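/- Let $k$ be a field of characteristic $0$ and let $V=V_0\oplus V_1$ be a $\mathbb Z_2$-graded Lie algebra over $k$ (the case $V_1=0$ is an ordinary Lie algebra), with bracket $l=[\cdot,\cdot]$ and an invariant inner product, i.e. an even, graded symmetric bilinear form $\langle\cdot,\cdot\rangle$ for which $v\mapsto\langle v,\cdot\rangle$ is an isomorphism $V\to V^*$, and with $\langle[x,y],z\rangle=\langle x,[y,z]\rangle$. In signs, a homogeneous object stands for its parity. **Cyclic cohomology.** A homogeneous $\varphi\in C^n(V)=\mathrm{Hom}(\bigwedge^nV,V)$ ($\bigwedge$ is the graded exterior power) is *cyclic* if $\langle\varphi(v_1,\dots,v_n),v_{n+1}\rangle=(-1)^{n+v_1\varphi}\langle v_1,\varphi(v_2,\dots,v_{n+1})\rangle$ for homogeneous $v_i$; put $\tilde\varphi(v_1,\dots,v_{n+1})=\langle\varphi(v_1,\dots,v_n),v_{n+1}\rangle$. Let $CC^n(V)_q$ be the space of cyclic cochains of degree $n\ge1$ and parity $q$, and let $HC^n(V)_q$, $n\ge 1$, be the cohomology of the complex $CC^1(V)_q\to CC^2(V)_q\to\cdots$ (so $HC^1(V)_q$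 is the kernel of $d$ on $CC^1(V)_q$) with the Lie algebra coboundary operator $$d\varphi(v_1,\dots,v_{n+1})=\sum_{\sigma\in Sh(2,n-1)}(-1)^\sigma\epsilon(\sigma)\,\varphi([v_{\sigma(1)},v_{\sigma(2)}],v_{\sigma(3)},\dots)-(-1)^{n-1}\sum_{\sigma\in Sh(n,1)}(-1)^\sigma\epsilon(\sigma)\,[\varphi(v_{\sigma(1)},\dots,v_{\sigma(n)}),v_{\sigma(n+1)}],$$ where $Sh$ denotes unshuffles and $\epsilon$ the Koszul sign. $H^n(V,k)_q$ is the Lie algebra cohomology with trivial coefficients (parity $q$ part). **$L_\infty$ structures.** An $L_\infty$ structure on a $\mathbb Z_2$-graded space $U$ is a sequence of maps $l_n:\bigwedge^nU\to U$ of parity $n$, $n\ge1$, such that the maps $d_n=\eta_1 l_n\eta_n^{-1}:\bigodot^n\Pi U\to\Pi U$ are the components of a coderivation of square zero of the (reduced) symmetric coalgebra $\bigodot\Pi U$ of the parity reversion; here $\eta_n(v_1\wedge\dots\wedge v_n)=(-1)^{(n-1)v_1+\dots+v_{n-1}}\pi v_1\odot\dots\odot\pi v_n$. **Deformations.** Let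 $t$ be a parameter of parity $p$ with $t^2=0$, and $V[t]=V\oplus tV$. An *infinitesimal deformation of $V$ into an $L_\infty$ algebra preserving the inner product*, with parameter $t$, is a graded $k[t]$-linear $L_\infty$ structure $l_t=l+t\lambda$ on $V[t]$ that reduces to $l$ modulo $t$ and all of whose components $l_{t,n}$ are cyclic for the $k[t]$-bilinear extension of $\langle\cdot,\cdot\rangle$; thus $\lambda=(\lambda_n)_{n\ge1}$ with $\lambda_n\in\mathrm{Hom}(\bigwedge^nV,V)$ of parity $p+n$. Two of them are *equivalent* if there is a $k[t]$-linear automorphism $F$ of the graded coalgebra $\bigodot\Pi V[t]$, with $F\equiv\mathrm{id}$ modulo $t$, that takes the one codifferential to the other and preserves the inner product: $F^*\omega=\omega$ for the constant form $\omega(\pi x,\pi y)=(-1)^x\langle x,y\rangle$ on $\Pi V[t]$. Here, if $F$ has components $f_n:\bigodot^n\Pi V[t]\to\Pi V[t]$, $F^*\omega=\omega$ means that for all homogeneous $w_1,\dots,w_N,x,y$ the sum $\sum_{I\sqcup J=\{1,\dots,N\}}\pm\,\omega(f_{|I|+1}(w_I,x),f_{|J|+1}(w_J,y))$, with Koszul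 signs, equals $\omega(x,y)$ if $N=0$ and $0$ if $N\ge1$. **Theorem.** The cyclic cohomology of $V$ classifies the infinitesimal deformations of $V$ into an $L_\infty$ algebra that preserve the inner product. Precisely: 1. For each parity $p$ of $t$, the map $l+t\lambda\mapsto(\lambda_n)_{n\ge1}$ is a bijection from these deformations onto the sequences of cyclic cocycles $\lambda_n$ of degree $n$ and parity $p+n$. Equivalence of deformations is an equivalence relation, and the map induces a bijection from the set of equivalence classes onto $\prod_{n\ge1}HC^n(V)_{p+n}$. 2. For each parity $q$, the map $\varphi\mapsto\tilde\varphi$ induces isomorphisms $HC^n(V)_q\cong H^{n+1}(V,k)_q$ for $n\ge2$, and an isomorphism of $HC^1(V)_q$ with the space of $2$-cocycles of parity $q$ in $\mathrm{Hom}(\bigwedge^2V,k)$. -/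

import Mathlib

noncomputable section

namespace CyclicLInfinity

/-- `Multi k n V M` is the space of `n`-linear maps `V × ⋯ × V → M` over `k`. -/
abbrev Multi (k : Type*) (n : ℕ) (V M : Type*) [Field k] [AddCommGroup V] [Module k V]
    [AddCommGroup M] [Module k M] : Type _ :=
  MultilinearMap k (fun _ : Fin n => V) M

/-! ### Signs, unshuffles -/

/-- The sign `(-1)^a` for a parity `a`. -/
def sgn (a : ZMod 2) : ℤˣ := (-1 : ℤˣ) ^ a

/-- The Koszul sign `ε(σ; v₁, …, vₙ)` for homogeneous `vᵢ` of parity `p i`: in the graded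
symmetric algebra, `v₁ ⊙ ⋯ ⊙ vₙ = ε(σ; v) v_{σ 1} ⊙ ⋯ ⊙ v_{σ n}`. -/
def koszul {n : ℕ} (p : Fin n → ZMod 2) (σ : Equiv.Perm (Fin n)) : ℤˣ :=
  ∏ i, ∏ j, if i < j ∧ σ j < σ i then sgn (p (σ i) * p (σ j)) else 1

/-- The unshuffles of type `(b, n - b)`: permutations that are increasing on the first `b`
positions and on the remaining ones. -/
def unshuffles (n b : ℕ) : Finset (Equiv.Perm (Fin n)) :=
  Finset.univ.filter fun σ =>
    ∀ i j : Fin n, i < j → ((j : ℕ) < b ∨ b ≤ (i : ℕ)) → σ i < σ j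

section Graded

variable {k V M : Type*} [Field k] [AddCommGroup V] [Module k V] [AddCommGroup M] [Module k M]

/-! ### Graded multilinear maps -/

/-- All `v i` are homogeneous, `v i` of parity `p i`. -/
def Homog (𝒱 : ZMod 2 → Submodule k V) {n : ℕ} (p : Fin n → ZMod 2) (v : Fin n → V) : Prop :=
  ∀ i, v i ∈ 𝒱 (p i)

/-- `φ` is homogeneous of parity `q`. -/
def HasParity (𝒱 : ZMod 2 → Submodule k V) (ℳ : ZMod 2 → Submodule k M) (q : ZMod 2) {n : ℕ}
    (φ : Multi k n V M) : Prop :=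
  ∀ p v, Homog 𝒱 p v → φ v ∈ ℳ (q + ∑ i, p i)

/-- `φ` is graded antisymmetric, i.e. factors through the graded exterior power `⋀ⁿ V`. -/
def IsGradedAlt (𝒱 : ZMod 2 → Submodule k V) {n : ℕ} (φ : Multi k n V M) : Prop :=
  ∀ (σ : Equiv.Perm (Fin n)) p v, Homog 𝒱 p v →
    φ v = (Equiv.Perm.sign σ * koszul p σ) • φ (fun i => v (σ i))

/-- `φ` is graded symmetric, i.e. factors through the graded symmetric power `⊙ⁿ V`. -/
def IsGradedSymm (𝒱 : ZMod 2 → Submodule k V) {n : ℕ} (φ : Multi k n V M) : Prop :=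
  ∀ (σ : Equiv.Perm (Fin n)) p v, Homog 𝒱 p v →
    φ v = koszul p σ • φ (fun i => v (σ i))

/-- The grading of the parity reversion `ΠV`, which is `V` as a module. -/
def parityReversion (𝒱 : ZMod 2 → Submodule k V) : ZMod 2 → Submodule k V := fun i => 𝒱 (i + 1)

/-- The grading of `k` itself, which is purely even. -/
def groundGrading (k : Type*) [Field k] : ZMod 2 → Submodule k k := fun i => if i = 0 then ⊤ else ⊥

/-- The projection of `V` onto its component of parity `i`. -/
def parityProj (𝒱 : ZMod 2 → Submodule k V) [DirectSum.Decomposition 𝒱] (i : ZMod 2) :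
    V →ₗ[k] V :=
  (𝒱 i).subtype ∘ₗ DirectSum.component k (ZMod 2) (fun j => 𝒱 j) i ∘ₗ
    (DirectSum.decomposeLinearEquiv 𝒱).toLinearMap

/-- The parity involution `v ↦ (-1)^v v`. -/
def parityInvolution (𝒱 : ZMod 2 → Submodule k V) [DirectSum.Decomposition 𝒱] : Module.End k V :=
  parityProj 𝒱 0 - parityProj 𝒱 1

/-! ### Compositions -/

/-- `(v₁, …, vₙ) ↦ φ (ψ (v₁, …, v_b), v_{b+1}, …, vₙ)`, where `n = b + a`. -/
def insertMap {n a b : ℕ} (h : b + a = n) (φ : Multi k (a + 1) V M) (ψ : Multi k b V V) :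
    Multi k n V M :=
  (MultilinearMap.uncurrySum (N := fun _ : Fin b ⊕ Fin a => V)
    (φ.curryLeft.compMultilinearMap ψ)).domDomCongr (finSumFinEquiv.trans (finCongr h))

theorem insertMap_apply {n a b : ℕ} (h : b + a = n) (φ : Multi k (a + 1) V M)
    (ψ : Multi k b V V) (v : Fin n → V) :
    insertMap h φ ψ v =
      φ (Fin.cons (ψ fun i => v (Fin.cast h (Fin.castAdd a i)))
        (fun j => v (Fin.cast h (Fin.natAdd b j)))) := by
  rfl

/-- The multilinear map that sends homogeneous `v₁, …, vₙ` to
`∑ (-1)^σ ε(σ; v) φ (ψ (v_{σ 1}, …, v_{σ b}), v_{σ (b+1)}, …, v_{σ n})`,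
the sum being over the unshuffles `σ` of type `(b, a)`. -/
def extComp (𝒱 : ZMod 2 → Submodule k V) [DirectSum.Decomposition 𝒱] {n a b : ℕ}
    (h : b + a = n) (φ : Multi k (a + 1) V M) (ψ : Multi k b V V) : Multi k n V M :=
  ∑ p : Fin n → ZMod 2, ∑ σ ∈ unshuffles n b,
    (Equiv.Perm.sign σ * koszul p σ) •
      ((insertMap h φ ψ).domDomCongr σ).compLinearMap (fun i => parityProj 𝒱 (p i))

/-- The cohomology `Z / B` given by cocycles `Z` and coboundaries `B`, written as `Z / (B ∩ Z)`
so that no proof of `B ⊆ Z` (that is, of `d ∘ d = 0`) is needed for the definition. -/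
abbrev Cohomology {X : Type*} [AddCommGroup X] [Module k X] (Z B : Submodule k X) : Type _ :=
  Z ⧸ B.submoduleOf Z

/-! ### Lie superalgebras, invariant inner products, cyclic cohomology -/

/-- `l` is the bracket of a `ℤ/2`-graded Lie algebra. -/
structure IsLieBracket (𝒱 : ZMod 2 → Submodule k V) (l : Multi k 2 V V) : Prop where
  even : HasParity 𝒱 𝒱 0 l
  antisymm : ∀ i j : ZMod 2, ∀ x ∈ 𝒱 i, ∀ y ∈ 𝒱 j, l ![x, y] = -(sgn (i * j) • l ![y, x])
  jacobi : ∀ i j : ZMod 2, ∀ x ∈ 𝒱 i, ∀ y ∈ 𝒱 j, ∀ z : V,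
    l ![x, l ![y, z]] = l ![l ![x, y], z] + sgn (i * j) • l ![y, l ![x, z]]

/-- `B` is an (even, graded symmetric, non-degenerate) inner product. Non-degeneracy means that
`v ↦ ⟨v, ·⟩` is an isomorphism from `V` onto its dual. -/
structure IsInnerProduct (𝒱 : ZMod 2 → Submodule k V) (B : V →ₗ[k] V →ₗ[k] k) : Prop where
  even : ∀ i j : ZMod 2, i ≠ j → ∀ x ∈ 𝒱 i, ∀ y ∈ 𝒱 j, B x y = 0
  symm : ∀ i j : ZMod 2, ∀ x ∈ 𝒱 i, ∀ y ∈ 𝒱 j, B x y = sgn (i * j) • B y x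
  nondegenerate : Function.Bijective B

/-- The inner product is invariant under the bracket. -/
def IsInvariantForm (l : Multi k 2 V V) (B : V →ₗ[k] V →ₗ[k] k) : Prop :=
  ∀ x y z : V, B (l ![x, y]) z = B x (l ![y, z])

/-- An `n`-linear map `φ` of parity `q` is cyclic with respect to the form `B`:
`⟨φ(v₁, …, vₙ), v_{n+1}⟩ = (-1)^{n + v₁ φ} ⟨v₁, φ(v₂, …, v_{n+1})⟩`. -/
def IsCyclic (𝒱 : ZMod 2 → Submodule k V) (B : V →ₗ[k] V →ₗ[k] M) (q : ZMod 2) {n : ℕ}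
    (φ : Multi k n V V) : Prop :=
  ∀ (p : Fin (n + 1) → ZMod 2) v, Homog 𝒱 p v →
    B (φ fun i => v i.castSucc) (v (Fin.last n)) =
      sgn ((n : ZMod 2) + p 0 * q) • B (v 0) (φ fun i => v i.succ)

/-- The space `CCⁿ(V)_q` of cyclic cochains of degree `n` and parity `q`. -/
def cyclicCochains (𝒱 : ZMod 2 → Submodule k V) (B : V →ₗ[k] V →ₗ[k] k) (q : ZMod 2) (n : ℕ) :
    Submodule k (Multi k n V V) where
  carrier := {φ | HasParity 𝒱 𝒱 q φ ∧ IsGradedAlt 𝒱 φ ∧ IsCyclic 𝒱 B q φ}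
  add_mem' := by
    rintro φ ψ ⟨h1, h2, h3⟩ ⟨h1', h2', h3'⟩
    refine ⟨fun p v hv => ?_, fun σ p v hv => ?_, fun p v hv => ?_⟩
    · exact add_mem (h1 p v hv) (h1' p v hv)
    · simp only [add_apply, smul_add]
      rw [h2 σ p v hv, h2' σ p v hv]
    · simp only [add_apply, map_add, smul_add, LinearMap.add_apply]
      rw [h3 p v hv, h3' p v hv]
  zero_mem' := by
    refine ⟨fun p v hv => ?_, fun σ p v hv => ?_, fun p v hv => ?_⟩ <;> simp
  smul_mem' := by
    rintro c φ ⟨h1, h2, h3⟩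
    refine ⟨fun p v hv => ?_, fun σ p v hv => ?_, fun p v hv => ?_⟩
    · exact Submodule.smul_mem _ _ (h1 p v hv)
    · simp only [smul_apply]
      rw [h2 σ p v hv, smul_comm]
    · simp only [smul_apply, map_smul, LinearMap.smul_apply]
      rw [h3 p v hv, smul_comm]

/-- The space `Cⁿ(V, k)_q` of scalar cochains of degree `n` and parity `q`. -/
def scalarCochains (𝒱 : ZMod 2 → Submodule k V) (q : ZMod 2) (n : ℕ) :
    Submodule k (Multi k n V k) where
  carrier := {f | HasParity 𝒱 (groundGrading k) q f ∧ IsGradedAlt 𝒱 f}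
  add_mem' := by
    rintro φ ψ ⟨h1, h2⟩ ⟨h1', h2'⟩
    refine ⟨fun p v hv => ?_, fun σ p v hv => ?_⟩
    · exact add_mem (h1 p v hv) (h1' p v hv)
    · simp only [add_apply, smul_add]
      rw [h2 σ p v hv, h2' σ p v hv]
  zero_mem' := by
    refine ⟨fun p v hv => ?_, fun σ p v hv => ?_⟩ <;> simp
  smul_mem' := by
    rintro c φ ⟨h1, h2⟩
    refine ⟨fun p v hv => ?_, fun σ p v hv => ?_⟩
    · exact Submodule.smul_mem _ _ (h1 p v hv)
    · simp only [smul_apply]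
      rw [h2 σ p v hv, smul_comm]

section Differential

variable (𝒱 : ZMod 2 → Submodule k V) [DirectSum.Decomposition 𝒱]

theorem insertMap_add_left {n a b : ℕ} (h : b + a = n) (φ φ' : Multi k (a + 1) V M)
    (ψ : Multi k b V V) : insertMap h (φ + φ') ψ = insertMap h φ ψ + insertMap h φ' ψ := by
  ext v; simp [insertMap_apply]

theorem insertMap_smul_left {n a b : ℕ} (h : b + a = n) (c : k) (φ : Multi k (a + 1) V M)
    (ψ : Multi k b V V) : insertMap h (c • φ) ψ = c • insertMap h φ ψ := by
  ext v; simp [insertMap_apply]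

theorem insertMap_add_right {n a b : ℕ} (h : b + a = n) (φ : Multi k (a + 1) V M)
    (ψ ψ' : Multi k b V V) : insertMap h φ (ψ + ψ') = insertMap h φ ψ + insertMap h φ ψ' := by
  ext v; simp [insertMap_apply, MultilinearMap.cons_add]

theorem insertMap_smul_right {n a b : ℕ} (h : b + a = n) (c : k) (φ : Multi k (a + 1) V M)
    (ψ : Multi k b V V) : insertMap h φ (c • ψ) = c • insertMap h φ ψ := by
  ext v; simp [insertMap_apply, MultilinearMap.cons_smul]

theorem extComp_apply {n a b : ℕ} (h : b + a = n) (φ : Multi k (a + 1) V M)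
    (ψ : Multi k b V V) (v : Fin n → V) :
    extComp 𝒱 h φ ψ v = ∑ p : Fin n → ZMod 2, ∑ σ ∈ unshuffles n b,
      (Equiv.Perm.sign σ * koszul p σ) •
        insertMap h φ ψ (fun i => parityProj 𝒱 (p (σ i)) (v (σ i))) := by
  simp only [extComp, sum_apply]
  rfl

theorem extComp_add_left {n a b : ℕ} (h : b + a = n) (φ φ' : Multi k (a + 1) V M)
    (ψ : Multi k b V V) : extComp 𝒱 h (φ + φ') ψ = extComp 𝒱 h φ ψ + extComp 𝒱 h φ' ψ := by
  ext v; simp [extComp_apply, insertMap_add_left, Finset.sum_add_distrib]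

theorem extComp_add_right {n a b : ℕ} (h : b + a = n) (φ : Multi k (a + 1) V M)
    (ψ ψ' : Multi k b V V) : extComp 𝒱 h φ (ψ + ψ') = extComp 𝒱 h φ ψ + extComp 𝒱 h φ ψ' := by
  ext v; simp [extComp_apply, insertMap_add_right, Finset.sum_add_distrib]

theorem extComp_smul_left {n a b : ℕ} (h : b + a = n) (c : k) (φ : Multi k (a + 1) V M)
    (ψ : Multi k b V V) : extComp 𝒱 h (c • φ) ψ = c • extComp 𝒱 h φ ψ := by
  ext v
  simp only [extComp_apply, insertMap_smul_left, smul_apply, Finset.smul_sum]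
  exact Finset.sum_congr rfl fun p _ => Finset.sum_congr rfl fun σ _ => smul_comm _ _ _

theorem extComp_smul_right {n a b : ℕ} (h : b + a = n) (c : k) (φ : Multi k (a + 1) V M)
    (ψ : Multi k b V V) : extComp 𝒱 h φ (c • ψ) = c • extComp 𝒱 h φ ψ := by
  ext v
  simp only [extComp_apply, insertMap_smul_right, smul_apply, Finset.smul_sum]
  exact Finset.sum_congr rfl fun p _ => Finset.sum_congr rfl fun σ _ => smul_comm _ _ _

/-- The Lie algebra coboundary `Cⁿ(V, k) → Cⁿ⁺¹(V, k)` with trivial coefficients, `n = a + 1`: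
`(df)(v) = ∑ (-1)^σ ε(σ) f([v_{σ 1}, v_{σ 2}], v_{σ 3}, …, v_{σ (n+1)})`. -/
def scalarDifferential (l : Multi k 2 V V) (a : ℕ) :
    Multi k (a + 1) V k →ₗ[k] Multi k (a + 2) V k where
  toFun f := extComp 𝒱 (Nat.add_comm 2 a) f l
  map_add' f g := extComp_add_left 𝒱 _ f g l
  map_smul' c f := extComp_smul_left 𝒱 _ c f l

/-- The Lie algebra coboundary `Cⁿ(V) → Cⁿ⁺¹(V)` with adjoint coefficients, `n = a + 1`:
`(dφ)(v) = ∑ (-1)^σ ε(σ) φ([v_{σ 1}, v_{σ 2}], v_{σ 3}, …, v_{σ (n+1)})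
  - (-1)^{n-1} ∑ (-1)^σ ε(σ) [φ(v_{σ 1}, …, v_{σ n}), v_{σ (n+1)}]`. -/
def lieDifferential (l : Multi k 2 V V) (a : ℕ) :
    Multi k (a + 1) V V →ₗ[k] Multi k (a + 2) V V where
  toFun φ := extComp 𝒱 (Nat.add_comm 2 a) φ l - sgn a • extComp 𝒱 (a := 1) rfl l φ
  map_add' φ ψ := by
    rw [extComp_add_left, extComp_add_right, smul_add, add_sub_add_comm]
  map_smul' c φ := by
    rw [extComp_smul_left, extComp_smul_right, RingHom.id_apply, smul_sub, smul_comm c]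

/-- The cyclic cocycles of degree `a + 1` and parity `q`. -/
def cyclicCocycles (l : Multi k 2 V V) (B : V →ₗ[k] V →ₗ[k] k) (q : ZMod 2) (a : ℕ) :
    Submodule k (Multi k (a + 1) V V) :=
  cyclicCochains 𝒱 B q (a + 1) ⊓ LinearMap.ker (lieDifferential 𝒱 l a)

/-- The cyclic coboundaries of degree `a + 1` and parity `q`. The complex of cyclic cochains
starts in degree `1`, so there are none in degree `1`. -/
def cyclicCoboundaries (l : Multi k 2 V V) (B : V →ₗ[k] V →ₗ[k] k) (q : ZMod 2) :
    (a : ℕ) → Submodule k (Multi k (a + 1) V V)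
  | 0 => ⊥
  | a + 1 => (cyclicCochains 𝒱 B q (a + 1)).map (lieDifferential 𝒱 l a)

/-- The cyclic cohomology `HCⁿ(V)_q` in degree `n = a + 1` and parity `q`. -/
abbrev CyclicCohomology (l : Multi k 2 V V) (B : V →ₗ[k] V →ₗ[k] k) (q : ZMod 2) (a : ℕ) :
    Type _ :=
  Cohomology (cyclicCocycles 𝒱 l B q a) (cyclicCoboundaries 𝒱 l B q a)

/-- The cocycles of degree `a + 1` and parity `q` with trivial coefficients. -/
def scalarCocycles (l : Multi k 2 V V) (q : ZMod 2) (a : ℕ) :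
    Submodule k (Multi k (a + 1) V k) :=
  scalarCochains 𝒱 q (a + 1) ⊓ LinearMap.ker (scalarDifferential 𝒱 l a)

/-- The coboundaries of degree `a + 1` and parity `q` with trivial coefficients. There are none
in degree `1`, because the coboundary of a cochain of degree `0` vanishes. -/
def scalarCoboundaries (l : Multi k 2 V V) (q : ZMod 2) :
    (a : ℕ) → Submodule k (Multi k (a + 1) V k)
  | 0 => ⊥
  | a + 1 => (scalarCochains 𝒱 q (a + 1)).map (scalarDifferential 𝒱 l a)

/-- The Lie algebra cohomology `Hⁿ(V, k)_q` in degree `n = a + 1` and parity `q`. -/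
abbrev ScalarCohomology (l : Multi k 2 V V) (q : ZMod 2) (a : ℕ) : Type _ :=
  Cohomology (scalarCocycles 𝒱 l q a) (scalarCoboundaries 𝒱 l q a)

end Differential

/-- The form `φ~(v₁, …, v_{n+1}) = ⟨φ(v₁, …, vₙ), v_{n+1}⟩`. -/
def tilde (B : V →ₗ[k] V →ₗ[k] k) {n : ℕ} (φ : Multi k n V V) : Multi k (n + 1) V k :=
  (B.compMultilinearMap φ).uncurryRight

/-! ### L∞ structures

The exterior coalgebra of `V` is identified with the symmetric coalgebra of `ΠV` through
`η(v₁ ∧ ⋯ ∧ vₙ) = (-1)^{(n-1) v₁ + ⋯ + v_{n-1}} πv₁ ⊙ ⋯ ⊙ πvₙ`. Coderivations and coalgebra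
endomorphisms of the symmetric coalgebra are given by their components `⊙ⁿ ΠV → ΠV`, `n ≥ 1`;
families are indexed by all `n`, with vanishing component for `n = 0`. -/

/-- The map `η₁ ∘ φ ∘ ηₙ⁻¹` on `ΠV` that corresponds to the map `φ` on `V`. -/
def suspend (𝒱 : ZMod 2 → Submodule k V) [DirectSum.Decomposition 𝒱] {n : ℕ}
    (φ : Multi k n V V) : Multi k n V V :=
  φ.compLinearMap fun i => parityInvolution 𝒱 ^ (n - 1 - (i : ℕ))

/-- The value at `w₁ ⊙ ⋯ ⊙ w_N` of the corestriction to `W` of the composite of a map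
`f : ⊙W → W` with the coderivation of `⊙W` that has components `d n : ⊙ⁿ W → W`. The `w i` are
homogeneous of parity `p i`. -/
def symComp (f d : ∀ n, Multi k n V V) {N : ℕ} (p : Fin N → ZMod 2) (w : Fin N → V) : V :=
  ∑ b : Fin (N + 1), ∑ σ ∈ unshuffles N b,
    koszul p σ • insertMap (a := N - b) (b := b) (by omega) (f (N - b + 1)) (d b)
      (fun i => w (σ i))

/-- The maps `l n : ⋀ⁿ V → V` define an `L∞` structure on `V`: `l n` has parity `n`, and the
corresponding maps on `W = ΠV` are the components of an odd coderivation of `⊙W` whose square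
is zero. -/
structure IsLInfinity (𝒱 : ZMod 2 → Submodule k V) [DirectSum.Decomposition 𝒱]
    (l : ∀ n, Multi k n V V) : Prop where
  zero : l 0 = 0
  parity : ∀ n : ℕ, HasParity 𝒱 𝒱 n (l n)
  alt : ∀ n, IsGradedAlt 𝒱 (l n)
  sq_zero : ∀ N (p : Fin N → ZMod 2) w, Homog (parityReversion 𝒱) p w →
    symComp (fun n => suspend 𝒱 (l n)) (fun n => suspend 𝒱 (l n)) p w = 0

/-- The family `l₂ = l`, `lₙ = 0` for `n ≠ 2` given by a bracket. -/
def ofBracket (l : Multi k 2 V V) : ∀ n, Multi k n V V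
  | 2 => l
  | _ => 0

/-- The Koszul sign of `w₁ ⊙ ⋯ ⊙ w_N ↦ w_{c₁} ⊙ ⋯ ⊙ w_{c_r}`, where `c₁, …, c_r` are the blocks
of the partition `c` of `{1, …, N}` and `w_{c_m}` is the product of the `wᵢ` with `i ∈ c_m`,
in increasing order of `i`. -/
def partitionSign {N : ℕ} (p : Fin N → ZMod 2) (c : OrderedFinpartition N) : ℤˣ :=
  ∏ i, ∏ j, if i < j ∧ c.index j < c.index i then sgn (p i * p j) else 1

/-- The value at `w₁ ⊙ ⋯ ⊙ w_N` of the corestriction to `W` of the composite of a map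
`d : ⊙W → W` with the coalgebra endomorphism of `⊙W` that has (even) components
`f n : ⊙ⁿ W → W`. -/
def morComp (d f : ∀ n, Multi k n V V) {N : ℕ} (p : Fin N → ZMod 2) (w : Fin N → V) : V :=
  ∑ c : OrderedFinpartition N, partitionSign p c •
    d c.length (fun m => f (c.partSize m) (fun j => w (c.emb m j)))

/-- The maps `f n` are the components of a coalgebra endomorphism `F` of `⊙(ΠV)` (even and
degree preserving) with `F ∘ d = d' ∘ F`, where `d`, `d'` are the coderivations that correspond
to `l`, `l'`. -/
structure IsLInfinityMorphism (𝒱 : ZMod 2 → Submodule k V) [DirectSum.Decomposition 𝒱]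
    (l l' f : ∀ n, Multi k n V V) : Prop where
  zero : f 0 = 0
  parity : ∀ n, HasParity (parityReversion 𝒱) (parityReversion 𝒱) 0 (f n)
  symm : ∀ n, IsGradedSymm (parityReversion 𝒱) (f n)
  intertwines : ∀ N (p : Fin N → ZMod 2) w, Homog (parityReversion 𝒱) p w →
    symComp f (fun n => suspend 𝒱 (l n)) p w = morComp (fun n => suspend 𝒱 (l' n)) f p w

/-- The Koszul sign of `w₁ ⊙ ⋯ ⊙ w_N ⊙ x ↦ w_I ⊙ x ⊙ w_J`, where `J` is the complement of `I`
and `x` has parity `a`. -/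
def subsetSign {N : ℕ} (p : Fin N → ZMod 2) (a : ZMod 2) (I : Finset (Fin N)) : ℤˣ :=
  (∏ i, ∏ j, if i < j ∧ i ∉ I ∧ j ∈ I then sgn (p i * p j) else 1) * sgn (a * ∑ j ∈ Iᶜ, p j)

/-- `f (w_I, x)`, the elements `wᵢ`, `i ∈ I`, being listed in increasing order of `i`. -/
def evalSubset (f : ∀ n, Multi k n V V) {N : ℕ} (w : Fin N → V) (I : Finset (Fin N)) (x : V) : V :=
  f (I.card + 1) (Fin.snoc (α := fun _ => V) (fun j => w (I.orderEmbOfFin rfl j)) x)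

/-- The coalgebra endomorphism of `⊙(ΠV)` with components `f n` preserves the inner product `B`.
The inner product gives a constant graded antisymmetric form `ω(πx, πy) = (-1)^x ⟨x, y⟩` on `ΠV`,
and the condition is `F^* ω = ω`, i.e.
`∑_{I ⊔ J = {1, …, N}} ± ω(f(w_I, x), f(w_J, y))` equals `ω(x, y)` if `N = 0`, and `0` if
`N ≥ 1`. If only `f₁ ≠ 0`, this says `⟨f₁ x, f₁ y⟩ = ⟨x, y⟩`. -/
def PreservesInnerProduct (𝒱 : ZMod 2 → Submodule k V) [DirectSum.Decomposition 𝒱]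
    (B : V →ₗ[k] V →ₗ[k] M) (f : ∀ n, Multi k n V V) : Prop :=
  ∀ N (p : Fin N → ZMod 2) w (a b : ZMod 2) (x y : V), Homog (parityReversion 𝒱) p w →
    x ∈ parityReversion 𝒱 a → y ∈ parityReversion 𝒱 b →
    ∑ I : Finset (Fin N), subsetSign p a I •
        B (parityInvolution 𝒱 (evalSubset f w I x)) (evalSubset f w Iᶜ y) =
      if N = 0 then B (parityInvolution 𝒱 x) y else 0

/-! ### Infinitesimal deformations

Let `t` be a parameter of parity `p`, with `t² = 0`. The module `V[t] = V ⊕ tV` is modelled on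
`V × V`, the pair `(x, y)` standing for `x + t y`. -/

/-- The grading of `V[t]`. -/
def extGrading (𝒱 : ZMod 2 → Submodule k V) (p : ZMod 2) : ZMod 2 → Submodule k (V × V) :=
  fun i => (𝒱 i).prod (𝒱 (i - p))

theorem parityProj_of_mem (𝒱 : ZMod 2 → Submodule k V) [DirectSum.Decomposition 𝒱] {i : ZMod 2}
    {x : V} (hx : x ∈ 𝒱 i) : parityProj 𝒱 i x = x :=
  DirectSum.decompose_of_mem_same 𝒱 hx

theorem parityProj_of_mem_ne (𝒱 : ZMod 2 → Submodule k V) [DirectSum.Decomposition 𝒱]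
    {i j : ZMod 2} {x : V} (hx : x ∈ 𝒱 i) (h : i ≠ j) : parityProj 𝒱 j x = 0 :=
  DirectSum.decompose_of_mem_ne 𝒱 hx h

theorem sum_parityProj (𝒱 : ZMod 2 → Submodule k V) [DirectSum.Decomposition 𝒱] (x : V) :
    ∑ i, parityProj 𝒱 i x = x := by
  classical
  induction x using DirectSum.Decomposition.inductionOn 𝒱 with
  | zero => simp
  | @homogeneous i m =>
    rw [Finset.sum_eq_single i]
    · exact parityProj_of_mem 𝒱 m.2
    · intro j _ hj
      exact parityProj_of_mem_ne 𝒱 m.2 (Ne.symm hj)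
    · intro h; exact absurd (Finset.mem_univ i) h
  | add m m' h h' => simp only [map_add, Finset.sum_add_distrib, h, h']

theorem sum_parityProj_sub (𝒱 : ZMod 2 → Submodule k V) [DirectSum.Decomposition 𝒱] (p : ZMod 2)
    (x : V) : ∑ i, parityProj 𝒱 (i - p) x = x := by
  exact (Equiv.sum_comp (Equiv.subRight p) fun i => parityProj 𝒱 i x).trans (sum_parityProj 𝒱 x)

/-- `V[t]` is the direct sum of its homogeneous components. -/
instance extDecomposition (𝒱 : ZMod 2 → Submodule k V) [DirectSum.Decomposition 𝒱] (p : ZMod 2) :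
    DirectSum.Decomposition (extGrading 𝒱 p) :=
  DirectSum.Decomposition.ofLinearMap (extGrading 𝒱 p)
    (∑ i : ZMod 2, DirectSum.lof k (ZMod 2) (fun j => extGrading 𝒱 p j) i ∘ₗ
      ((parityProj 𝒱 i).prodMap (parityProj 𝒱 (i - p))).codRestrict (extGrading 𝒱 p i)
        (fun z => ⟨Subtype.prop _, Subtype.prop _⟩))
    (by
      refine LinearMap.ext fun z => ?_
      simp only [LinearMap.comp_apply, LinearMap.sum_apply, map_sum, DirectSum.coeLinearMap_lof,
        LinearMap.id_apply]
      exact Prod.ext (by rw [Prod.fst_sum]; exact sum_parityProj 𝒱 z.1)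
        (by rw [Prod.snd_sum]; exact sum_parityProj_sub 𝒱 p z.2))
    (by
      refine DirectSum.linearMap_ext k fun i => LinearMap.ext fun z => ?_
      obtain ⟨⟨x, y⟩, hx, hy⟩ := z
      simp only [LinearMap.comp_apply, DirectSum.coeLinearMap_lof, LinearMap.sum_apply,
        LinearMap.id_apply]
      rw [Finset.sum_eq_single i]
      · congr 1
        exact Subtype.ext (Prod.ext (parityProj_of_mem 𝒱 hx) (parityProj_of_mem 𝒱 hy))
      · intro j _ hj
        refine (congrArg _ ?_).trans (map_zero (DirectSum.lof k (ZMod 2)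
          (fun j => extGrading 𝒱 p j) j))
        refine Subtype.ext (Prod.ext (parityProj_of_mem_ne 𝒱 hx (Ne.symm hj))
          (parityProj_of_mem_ne 𝒱 hy fun h => hj (sub_left_injective h).symm))
      · intro h; exact absurd (Finset.mem_univ i) h)

/-- Multiplication by `t` on `V[t]`: it sends `x + t y` to `t x`. -/
def mulT : Module.End k (V × V) := LinearMap.inr k V V ∘ₗ LinearMap.fst k V V

/-- A multilinear map `φ` of parity `q` on `V[t]` is graded linear over `k[t]`:
`φ(v₁, …, t vᵢ, …, vₙ) = (-1)^{t (φ + v₁ + ⋯ + v_{i-1})} t φ(v₁, …, vₙ)`. -/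
def IsGradedTLinear (𝒰 : ZMod 2 → Submodule k (V × V)) (p q : ZMod 2) {n : ℕ}
    (φ : Multi k n (V × V) (V × V)) : Prop :=
  ∀ (r : Fin n → ZMod 2) v, Homog 𝒰 r v → ∀ i : Fin n,
    φ (Function.update v i (mulT (k := k) (v i))) =
      sgn (p * (q + ∑ j ∈ Finset.Iio i, r j)) • mulT (k := k) (φ v)

/-- The extension of an even form `B` on `V` to a form on `V[t]` with values in `k[t]`, again
modelled on pairs:
`⟨x + t y, x' + t y'⟩ = ⟨x, x'⟩ + t (⟨y, x'⟩ + (-1)^{t x} ⟨x, y'⟩)`. -/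
def extForm (𝒱 : ZMod 2 → Submodule k V) [DirectSum.Decomposition 𝒱] (p : ZMod 2)
    (B : V →ₗ[k] V →ₗ[k] k) : (V × V) →ₗ[k] (V × V) →ₗ[k] (k × k) :=
  LinearMap.mk₂ k
    (fun z z' => (B z.1 z'.1,
      B z.2 z'.1 + B (if p = 0 then z.1 else parityInvolution 𝒱 z.1) z'.2))
    (by intro z₁ z₂ z'; ext <;> split_ifs <;> simp <;> abel)
    (by intro c z z'; ext <;> split_ifs <;> simp [mul_add])
    (by intro z z₁ z₂; ext <;> split_ifs <;> simp <;> abel)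
    (by intro c z z'; ext <;> split_ifs <;> simp [mul_add])

/-- An infinitesimal deformation `l_t = l + t λ` of the graded Lie algebra `(V, l)` into an `L∞`
algebra, with a parameter `t` of parity `p`, `t² = 0`, that preserves the inner product `B`: a
`k[t]`-linear `L∞` structure on `V[t]` that reduces to `l` modulo `t`, and for which the inner
product of `V[t]` is invariant. -/
structure Deformation (𝒱 : ZMod 2 → Submodule k V) [DirectSum.Decomposition 𝒱]
    (l : Multi k 2 V V) (B : V →ₗ[k] V →ₗ[k] k) (p : ZMod 2) where
  /-- The operations of the deformed structure. -/
  op : ∀ n, Multi k n (V × V) (V × V)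
  isLInfinity : IsLInfinity (extGrading 𝒱 p) op
  isGradedTLinear : ∀ n : ℕ, IsGradedTLinear (extGrading 𝒱 p) p n (op n)
  reduces : ∀ n (z : Fin n → V × V), (op n z).1 = ofBracket l n fun i => (z i).1
  invariant : ∀ n : ℕ, IsCyclic (extGrading 𝒱 p) (extForm 𝒱 p B) n (op n)

/-- The component `λₙ` of the deformation `l_t = l + t λ`. -/
def Deformation.cochain {𝒱 : ZMod 2 → Submodule k V} [DirectSum.Decomposition 𝒱]
    {l : Multi k 2 V V} {B : V →ₗ[k] V →ₗ[k] k} {p : ZMod 2} (m : Deformation 𝒱 l B p) (n : ℕ) :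
    Multi k n V V :=
  (LinearMap.snd k V V).compMultilinearMap ((m.op n).compLinearMap fun _ => LinearMap.inl k V V)

/-- Two deformations are equivalent if there is a `k[t]`-linear coalgebra automorphism of
`⊙(ΠV[t])` that is the identity modulo `t`, takes the one codifferential to the other, and
preserves the inner product. (An endomorphism that is the identity modulo `t` is invertible.) -/
def Deformation.IsEquivalent {𝒱 : ZMod 2 → Submodule k V} [DirectSum.Decomposition 𝒱]
    {l : Multi k 2 V V} {B : V →ₗ[k] V →ₗ[k] k} {p : ZMod 2} (m m' : Deformation 𝒱 l B p) : Prop :=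
  ∃ f : ∀ n, Multi k n (V × V) (V × V),
    IsLInfinityMorphism (extGrading 𝒱 p) m.op m'.op f ∧
    (∀ n, IsGradedTLinear (parityReversion (extGrading 𝒱 p)) p 0 (f n)) ∧
    (∀ z : Fin 1 → V × V, (f 1 z).1 = (z 0).1) ∧
    (∀ n, n ≠ 1 → ∀ z : Fin n → V × V, (f n z).1 = 0) ∧
    PreservesInnerProduct (extGrading 𝒱 p) (extForm 𝒱 p B) f

end Graded

end CyclicLInfinity

end

open CyclicLInfinity

noncomputable section

namespace CyclicLInfinity

/-! ### Signs -/

/-! Since t² = 0, every condition on a deformation or on an equivalence becomes linear in the part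
of order t.

A `k[t]`-linear operation that vanishes modulo t is t times a map on V. A deformation is therefore
the extended bracket plus tλ_n (`IsGradedTLinear.eq_tPart`, `Deformation.op_eq`), and parity,
antisymmetry and cyclicity of l_t amount to those of λ_n, the parity being shifted by that of t. In
the square of the codifferential, the order 0 part vanishes by the Jacobi identity and the order t
part consists of the composites of l with λ. As l has arity two, the component with n + 1 inputs
involves λ_n alone, and it is dλ_n up to sign (`totalComp_deformOp`). So l_t is an L∞ structure
exactly if each λ_n is a cocycle.

An automorphism that is the identity modulo t has the form id + tφ (`eq_equivMap`). Comparison of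
the terms of order t shows that it takes λ to λ' exactly if λ' - λ = dφ (`intertwines_iff`), and
that it preserves ω exactly if all φ_n are cyclic (`preservesInnerProduct_iff`). As φ_0 = 0, nothing
is divided out in degree 1. Equivalent thus means cohomologous in the cyclic complex, which gives
both the equivalence relation and the bijection on classes.

For the second part, nondegeneracy makes φ ↦ φ~ a bijection on multilinear maps. Antisymmetry of φ
is antisymmetry of φ~ under the permutations that fix the last argument, and cyclicity is
antisymmetry under the rotation; together these generate the symmetric group
(`tilde_mem_scalarCochains_iff`). Invariance of the form identifies the differentials
(`scalarDifferential_tilde`). The cyclic complex is thus the scalar complex, shifted by one and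
truncated: scalar 1-cochains have no counterpart, so degree 1 yields all 2-cocycles.

The definitions on ΠV are carried over to V by two sign rules: `koszul_add_one` for permutations and
`suspSign_insert` for composites. -/

@[simp] theorem sgn_zero : sgn 0 = 1 := by simp [sgn]

@[simp] theorem sgn_one : sgn 1 = -1 := by simp [sgn]

theorem sgn_add (a b : ZMod 2) : sgn (a + b) = sgn a * sgn b := uzpow_add _ _ _

@[simp] theorem sgn_mul_self (a : ZMod 2) : sgn a * sgn a = 1 := Int.units_mul_self _

theorem sgn_sum {ι : Type*} (s : Finset ι) (f : ι → ZMod 2) :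
    sgn (∑ i ∈ s, f i) = ∏ i ∈ s, sgn (f i) := by
  classical
  induction s using Finset.induction_on with
  | empty => simp
  | insert i s hi ih => rw [Finset.sum_insert hi, Finset.prod_insert hi, sgn_add, ih]

theorem sgn_smul_smul {X : Type*} [AddCommGroup X] (a b : ZMod 2) (x : X) :
    sgn a • sgn b • x = sgn (a + b) • x := by
  rw [sgn_add, mul_smul]

theorem units_smul_self_smul {X : Type*} [AddCommGroup X] (u : ℤˣ) (x : X) : u • u • x = x := by
  rw [smul_smul, Int.units_mul_self, one_smul]

/-- Equalities in `ZMod 2` up to multiples of `2`. -/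
theorem two_eq_zero : (2 : ZMod 2) = 0 := rfl

theorem zmod2_add_self (a : ZMod 2) : a + a = 0 := CharTwo.add_self_eq_zero a

/-! ### Products over pairs of indices -/

/-- Collects the factors of (u, v) and (v, u), so that sign identities can be checked one unordered
pair at a time. -/
theorem prod_prod_eq_prod_lt {n : ℕ} (X : Fin n → Fin n → ℤˣ) (h : ∀ u, X u u = 1) :
    ∏ u, ∏ v, X u v = ∏ u, ∏ v, if u < v then X u v * X v u else 1 := by
  have h1 : (∏ u, ∏ v, if u < v then X v u else 1) = ∏ u, ∏ v, if v < u then X u v else 1 :=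
    Finset.prod_comm
  have h2 : (∏ u, ∏ v, if u < v then X u v * X v u else 1) =
      (∏ u, ∏ v, if u < v then X u v else 1) * ∏ u, ∏ v, if u < v then X v u else 1 := by
    simp only [← Finset.prod_mul_distrib]
    refine Finset.prod_congr rfl fun u _ => Finset.prod_congr rfl fun v _ => ?_
    split_ifs <;> simp
  rw [h2, h1]
  simp only [← Finset.prod_mul_distrib]
  refine Finset.prod_congr rfl fun u _ => Finset.prod_congr rfl fun v _ => ?_
  rcases lt_trichotomy u v with huv | rfl | huv
  · simp [huv, huv.not_gt]
  · simp [h]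
  · simp [huv, huv.not_gt]

/-- Inversions are counted by the pair of elements exchanged instead of the pair of positions; the
parities then no longer involve σ, and signs of different permutations can be compared factor by
factor. -/
theorem koszul_eq_prod_labels {n : ℕ} (p : Fin n → ZMod 2) (σ : Equiv.Perm (Fin n)) :
    koszul p σ = ∏ u, ∏ v, if u < v ∧ σ.symm v < σ.symm u then sgn (p u * p v) else 1 := by
  symm
  rw [Finset.prod_comm, koszul, ← Equiv.prod_comp σ]
  refine Finset.prod_congr rfl fun i _ => ?_
  rw [← Equiv.prod_comp σ]
  refine Finset.prod_congr rfl fun j _ => ?_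
  simp only [Equiv.symm_apply_apply, and_comm, mul_comm]

theorem koszul_comp_eq_prod_labels {n : ℕ} (p : Fin n → ZMod 2) (σ τ : Equiv.Perm (Fin n)) :
    koszul (fun i => p (σ i)) τ = ∏ u, ∏ v,
      if σ.symm u < σ.symm v ∧ τ.symm (σ.symm v) < τ.symm (σ.symm u) then sgn (p u * p v) else 1 := by
  rw [koszul_eq_prod_labels, ← Equiv.prod_comp σ.symm]
  refine Finset.prod_congr rfl fun i _ => ?_
  rw [← Equiv.prod_comp σ.symm]
  refine Finset.prod_congr rfl fun j _ => ?_
  simp only [Equiv.apply_symm_apply]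

/-- A pair of elements is inverted by the product exactly if one, but not both, of the two steps
exchanges it; a pair exchanged twice contributes a square. -/
theorem koszul_mul {n : ℕ} (p : Fin n → ZMod 2) (σ τ : Equiv.Perm (Fin n)) :
    koszul p (σ * τ) = koszul p σ * koszul (fun i => p (σ i)) τ := by
  rw [koszul_comp_eq_prod_labels, prod_prod_eq_prod_lt _ (by simp), koszul_eq_prod_labels,
    koszul_eq_prod_labels]
  simp only [← Finset.prod_mul_distrib]
  refine Finset.prod_congr rfl fun u _ => Finset.prod_congr rfl fun v _ => ?_
  by_cases huv : u < v
  · have h1 : σ.symm u ≠ σ.symm v := fun h => huv.ne (σ.symm.injective h)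
    have h2 : τ.symm (σ.symm u) ≠ τ.symm (σ.symm v) := fun h => h1 (τ.symm.injective h)
    have h3 : ∀ w, (σ * τ).symm w = τ.symm (σ.symm w) := fun _ => rfl
    simp only [huv, true_and, if_true, h3, mul_comm (p v) (p u)]
    rcases h1.lt_or_gt with h1 | h1 <;> rcases h2.lt_or_gt with h2 | h2 <;>
      simp [h1, h2, h1.not_gt, h2.not_gt]
  · simp [huv]

@[simp] theorem koszul_refl {n : ℕ} (p : Fin n → ZMod 2) : koszul p 1 = 1 := by
  refine Finset.prod_eq_one fun i _ => Finset.prod_eq_one fun j _ => if_neg ?_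
  rintro ⟨h1, h2⟩
  exact h1.not_gt h2

theorem sign_eq_prod_labels {n : ℕ} (σ : Equiv.Perm (Fin n)) :
    Equiv.Perm.sign σ = ∏ u, ∏ v, if u < v ∧ σ.symm v < σ.symm u then -1 else (1 : ℤˣ) := by
  rw [← Equiv.Perm.sign_symm, Equiv.Perm.sign_eq_prod_prod_Ioi]
  refine Finset.prod_congr rfl fun u _ => ?_
  rw [← Finset.prod_subset (Finset.subset_univ (Finset.Ioi u))]
  · refine Finset.prod_congr rfl fun v hv => ?_
    have hv := Finset.mem_Ioi.1 hv
    have h1 : σ.symm u ≠ σ.symm v := fun h => hv.ne (σ.symm.injective h)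
    rcases h1.lt_or_gt with h1 | h1 <;> simp [hv, h1, h1.not_gt]
  · intro v _ hv
    rw [if_neg]
    exact fun h => hv (Finset.mem_Ioi.2 h.1)

/-- The sign of the identification of `v₁ ∧ ⋯ ∧ vₙ` with `πv₁ ⊙ ⋯ ⊙ πvₙ`. -/
def suspSign {n : ℕ} (p : Fin n → ZMod 2) : ℤˣ := sgn (∑ i : Fin n, ((n - 1 - (i : ℕ) : ℕ) : ZMod 2) * p i)

theorem suspSign_eq_prod {n : ℕ} (p : Fin n → ZMod 2) :
    suspSign p = ∏ u, ∏ v, if u < v then sgn (p u) else 1 := by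
  rw [suspSign, sgn_sum]
  refine Finset.prod_congr rfl fun u _ => ?_
  rw [← Finset.prod_filter, Finset.prod_const, Finset.filter_lt_eq_Ioi, Fin.card_Ioi]
  generalize n - 1 - (u : ℕ) = m
  induction m with
  | zero => simp
  | succ m ih => rw [Nat.cast_succ, add_mul, sgn_add, ih, pow_succ, one_mul]

theorem suspSign_comp {n : ℕ} (p : Fin n → ZMod 2) (σ : Equiv.Perm (Fin n)) :
    suspSign (fun i => p (σ i)) = ∏ u, ∏ v, if σ.symm u < σ.symm v then sgn (p u) else 1 := by
  rw [suspSign_eq_prod, ← Equiv.prod_comp σ.symm]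
  refine Finset.prod_congr rfl fun i _ => ?_
  rw [← Equiv.prod_comp σ.symm]
  refine Finset.prod_congr rfl fun j _ => ?_
  simp only [Equiv.apply_symm_apply]

/-- For an inverted pair, (p u + 1)(p v + 1) = p u p v + (p u + p v) + 1. The last summand gives the
signature, and p u + p v is the change of the suspension sign. This is why η turns exterior powers
into symmetric ones. -/
theorem koszul_add_one {n : ℕ} (p : Fin n → ZMod 2) (σ : Equiv.Perm (Fin n)) :
    koszul (fun i => p i + 1) σ =
      Equiv.Perm.sign σ * koszul p σ * (suspSign p * suspSign fun i => p (σ i)) := by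
  rw [suspSign_comp, suspSign_eq_prod, prod_prod_eq_prod_lt
    (fun u v => if σ.symm u < σ.symm v then sgn (p u) else 1) (by simp), koszul_eq_prod_labels,
    koszul_eq_prod_labels, sign_eq_prod_labels]
  simp only [← Finset.prod_mul_distrib]
  refine Finset.prod_congr rfl fun u _ => Finset.prod_congr rfl fun v _ => ?_
  by_cases huv : u < v
  · have h1 : σ.symm u ≠ σ.symm v := fun h => huv.ne (σ.symm.injective h)
    rcases h1.lt_or_gt with h1 | h1
    · simp [huv, h1, h1.not_gt]
    · simp only [huv, h1, h1.not_gt, and_self, if_true, if_false, one_mul]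
      rw [← sgn_one, ← sgn_add, ← sgn_add, ← sgn_add]
      congr 1
      ring
  · simp [huv]

section Graded

variable {k V M : Type*} [Field k] [AddCommGroup V] [Module k V] [AddCommGroup M] [Module k M]

/-! ### Graded multilinear maps -/

theorem units_smul_eq (u : ℤˣ) (x : V) : u • x = ((u : ℤ) : k) • x := by
  rw [Units.smul_def, Int.cast_smul_eq_zsmul]

theorem units_smul_mem (W : Submodule k V) (u : ℤˣ) {x : V} (hx : x ∈ W) : u • x ∈ W := by
  rw [units_smul_eq (k := k)]
  exact W.smul_mem _ hx

theorem Multi.map_units_smul {n : ℕ} (φ : Multi k n V M) (u : Fin n → ℤˣ) (v : Fin n → V) :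
    φ (fun i => u i • v i) = (∏ i, u i) • φ v := by
  simp only [units_smul_eq (k := k)]
  rw [φ.map_smul_univ]
  simp

theorem Multi.cons_units_smul {n : ℕ} (φ : Multi k (n + 1) V M) (u : ℤˣ) (x : V) (v : Fin n → V) :
    φ (Fin.cons (u • x) v) = u • φ (Fin.cons x v) := by
  rw [units_smul_eq (k := k), MultilinearMap.cons_smul, ← units_smul_eq]

variable {𝒱 : ZMod 2 → Submodule k V}

theorem Homog.comp {n m : ℕ} {p : Fin n → ZMod 2} {v : Fin n → V} (hv : Homog 𝒱 p v)
    (σ : Fin m → Fin n) : Homog 𝒱 (fun i => p (σ i)) (fun i => v (σ i)) := fun i => hv (σ i)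

theorem Homog.cons {n : ℕ} {p : Fin n → ZMod 2} {v : Fin n → V} (hv : Homog 𝒱 p v)
    {a : ZMod 2} {x : V} (hx : x ∈ 𝒱 a) :
    Homog 𝒱 (Fin.cons a p : Fin (n + 1) → ZMod 2) (Fin.cons x v : Fin (n + 1) → V) :=
  Fin.cases hx hv

theorem Homog.snoc {n : ℕ} {p : Fin n → ZMod 2} {v : Fin n → V} (hv : Homog 𝒱 p v)
    {a : ZMod 2} {x : V} (hx : x ∈ 𝒱 a) :
    Homog 𝒱 (Fin.snoc (α := fun _ => ZMod 2) p a) (Fin.snoc (α := fun _ => V) v x) := by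
  intro i
  induction i using Fin.lastCases with
  | last => simpa using hx
  | cast i => simpa using hv i

theorem Homog.parityReversion {n : ℕ} {p : Fin n → ZMod 2} {v : Fin n → V} (hv : Homog 𝒱 p v) :
    Homog (CyclicLInfinity.parityReversion 𝒱) (fun i => p i + 1) v := by
  intro i
  have := hv i
  rwa [← add_zero (p i), ← zmod2_add_self 1, ← add_assoc] at this

variable (𝒱) [DirectSum.Decomposition 𝒱]

theorem parityProj_mem (i : ZMod 2) (x : V) : parityProj 𝒱 i x ∈ 𝒱 i := Subtype.prop _

theorem Multi.ext_homog {n : ℕ} {φ ψ : Multi k n V M}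
    (h : ∀ p v, Homog 𝒱 p v → φ v = ψ v) : φ = ψ := by
  classical
  ext v
  have hv : v = fun i => ∑ j, parityProj 𝒱 j (v i) := by
    funext i
    rw [sum_parityProj]
  rw [hv, φ.map_sum, ψ.map_sum]
  exact Finset.sum_congr rfl fun p _ => h p _ fun i => parityProj_mem 𝒱 (p i) (v i)

theorem parityInvolution_apply (x : V) :
    parityInvolution 𝒱 x = parityProj 𝒱 0 x - parityProj 𝒱 1 x := rfl

theorem parityInvolution_of_mem {i : ZMod 2} {x : V} (hx : x ∈ 𝒱 i) :
    parityInvolution 𝒱 x = sgn i • x := by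
  rw [parityInvolution_apply]
  have hi : ∀ i : ZMod 2, i = 0 ∨ i = 1 := by decide
  rcases hi i with rfl | rfl
  · rw [parityProj_of_mem 𝒱 hx, parityProj_of_mem_ne 𝒱 hx zero_ne_one]
    simp
  · rw [parityProj_of_mem 𝒱 hx, parityProj_of_mem_ne 𝒱 hx one_ne_zero]
    simp

theorem parityInvolution_pow_of_mem {i : ZMod 2} {x : V} (hx : x ∈ 𝒱 i) (m : ℕ) :
    (parityInvolution 𝒱 ^ m) x = sgn (m * i) • x := by
  induction m with
  | zero => simp
  | succ m ih =>
    rw [pow_succ', Module.End.mul_apply, ih,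
      parityInvolution_of_mem 𝒱 (units_smul_mem _ _ hx), sgn_smul_smul]
    congr 2
    push_cast
    ring

theorem suspend_apply_homog {n : ℕ} (φ : Multi k n V V) {p : Fin n → ZMod 2} {v : Fin n → V}
    (hv : Homog 𝒱 p v) : suspend 𝒱 φ v = suspSign p • φ v := by
  rw [suspend, MultilinearMap.compLinearMap_apply]
  simp only [parityInvolution_pow_of_mem 𝒱 (hv _)]
  rw [Multi.map_units_smul, suspSign, sgn_sum]

/-- The suspension signs square to 1, so `suspend` also serves as the passage from ΠV back to V. -/
theorem suspend_suspend {n : ℕ} (φ : Multi k n V V) : suspend 𝒱 (suspend 𝒱 φ) = φ := by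
  refine Multi.ext_homog 𝒱 fun p v hv => ?_
  rw [suspend_apply_homog 𝒱 _ hv, suspend_apply_homog 𝒱 _ hv, units_smul_self_smul]

theorem suspend_add {n : ℕ} (φ ψ : Multi k n V V) :
    suspend 𝒱 (φ + ψ) = suspend 𝒱 φ + suspend 𝒱 ψ := rfl

@[simp] theorem suspend_zero {n : ℕ} : suspend 𝒱 (0 : Multi k n V V) = 0 := rfl

theorem isGradedSymm_suspend_iff {n : ℕ} {φ : Multi k n V V} :
    IsGradedSymm (parityReversion 𝒱) (suspend 𝒱 φ) ↔ IsGradedAlt 𝒱 φ := by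
  have key : ∀ (σ : Equiv.Perm (Fin n)) p v, Homog 𝒱 p v →
      (suspend 𝒱 φ v = koszul (fun i => p i + 1) σ • suspend 𝒱 φ (fun i => v (σ i)) ↔
        φ v = (Equiv.Perm.sign σ * koszul p σ) • φ (fun i => v (σ i))) := by
    intro σ p v hv
    rw [suspend_apply_homog 𝒱 _ hv, suspend_apply_homog 𝒱 _ (hv.comp σ), koszul_add_one, smul_smul,
      mul_assoc, mul_assoc (suspSign p), Int.units_mul_self, mul_one, mul_comm _ (suspSign p),
      mul_smul]
    exact smul_left_cancel_iff _
  constructor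
  · intro h σ p v hv
    exact (key σ p v hv).1 (h σ _ v hv.parityReversion)
  · intro h σ p v hv
    have := (key σ _ v hv).2 (h σ _ v hv)
    simpa only [add_assoc, zmod2_add_self, add_zero] using this

/-- Parity reversion shifts the n inputs and the output by one each. Hence operations of parity n
become odd, and even components on ΠV come from maps of parity n + 1. -/
theorem hasParity_suspend_iff {n : ℕ} {q : ZMod 2} {φ : Multi k n V V} :
    HasParity (parityReversion 𝒱) (parityReversion 𝒱) q (suspend 𝒱 φ) ↔
      HasParity 𝒱 𝒱 (q + n + 1) φ := by
  have e : ∀ p : Fin n → ZMod 2, q + ∑ i, (p i + 1) + 1 = q + n + 1 + ∑ i, p i := by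
    intro p
    simp only [Finset.sum_add_distrib, Finset.sum_const, Finset.card_univ, Fintype.card_fin,
      nsmul_eq_mul, mul_one]
    ring
  have mem : ∀ (u : ℤˣ) (x : V) i, u • x ∈ 𝒱 i ↔ x ∈ 𝒱 i := fun u x i =>
    ⟨fun h => by simpa only [units_smul_self_smul] using units_smul_mem _ u h, units_smul_mem _ u⟩
  constructor
  · intro h p v hv
    have := h _ v hv.parityReversion
    rw [parityReversion, suspend_apply_homog 𝒱 _ hv, mem, e] at this
    exact this
  · intro h p v hv
    have := h _ v hv
    rw [parityReversion, suspend_apply_homog 𝒱 _ hv, mem]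
    rw [← e] at this
    simpa only [add_assoc, zmod2_add_self, add_zero] using this

/-! ### Compositions -/

/-- On homogeneous arguments the projections kill every parity vector except the actual one. -/
theorem extComp_apply_homog {n a b : ℕ} (h : b + a = n) (φ : Multi k (a + 1) V M)
    (ψ : Multi k b V V) {p : Fin n → ZMod 2} {v : Fin n → V} (hv : Homog 𝒱 p v) :
    extComp 𝒱 h φ ψ v = ∑ σ ∈ unshuffles n b,
      (Equiv.Perm.sign σ * koszul p σ) • insertMap h φ ψ (fun i => v (σ i)) := by
  rw [extComp_apply, Finset.sum_eq_single p]
  · refine Finset.sum_congr rfl fun σ _ => ?_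
    simp only [parityProj_of_mem 𝒱 (hv _)]
  · intro p' _ hp'
    obtain ⟨i, hi⟩ := Function.ne_iff.1 hp'
    refine Finset.sum_eq_zero fun σ _ => ?_
    convert smul_zero _
    change (insertMap h φ ψ).domDomCongr σ (fun i => parityProj 𝒱 (p' i) (v i)) = 0
    exact MultilinearMap.map_coord_zero _ i (parityProj_of_mem_ne 𝒱 (hv i) hi.symm)
  · intro hp
    exact absurd (Finset.mem_univ p) hp

/-- The inner result has parity s plus the parities of its inputs and stands before a further
arguments. The inputs' share raises their exponents from b - 1 - i to n - 1 - i, as required for the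
total sign; only a s is left over. -/
theorem suspSign_insert {n a b : ℕ} (h : b + a = n) (s : ZMod 2) (p : Fin n → ZMod 2) :
    (suspSign (fun i : Fin b => p (Fin.cast h (Fin.castAdd a i)))) *
      suspSign (Fin.cons (s + ∑ i, p (Fin.cast h (Fin.castAdd a i)))
        (fun j => p (Fin.cast h (Fin.natAdd b j))) : Fin (a + 1) → ZMod 2) =
      sgn (a * s) * suspSign p := by
  subst h
  simp only [suspSign, ← sgn_add, Fin.sum_univ_add, Fin.sum_univ_succ, Fin.cons_zero, Fin.cons_succ,
    Fin.cast_refl, Fin.val_zero, Fin.val_succ, Fin.val_castAdd, Fin.val_natAdd, id]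
  congr 1
  have e1 : ∀ i : Fin b, ((b + a - 1 - (i : ℕ) : ℕ) : ZMod 2) = a + (b - 1 - (i : ℕ) : ℕ) := by
    intro i
    rw [← Nat.cast_add]
    congr 1
    omega
  have e2 : ∀ j : Fin a, b + a - 1 - (b + (j : ℕ)) = a + 1 - 1 - (j + 1) := by
    intro j
    omega
  simp only [e1, e2, add_mul, Finset.sum_add_distrib, mul_add, Finset.mul_sum]
  simp only [add_tsub_cancel_right, tsub_zero]
  ring

theorem insertMap_suspend {n a b : ℕ} (h : b + a = n) (φ : Multi k (a + 1) V V)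
    {ψ : Multi k b V V} {s : ZMod 2} (hψ : HasParity 𝒱 𝒱 s ψ) {p : Fin n → ZMod 2} {v : Fin n → V}
    (hv : Homog 𝒱 p v) :
    insertMap h (suspend 𝒱 φ) (suspend 𝒱 ψ) v =
      (sgn (a * s) * suspSign p) • insertMap h φ ψ v := by
  rw [insertMap_apply, insertMap_apply, suspend_apply_homog 𝒱 ψ (hv.comp _),
    Multi.cons_units_smul, suspend_apply_homog 𝒱 φ ((hv.comp _).cons (hψ _ _ (hv.comp _))),
    smul_smul, suspSign_insert h]

/-- The bridge from composition in the symmetric coalgebra of ΠV to `extComp` on V: the suspension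
sign of the permuted arguments occurs twice and cancels. -/
theorem sum_unshuffles_suspend {n a b : ℕ} (h : b + a = n) (φ : Multi k (a + 1) V V)
    {ψ : Multi k b V V} {s : ZMod 2} (hψ : HasParity 𝒱 𝒱 s ψ) {p : Fin n → ZMod 2} {v : Fin n → V}
    (hv : Homog 𝒱 p v) :
    ∑ σ ∈ unshuffles n b, koszul (fun i => p i + 1) σ •
        insertMap h (suspend 𝒱 φ) (suspend 𝒱 ψ) (fun i => v (σ i)) =
      (sgn (a * s) * suspSign p) • extComp 𝒱 h φ ψ v := by
  rw [extComp_apply_homog 𝒱 h φ ψ hv, Finset.smul_sum]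
  refine Finset.sum_congr rfl fun σ _ => ?_
  rw [insertMap_suspend 𝒱 h φ hψ (hv.comp σ), koszul_add_one, smul_smul, smul_smul]
  congr 1
  calc _ = sgn (a * s) * suspSign p * (Equiv.Perm.sign σ * koszul p σ) *
      ((suspSign fun i => p (σ i)) * suspSign fun i => p (σ i)) := by ac_rfl
    _ = _ := by rw [Int.units_mul_self, mul_one]

end Graded

/-! ### Unshuffles of type `(n, 1)` -/

/-- The permutation `(0, …, i - 1, i + 1, …, n, i)`. -/
def skipPerm {n : ℕ} (i : Fin (n + 1)) : Equiv.Perm (Fin (n + 1)) :=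
  finSuccEquivLast.trans (finSuccEquiv' i).symm

@[simp] theorem skipPerm_last {n : ℕ} (i : Fin (n + 1)) : skipPerm i (Fin.last n) = i := by
  simp [skipPerm]

@[simp] theorem skipPerm_castSucc {n : ℕ} (i : Fin (n + 1)) (j : Fin n) :
    skipPerm i j.castSucc = i.succAbove j := by
  simp [skipPerm]

theorem koszul_skipPerm {n : ℕ} (p : Fin (n + 1) → ZMod 2) (i : Fin (n + 1)) :
    koszul p (skipPerm i) = sgn (p i * ∑ j ∈ Finset.Ioi i, p j) := by
  have h1 : ∀ a b : Fin n, ¬ (a < b ∧ i.succAbove b < i.succAbove a) := by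
    rintro a b ⟨h, h'⟩
    exact h'.not_gt (Fin.strictMono_succAbove i h)
  rw [koszul, Fin.prod_univ_castSucc]
  simp only [Fin.prod_univ_castSucc, skipPerm_last, skipPerm_castSucc, Fin.castSucc_lt_castSucc_iff,
    h1, if_false, Finset.prod_const_one, one_mul, Fin.castSucc_lt_last, true_and, lt_irrefl,
    false_and, (Fin.castSucc_lt_last _).not_gt, mul_one]
  rw [Finset.mul_sum, sgn_sum, ← Finset.filter_lt_eq_Ioi, Finset.prod_filter,
    Fin.prod_univ_succAbove _ i]
  simp [mul_comm]

/-- Signatures are Koszul signs of purely odd elements, so they need no separate computation. -/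
theorem sign_eq_koszul_one {n : ℕ} (σ : Equiv.Perm (Fin n)) :
    Equiv.Perm.sign σ = koszul (fun _ => 1) σ := by
  rw [sign_eq_prod_labels, koszul_eq_prod_labels]
  simp

theorem sign_skipPerm {n : ℕ} (i : Fin (n + 1)) :
    Equiv.Perm.sign (skipPerm i) = sgn ((n - i : ℕ) : ZMod 2) := by
  rw [sign_eq_koszul_one, koszul_skipPerm, Finset.sum_const, Fin.card_Ioi]
  simp

theorem mem_unshuffles {n b : ℕ} {σ : Equiv.Perm (Fin n)} :
    σ ∈ unshuffles n b ↔
      ∀ i j : Fin n, i < j → ((j : ℕ) < b ∨ b ≤ (i : ℕ)) → σ i < σ j := by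
  simp [unshuffles]

theorem strictMono_eq_succAbove {n : ℕ} {f : Fin n → Fin (n + 1)} (hf : StrictMono f)
    {i : Fin (n + 1)} (hi : ∀ j, f j ≠ i) : f = i.succAbove := by
  refine (hf.range_inj (Fin.strictMono_succAbove i)).1 ?_
  rw [Fin.range_succAbove]
  refine Set.eq_of_subset_of_ncard_le ?_ ?_
  · rintro _ ⟨j, rfl⟩
    exact hi j
  · rw [Set.ncard_compl, Set.ncard_singleton, Set.ncard_range_of_injective hf.injective]
    simp

/-- An unshuffle of type (n, 1) is determined by the element it puts last, the others being listed
in increasing order. -/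
theorem sum_unshuffles_last {X : Type*} [AddCommMonoid X] {n : ℕ}
    (F : Equiv.Perm (Fin (n + 1)) → X) :
    ∑ σ ∈ unshuffles (n + 1) n, F σ = ∑ i, F (skipPerm i) := by
  symm
  refine Finset.sum_bij (fun i _ => skipPerm i) ?_ ?_ ?_ fun _ _ => rfl
  · intro i _
    rw [mem_unshuffles]
    intro a b hab h
    have hb : (b : ℕ) < n := by omega
    have ha : (a : ℕ) < n := by omega
    have := Fin.strictMono_succAbove i (show (⟨a, ha⟩ : Fin n) < ⟨b, hb⟩ from hab)
    rwa [← skipPerm_castSucc, ← skipPerm_castSucc] at this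
  · intro i _ j _ h
    rw [← skipPerm_last i, ← skipPerm_last j]
    exact congrArg (fun σ : Equiv.Perm (Fin (n + 1)) => σ (Fin.last n)) h
  · intro σ hσ
    rw [mem_unshuffles] at hσ
    refine ⟨σ (Fin.last n), Finset.mem_univ _, ?_⟩
    have h : (fun j : Fin n => σ j.castSucc) = (σ (Fin.last n)).succAbove := by
      refine strictMono_eq_succAbove (fun a b hab => hσ _ _ hab (Or.inl b.2)) fun j h => ?_
      exact (Fin.castSucc_lt_last j).ne (σ.injective h)
    refine Equiv.ext fun j => ?_
    induction j using Fin.lastCases with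
    | last => simp
    | cast j => rw [skipPerm_castSucc, ← h]

/-! ### The bracket as an operation with two inputs -/

section Graded

variable {k V M : Type*} [Field k] [AddCommGroup V] [Module k V] [AddCommGroup M] [Module k M]

variable {𝒱 : ZMod 2 → Submodule k V} {l : Multi k 2 V V}

theorem cons_eq_pair {X : Type*} (x : X) (y : Fin 1 → X) :
    (Fin.cons x y : Fin 2 → X) = ![x, y 0] := by
  funext i
  fin_cases i <;> rfl

theorem eq_pair {X : Type*} (v : Fin 2 → X) : v = ![v 0, v 1] := by
  funext i
  fin_cases i <;> rfl

/-- `(v₁, …, v_{n+1}) ↦ l (ψ (v₁, …, vₙ), v_{n+1})`. -/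
theorem insertMap_pair {n : ℕ} (h : n + 1 = n + 1) (l : Multi k 2 V M) (ψ : Multi k n V V)
    (v : Fin (n + 1) → V) :
    insertMap h l ψ v = l ![ψ fun i => v i.castSucc, v (Fin.last n)] := by
  rw [insertMap_apply, cons_eq_pair]
  rfl

theorem IsLieBracket.map_mem (hl : IsLieBracket 𝒱 l) {i j : ZMod 2} {x y : V} (hx : x ∈ 𝒱 i)
    (hy : y ∈ 𝒱 j) : l ![x, y] ∈ 𝒱 (i + j) := by
  have := hl.even ![i, j] ![x, y] (by intro m; fin_cases m <;> assumption)
  simpa using this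

theorem IsLieBracket.isGradedAlt (hl : IsLieBracket 𝒱 l) : IsGradedAlt 𝒱 l := by
  intro σ p v hv
  rw [eq_pair v, eq_pair (fun i => ![v 0, v 1] (σ i))]
  by_cases h : σ 0 = 0
  · have h1 : σ 1 = 1 := by
      have : σ 1 ≠ σ 0 := fun h => one_ne_zero (σ.injective h)
      rw [h] at this
      exact Fin.eq_one_of_ne_zero _ this
    have h2 : σ = 1 := Equiv.ext fun i => by fin_cases i <;> assumption
    subst h2
    simp
  · have h0 : σ 0 = 1 := Fin.eq_one_of_ne_zero _ h
    have h1 : σ 1 = 0 := by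
      have : σ 1 ≠ σ 0 := fun h => one_ne_zero (σ.injective h)
      rw [h0] at this
      revert this
      generalize σ 1 = m
      revert m
      decide
    have h2 : σ = Equiv.swap 0 1 := Equiv.ext fun i => by
      fin_cases i
      · simpa using h0
      · simpa using h1
    have h3 : koszul p σ = sgn (p 0 * p 1) := by
      simp [koszul, Fin.prod_univ_two, h0, h1, mul_comm]
    rw [h3, h0, h1, h2, Equiv.Perm.sign_swap zero_ne_one, hl.antisymm _ _ _ (hv 0) _ (hv 1)]
    simp

/-- The three unshuffles of type (2, 1) give the three double brackets. Antisymmetry brings two of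
them into the form [x, [y, z]], after which the sum vanishes by the Jacobi identity. -/
theorem IsLieBracket.extComp_self [DirectSum.Decomposition 𝒱] (hl : IsLieBracket 𝒱 l)
    (h : 2 + 1 = 3) : extComp 𝒱 h l l = 0 := by
  refine Multi.ext_homog 𝒱 fun p v hv => ?_
  rw [extComp_apply_homog 𝒱 h l l hv, sum_unshuffles_last]
  rw [show (∑ i : Fin (2 + 1), _) = _ from Fin.sum_univ_three _]
  simp only [insertMap_pair, koszul_skipPerm, sign_skipPerm, skipPerm_castSucc,
    skipPerm_last]
  have e0 : (Finset.Ioi (0 : Fin 3)) = {1, 2} := by decide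
  have e1 : (Finset.Ioi (1 : Fin 3)) = {2} := by decide
  have e2 : (Finset.Ioi (2 : Fin 3)) = ∅ := by decide
  rw [e0, e1, e2, eq_pair fun i => v (Fin.succAbove 0 i), eq_pair fun i => v (Fin.succAbove 1 i),
    eq_pair fun i => v (Fin.succAbove 2 i)]
  have s00 : Fin.succAbove (0 : Fin 3) 0 = 1 := by decide
  have s01 : Fin.succAbove (0 : Fin 3) 1 = 2 := by decide
  have s10 : Fin.succAbove (1 : Fin 3) 0 = 0 := by decide
  have s11 : Fin.succAbove (1 : Fin 3) 1 = 2 := by decide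
  have s20 : Fin.succAbove (2 : Fin 3) 0 = 0 := by decide
  have s21 : Fin.succAbove (2 : Fin 3) 1 = 1 := by decide
  rw [s00, s01, s10, s11, s20, s21, Finset.sum_pair (by decide), Finset.sum_singleton,
    Finset.sum_empty, hl.antisymm _ _ _ (hl.map_mem (hv 1) (hv 2)) _ (hv 0),
    hl.antisymm _ _ _ (hl.map_mem (hv 0) (hv 2)) _ (hv 1), hl.jacobi _ _ _ (hv 0) _ (hv 1)]
  have c0 : ((2 - ((0 : Fin 3) : ℕ) : ℕ) : ZMod 2) = 0 := by decide
  have c1 : ((2 - ((1 : Fin 3) : ℕ) : ℕ) : ZMod 2) = 1 := by decide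
  have c2 : ((2 - ((2 : Fin 3) : ℕ) : ℕ) : ZMod 2) = 0 := by decide
  rw [c0, c1, c2]
  simp only [mul_zero, sgn_zero, sgn_one, one_mul, one_smul, smul_neg, Units.neg_smul, neg_neg, neg_mul,
    sgn_smul_smul, mul_comm (p 1 + p 2) (p 0), zmod2_add_self]
  rw [show p 1 * p 2 + (p 0 + p 2) * p 1 = p 0 * p 1 + (p 1 * p 2 + p 1 * p 2) by ring,
    zmod2_add_self, add_zero, zero_apply]
  abel

end Graded

section Graded

variable {k V M : Type*} [Field k] [AddCommGroup V] [Module k V] [AddCommGroup M] [Module k M]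

/-! ### Bilinear maps written as multilinear maps -/

theorem pair_add_left (l : Multi k 2 V M) (x x' y : V) :
    l ![x + x', y] = l ![x, y] + l ![x', y] := l.cons_add ![y] x x'

theorem pair_add_right (l : Multi k 2 V M) (x y y' : V) :
    l ![x, y + y'] = l ![x, y] + l ![x, y'] := by
  have h : ∀ z, ![x, z] = Function.update ![x, 0] 1 z := by
    intro z
    funext i
    fin_cases i <;> simp
  rw [h, h y, h y', l.map_update_add]

theorem pair_units_smul_left (l : Multi k 2 V M) (u : ℤˣ) (x y : V) :
    l ![u • x, y] = u • l ![x, y] := Multi.cons_units_smul l u x ![y]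

theorem pair_units_smul_right (l : Multi k 2 V M) (u : ℤˣ) (x y : V) :
    l ![x, u • y] = u • l ![x, y] := by
  have h : ![x, u • y] = fun i => ![1, u] i • ![x, y] i := by
    funext i
    fin_cases i <;> simp
  rw [h, Multi.map_units_smul, Fin.prod_univ_two]
  simp

@[simp] theorem pair_zero_left (l : Multi k 2 V M) (y : V) : l ![0, y] = 0 :=
  l.map_coord_zero 0 rfl

@[simp] theorem pair_zero_right (l : Multi k 2 V M) (x : V) : l ![x, 0] = 0 :=
  l.map_coord_zero 1 rfl

/-! ### The part of a multilinear map on `V[t]` that is divisible by `t` -/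

/-- The map `(x₁ + t y₁, …, xₙ + t yₙ) ↦ t φ(x₁, …, xₙ)`. -/
def tPart {n : ℕ} (φ : Multi k n V V) : Multi k n (V × V) (V × V) :=
  (LinearMap.inr k V V).compMultilinearMap (φ.compLinearMap fun _ => LinearMap.fst k V V)

theorem tPart_apply {n : ℕ} (φ : Multi k n V V) (z : Fin n → V × V) :
    tPart φ z = (0, φ fun i => (z i).1) := rfl

theorem tPart_zero {n : ℕ} : tPart (0 : Multi k n V V) = 0 := rfl

/-! ### The grading of `V[t]` -/

variable (𝒱 : ZMod 2 → Submodule k V)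

theorem zmod2_sub (a b : ZMod 2) : a - b = a + b := CharTwo.sub_eq_add a b

theorem mem_extGrading {p i : ZMod 2} {z : V × V} :
    z ∈ extGrading 𝒱 p i ↔ z.1 ∈ 𝒱 i ∧ z.2 ∈ 𝒱 (i + p) := by
  rw [extGrading, Submodule.mem_prod, zmod2_sub]

theorem Homog.fst {𝒱 : ZMod 2 → Submodule k V} {p : ZMod 2} {n : ℕ} {r : Fin n → ZMod 2}
    {z : Fin n → V × V} (hz : Homog (extGrading 𝒱 p) r z) : Homog 𝒱 r fun i => (z i).1 :=
  fun i => ((mem_extGrading 𝒱).1 (hz i)).1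

theorem Homog.inl {𝒱 : ZMod 2 → Submodule k V} (p : ZMod 2) {n : ℕ} {r : Fin n → ZMod 2}
    {v : Fin n → V} (hv : Homog 𝒱 r v) : Homog (extGrading 𝒱 p) r fun i => (v i, (0 : V)) :=
  fun i => (mem_extGrading 𝒱).2 ⟨hv i, zero_mem _⟩

variable [DirectSum.Decomposition 𝒱]

theorem parityInvolution_extGrading (p : ZMod 2) (z : V × V) :
    parityInvolution (extGrading 𝒱 p) z =
      (parityInvolution 𝒱 z.1, sgn p • parityInvolution 𝒱 z.2) := by
  induction z using DirectSum.Decomposition.inductionOn (extGrading 𝒱 p) with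
  | zero => simp only [map_zero, Prod.fst_zero, Prod.snd_zero, smul_zero]; rfl
  | @homogeneous i m =>
    obtain ⟨h1, h2⟩ := (mem_extGrading 𝒱).1 m.2
    rw [parityInvolution_of_mem _ m.2, parityInvolution_of_mem _ h1, parityInvolution_of_mem _ h2,
      sgn_smul_smul, add_left_comm, zmod2_add_self, add_zero]
    rfl
  | add m m' h h' => rw [map_add, h, h']; simp

theorem parityInvolution_pow_extGrading_fst (p : ZMod 2) (m : ℕ) (z : V × V) :
    ((parityInvolution (extGrading 𝒱 p) ^ m) z).1 = (parityInvolution 𝒱 ^ m) z.1 := by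
  induction m with
  | zero => rfl
  | succ m ih =>
    rw [pow_succ', pow_succ', Module.End.mul_apply, Module.End.mul_apply,
      parityInvolution_extGrading, ih]

/-- The sign `v ↦ (-1)^{t v} v` of moving the parameter `t` of parity `p` past `v`. -/
def parityTwist (p : ZMod 2) : Module.End k V := if p = 0 then LinearMap.id else parityInvolution 𝒱

theorem parityTwist_of_mem (p : ZMod 2) {i : ZMod 2} {x : V} (hx : x ∈ 𝒱 i) :
    parityTwist 𝒱 p x = sgn (p * i) • x := by
  have hp : ∀ p : ZMod 2, p = 0 ∨ p = 1 := by decide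
  rcases hp p with rfl | rfl
  · simp [parityTwist]
  · simp [parityTwist, parityInvolution_of_mem 𝒱 hx]

theorem extForm_apply (p : ZMod 2) (B : V →ₗ[k] V →ₗ[k] k) (z z' : V × V) :
    extForm 𝒱 p B z z' = (B z.1 z'.1, B z.2 z'.1 + B (parityTwist 𝒱 p z.1) z'.2) := by
  rw [extForm, LinearMap.mk₂_apply, parityTwist]
  split_ifs <;> rfl

theorem suspend_tPart (p : ZMod 2) {n : ℕ} (φ : Multi k n V V) :
    suspend (extGrading 𝒱 p) (tPart φ) = tPart (suspend 𝒱 φ) := by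
  ext z
  · rfl
  · simp only [suspend, MultilinearMap.compLinearMap_apply, tPart_apply,
      parityInvolution_pow_extGrading_fst]

/-! ### The bracket of `V[t]` -/

/-- The `k[t]`-bilinear extension of the bracket `l` to `V[t]`. -/
def extBracket (p : ZMod 2) (l : Multi k 2 V V) : Multi k 2 (V × V) (V × V) :=
  (LinearMap.inl k V V).compMultilinearMap (l.compLinearMap fun _ => LinearMap.fst k V V) +
  ((LinearMap.inr k V V).compMultilinearMap
      (l.compLinearMap ![LinearMap.snd k V V, LinearMap.fst k V V]) +
    (LinearMap.inr k V V).compMultilinearMap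
      (l.compLinearMap ![parityTwist 𝒱 p ∘ₗ LinearMap.fst k V V, LinearMap.snd k V V]))

theorem extBracket_apply (p : ZMod 2) (l : Multi k 2 V V) (z z' : V × V) :
    extBracket 𝒱 p l ![z, z'] =
      (l ![z.1, z'.1], l ![z.2, z'.1] + l ![parityTwist 𝒱 p z.1, z'.2]) := by
  simp only [extBracket, add_apply, LinearMap.compMultilinearMap_apply,
    MultilinearMap.compLinearMap_apply]
  rw [eq_pair fun i => (LinearMap.fst k V V) (![z, z'] i),
    eq_pair fun i => (![LinearMap.snd k V V, LinearMap.fst k V V] i) (![z, z'] i),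
    eq_pair fun i => (![parityTwist 𝒱 p ∘ₗ LinearMap.fst k V V, LinearMap.snd k V V] i)
      (![z, z'] i)]
  simp

theorem extBracket_fst (p : ZMod 2) (l : Multi k 2 V V) (z : Fin 2 → V × V) :
    (extBracket 𝒱 p l z).1 = l fun i => (z i).1 := by
  rw [eq_pair z, extBracket_apply, eq_pair fun i => (![z 0, z 1] i).1]
  rfl

variable {𝒱}

/-- The order t part of each axiom is a sum of instances of the same axiom for l, one for each
argument that may supply the factor t; the twist provides the sign of moving t to the front. -/
theorem IsLieBracket.extBracket {l : Multi k 2 V V} (hl : IsLieBracket 𝒱 l) (p : ZMod 2) :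
    IsLieBracket (extGrading 𝒱 p) (extBracket 𝒱 p l) where
  even := by
    intro r z hz
    have h0 := (mem_extGrading 𝒱).1 (hz 0)
    have h1 := (mem_extGrading 𝒱).1 (hz 1)
    rw [eq_pair z, extBracket_apply, zero_add, Fin.sum_univ_two, mem_extGrading,
      parityTwist_of_mem 𝒱 p h0.1, pair_units_smul_left]
    refine ⟨hl.map_mem h0.1 h1.1, add_mem ?_ (units_smul_mem _ _ ?_)⟩
    · have := hl.map_mem h0.2 h1.1
      rwa [add_right_comm] at this
    · have := hl.map_mem h0.1 h1.2
      rwa [← add_assoc] at this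
  antisymm := by
    intro i j x hx y hy
    have hx := (mem_extGrading 𝒱).1 hx
    have hy := (mem_extGrading 𝒱).1 hy
    rw [extBracket_apply, extBracket_apply, parityTwist_of_mem 𝒱 p hx.1,
      parityTwist_of_mem 𝒱 p hy.1, pair_units_smul_left, pair_units_smul_left,
      hl.antisymm _ _ _ hx.1 _ hy.1, hl.antisymm _ _ _ hx.2 _ hy.1, hl.antisymm _ _ _ hx.1 _ hy.2]
    refine Prod.ext rfl ?_
    simp only [Prod.snd_neg, Prod.smul_snd, smul_add, smul_neg, sgn_smul_smul]
    rw [add_comm, neg_add]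
    congr 4
    · linear_combination p * i * two_eq_zero
    · ring
  jacobi := by
    intro i j x hx y hy z
    have hx := (mem_extGrading 𝒱).1 hx
    have hy := (mem_extGrading 𝒱).1 hy
    simp only [extBracket_apply]
    refine Prod.ext (hl.jacobi _ _ _ hx.1 _ hy.1 _) ?_
    simp only [Prod.snd_add, Prod.smul_snd]
    rw [parityTwist_of_mem 𝒱 p hx.1, parityTwist_of_mem 𝒱 p hy.1,
      parityTwist_of_mem 𝒱 p (hl.map_mem hx.1 hy.1)]
    simp only [pair_units_smul_left, pair_units_smul_right, pair_add_left, pair_add_right, smul_add,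
      sgn_smul_smul]
    rw [hl.jacobi _ _ _ hx.2 _ hy.1, hl.jacobi _ _ _ hx.1 _ hy.2, hl.jacobi _ _ _ hx.1 _ hy.1]
    simp only [smul_add, sgn_smul_smul]
    rw [show (i + p) * j = i * j + p * j by ring,
      show p * i + i * (j + p) = i * j + p * i * 2 by ring, two_eq_zero, mul_zero, add_zero,
      show p * j + p * i + i * j = i * j + (p * i + p * j) by ring,
      show p * j + p * i = p * (i + j) by ring]
    abel

/-! ### Maps that are linear over `k[t]` -/

theorem mulT_apply (z : V × V) : mulT (k := k) z = (0, z.1) := rfl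

/-- A `k[t]`-linear map that vanishes modulo `t` is determined by its values on `V`. -/
theorem IsGradedTLinear.eq_tPart {p q c : ZMod 2} {𝒰 : ZMod 2 → Submodule k (V × V)}
    (h𝒰 : ∀ i, 𝒰 i = extGrading 𝒱 p (i + c)) {n : ℕ} {φ : Multi k n (V × V) (V × V)}
    (hφ : IsGradedTLinear 𝒰 p q φ) (h : ∀ z, (φ z).1 = 0) :
    φ = tPart ((LinearMap.snd k V V).compMultilinearMap
      (φ.compLinearMap fun _ => LinearMap.inl k V V)) := by
  -- Write z i = x + t y. The term with t y equals ± t φ(…, y, …), which is zero because φ vanishes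
  -- modulo t and t² = 0. The shift c covers V[t] (c = 0) and its parity reversion (c = 1).
  have step : ∀ (r : Fin n → ZMod 2) z, Homog (extGrading 𝒱 p) r z → ∀ i,
      φ z = φ (Function.update z i ((z i).1, 0)) := by
    intro r z hz i
    have h1 : z = Function.update z i (((z i).1, 0) + mulT (k := k) ((z i).2, (0 : V))) := by
      rw [mulT_apply, Prod.mk_add_mk, add_zero, zero_add, Prod.mk.eta, Function.update_eq_self]
    have h2 : Homog 𝒰 (Function.update (fun j => r j + c) i (r i + p + c))
        (Function.update z i ((z i).2, (0 : V))) := by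
      intro j
      rw [h𝒰]
      rcases eq_or_ne j i with rfl | hj
      · rw [Function.update_self, Function.update_self, add_assoc, zmod2_add_self, add_zero]
        exact (mem_extGrading 𝒱).2 ⟨((mem_extGrading 𝒱).1 (hz j)).2, zero_mem _⟩
      · rw [Function.update_of_ne hj, Function.update_of_ne hj, add_assoc, zmod2_add_self, add_zero]
        exact hz j
    have h3 := hφ _ _ h2 i
    rw [Function.update_self, Function.update_idem, mulT_apply (φ _), h] at h3
    conv_lhs => rw [h1, φ.map_update_add, h3]
    simp
  have all : ∀ (r : Fin n → ZMod 2) z, Homog (extGrading 𝒱 p) r z → ∀ S : Finset (Fin n),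
      φ z = φ fun i => if i ∈ S then ((z i).1, 0) else z i := by
    intro r z hz S
    induction S using Finset.induction_on with
    | empty => simp
    | insert i S hi ih =>
      rw [ih, step r _ _ i]
      · congr 1
        funext j
        rcases eq_or_ne j i with rfl | hj
        · simp [hi]
        · simp [hj]
      · intro j
        dsimp only
        split_ifs
        · exact (mem_extGrading 𝒱).2 ⟨((mem_extGrading 𝒱).1 (hz j)).1, zero_mem _⟩
        · exact hz j
  refine Multi.ext_homog (extGrading 𝒱 p) fun r z hz => ?_
  rw [all r z hz Finset.univ]
  refine Prod.ext (h _) ?_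
  simp [tPart_apply]

/-- Both sides contain t² and vanish. -/
theorem isGradedTLinear_tPart (𝒰 : ZMod 2 → Submodule k (V × V)) (p q : ZMod 2) {n : ℕ}
    (φ : Multi k n V V) : IsGradedTLinear 𝒰 p q (tPart φ) := by
  intro r z _ i
  rw [mulT_apply, mulT_apply, tPart_apply, tPart_apply, φ.map_coord_zero i (by simp)]
  exact (smul_zero _).symm

theorem IsGradedTLinear.add {p q : ZMod 2} {𝒰 : ZMod 2 → Submodule k (V × V)} {n : ℕ}
    {φ ψ : Multi k n (V × V) (V × V)} (hφ : IsGradedTLinear 𝒰 p q φ)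
    (hψ : IsGradedTLinear 𝒰 p q ψ) : IsGradedTLinear 𝒰 p q (φ + ψ) := by
  intro r z hz i
  rw [add_apply, add_apply, hφ r z hz, hψ r z hz, map_add, smul_add]

theorem IsGradedTLinear.sub {p q : ZMod 2} {𝒰 : ZMod 2 → Submodule k (V × V)} {n : ℕ}
    {φ ψ : Multi k n (V × V) (V × V)} (hφ : IsGradedTLinear 𝒰 p q φ)
    (hψ : IsGradedTLinear 𝒰 p q ψ) : IsGradedTLinear 𝒰 p q (φ - ψ) := by
  intro r z hz i
  rw [sub_apply, sub_apply, hφ r z hz, hψ r z hz, map_sub, smul_sub]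

theorem isGradedTLinear_extBracket (p : ZMod 2) (l : Multi k 2 V V) :
    IsGradedTLinear (extGrading 𝒱 p) p 0 (extBracket 𝒱 p l) := by
  intro r z hz i
  rw [eq_pair (Function.update z i _), eq_pair z, extBracket_apply, extBracket_apply]
  fin_cases i
  · have : Finset.Iio (0 : Fin 2) = ∅ := by decide
    simp [mulT_apply, this]
  · have : Finset.Iio (1 : Fin 2) = {0} := by decide
    simp [mulT_apply, parityTwist_of_mem 𝒱 p ((mem_extGrading 𝒱).1 (hz 0)).1,
      pair_units_smul_left, this]

end Graded

section Graded

variable {k V M : Type*} [Field k] [AddCommGroup V] [Module k V] [AddCommGroup M] [Module k M]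

/-! ### Compatibility of conditions on maps on `V` and on `V[t]` -/

section TPart

variable {𝒱 : ZMod 2 → Submodule k V}

theorem hasParity_tPart_iff {p q : ZMod 2} {n : ℕ} {φ : Multi k n V V} :
    HasParity (extGrading 𝒱 p) (extGrading 𝒱 p) q (tPart φ) ↔ HasParity 𝒱 𝒱 (p + q) φ := by
  have e : ∀ r : Fin n → ZMod 2, q + ∑ i, r i + p = p + q + ∑ i, r i := fun r => by ring
  constructor
  · intro h r v hv
    have := ((mem_extGrading 𝒱).1 (h r _ (hv.inl p))).2
    rwa [e] at this
  · intro h r z hz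
    refine (mem_extGrading 𝒱).2 ⟨zero_mem _, ?_⟩
    rw [e]
    exact h r _ hz.fst

theorem isGradedAlt_tPart_iff {p : ZMod 2} {n : ℕ} {φ : Multi k n V V} :
    IsGradedAlt (extGrading 𝒱 p) (tPart φ) ↔ IsGradedAlt 𝒱 φ := by
  constructor
  · intro h σ r v hv
    exact congrArg Prod.snd (h σ r _ (hv.inl p))
  · intro h σ r z hz
    exact Prod.ext (by simp [tPart_apply]) (h σ r _ hz.fst)

/-- In ⟨v₁, tφ⟩ the parameter moves past v₁. The resulting sign, with exponent p times the parity of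
v₁, accounts for the change from the parity q of tφ to the parity p + q of φ. -/
theorem isCyclic_tPart_iff [DirectSum.Decomposition 𝒱] {p q : ZMod 2}
    {B : V →ₗ[k] V →ₗ[k] k} {n : ℕ} {φ : Multi k n V V} :
    IsCyclic (extGrading 𝒱 p) (extForm 𝒱 p B) q (tPart φ) ↔ IsCyclic 𝒱 B (p + q) φ := by
  have key : ∀ (r : Fin (n + 1) → ZMod 2) z, Homog (extGrading 𝒱 p) r z →
      (extForm 𝒱 p B (tPart φ fun i => z i.castSucc) (z (Fin.last n)) =
        sgn ((n : ZMod 2) + r 0 * q) • extForm 𝒱 p B (z 0) (tPart φ fun i => z i.succ) ↔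
      B (φ fun i => (z i.castSucc).1) (z (Fin.last n)).1 =
        sgn ((n : ZMod 2) + r 0 * (p + q)) • B (z 0).1 (φ fun i => (z i.succ).1)) := by
    intro r z hz
    rw [extForm_apply, extForm_apply, tPart_apply, tPart_apply, Prod.ext_iff,
      parityTwist_of_mem 𝒱 p (hz.fst 0)]
    simp only [map_zero, LinearMap.zero_apply, Prod.smul_fst, Prod.smul_snd, smul_zero, true_and,
      add_zero, zero_add]
    rw [units_smul_eq (k := k) (sgn (p * r 0)), map_smul, LinearMap.smul_apply,
      ← units_smul_eq, sgn_smul_smul, show (n : ZMod 2) + r 0 * q + p * r 0 =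
        n + r 0 * (p + q) by ring]
  constructor
  · intro h r v hv
    exact (key r _ (hv.inl p)).1 (h r _ (hv.inl p))
  · intro h r z hz
    exact (key r z hz).2 (h r _ hz.fst)

end TPart

section Add

variable {𝒱 : ZMod 2 → Submodule k V} {ℳ : ZMod 2 → Submodule k M}

theorem HasParity.add {q : ZMod 2} {n : ℕ} {φ ψ : Multi k n V M} (hφ : HasParity 𝒱 ℳ q φ)
    (hψ : HasParity 𝒱 ℳ q ψ) : HasParity 𝒱 ℳ q (φ + ψ) :=
  fun p v hv => add_mem (hφ p v hv) (hψ p v hv)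

theorem HasParity.sub {q : ZMod 2} {n : ℕ} {φ ψ : Multi k n V M} (hφ : HasParity 𝒱 ℳ q φ)
    (hψ : HasParity 𝒱 ℳ q ψ) : HasParity 𝒱 ℳ q (φ - ψ) :=
  fun p v hv => sub_mem (hφ p v hv) (hψ p v hv)

theorem hasParity_zero {q : ZMod 2} {n : ℕ} : HasParity 𝒱 ℳ q (0 : Multi k n V M) :=
  fun _ _ _ => zero_mem _

theorem IsGradedAlt.add {n : ℕ} {φ ψ : Multi k n V M} (hφ : IsGradedAlt 𝒱 φ)
    (hψ : IsGradedAlt 𝒱 ψ) : IsGradedAlt 𝒱 (φ + ψ) := by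
  intro σ p v hv
  rw [add_apply, add_apply, hφ σ p v hv, hψ σ p v hv, smul_add]

theorem IsGradedAlt.sub {n : ℕ} {φ ψ : Multi k n V M} (hφ : IsGradedAlt 𝒱 φ)
    (hψ : IsGradedAlt 𝒱 ψ) : IsGradedAlt 𝒱 (φ - ψ) := by
  intro σ p v hv
  rw [sub_apply, sub_apply, hφ σ p v hv, hψ σ p v hv, smul_sub]

theorem isGradedAlt_zero {n : ℕ} : IsGradedAlt 𝒱 (0 : Multi k n V M) :=
  fun _ _ _ _ => (smul_zero _).symm

theorem IsGradedSymm.add {n : ℕ} {φ ψ : Multi k n V M} (hφ : IsGradedSymm 𝒱 φ)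
    (hψ : IsGradedSymm 𝒱 ψ) : IsGradedSymm 𝒱 (φ + ψ) := by
  intro σ p v hv
  rw [add_apply, add_apply, hφ σ p v hv, hψ σ p v hv, smul_add]

theorem IsGradedSymm.sub {n : ℕ} {φ ψ : Multi k n V M} (hφ : IsGradedSymm 𝒱 φ)
    (hψ : IsGradedSymm 𝒱 ψ) : IsGradedSymm 𝒱 (φ - ψ) := by
  intro σ p v hv
  rw [sub_apply, sub_apply, hφ σ p v hv, hψ σ p v hv, smul_sub]

theorem IsCyclic.add {B : V →ₗ[k] V →ₗ[k] M} {q : ZMod 2} {n : ℕ} {φ ψ : Multi k n V V}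
    (hφ : IsCyclic 𝒱 B q φ) (hψ : IsCyclic 𝒱 B q ψ) : IsCyclic 𝒱 B q (φ + ψ) := by
  intro p v hv
  rw [add_apply, add_apply, map_add, map_add, LinearMap.add_apply, hφ p v hv, hψ p v hv, smul_add]

theorem IsCyclic.sub {B : V →ₗ[k] V →ₗ[k] M} {q : ZMod 2} {n : ℕ} {φ ψ : Multi k n V V}
    (hφ : IsCyclic 𝒱 B q φ) (hψ : IsCyclic 𝒱 B q ψ) : IsCyclic 𝒱 B q (φ - ψ) := by
  intro p v hv
  rw [sub_apply, sub_apply, map_sub, map_sub, LinearMap.sub_apply, hφ p v hv, hψ p v hv, smul_sub]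

theorem isCyclic_zero {B : V →ₗ[k] V →ₗ[k] M} {q : ZMod 2} {n : ℕ} :
    IsCyclic 𝒱 B q (0 : Multi k n V V) := by
  intro p v hv
  simp

end Add

/-! ### The family of operations given by a bracket -/

section OfBracket

variable {𝒱 : ZMod 2 → Submodule k V} {l : Multi k 2 V V}

theorem ofBracket_of_ne {n : ℕ} (hn : n ≠ 2) : ofBracket l n = 0 := by
  match n, hn with
  | 0, _ => rfl
  | 1, _ => rfl
  | n + 3, _ => rfl

theorem hasParity_ofBracket (hl : IsLieBracket 𝒱 l) (n : ℕ) :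
    HasParity 𝒱 𝒱 (n : ZMod 2) (ofBracket l n) := by
  rcases eq_or_ne n 2 with rfl | hn
  · exact hl.even
  · rw [ofBracket_of_ne hn]
    exact hasParity_zero

theorem isGradedAlt_ofBracket (hl : IsLieBracket 𝒱 l) (n : ℕ) :
    IsGradedAlt 𝒱 (ofBracket l n) := by
  rcases eq_or_ne n 2 with rfl | hn
  · exact hl.isGradedAlt
  · rw [ofBracket_of_ne hn]
    exact isGradedAlt_zero

variable [DirectSum.Decomposition 𝒱]

theorem isGradedTLinear_ofBracket (p : ZMod 2) (n : ℕ) :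
    IsGradedTLinear (extGrading 𝒱 p) p n (ofBracket (extBracket 𝒱 p l) n) := by
  rcases eq_or_ne n 2 with rfl | hn
  · exact isGradedTLinear_extBracket p l
  · rw [ofBracket_of_ne hn]
    exact isGradedTLinear_tPart _ _ _ (0 : Multi k n V V)

theorem ofBracket_extBracket_fst (p : ZMod 2) (n : ℕ) (z : Fin n → V × V) :
    (ofBracket (extBracket 𝒱 p l) n z).1 = ofBracket l n fun i => (z i).1 := by
  rcases eq_or_ne n 2 with rfl | hn
  · exact extBracket_fst 𝒱 p l z
  · rw [ofBracket_of_ne hn, ofBracket_of_ne hn]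
    rfl

/-- For n = 2 the exponent in the cyclicity condition is even, and the condition becomes the
invariance of the inner product. -/
theorem isCyclic_ofBracket_extBracket (hl : IsLieBracket 𝒱 l) {B : V →ₗ[k] V →ₗ[k] k}
    (hinv : IsInvariantForm l B) (p : ZMod 2) (n : ℕ) :
    IsCyclic (extGrading 𝒱 p) (extForm 𝒱 p B) n (ofBracket (extBracket 𝒱 p l) n) := by
  rcases eq_or_ne n 2 with rfl | hn
  · intro r z hz
    change extForm 𝒱 p B (extBracket 𝒱 p l fun i => z i.castSucc) (z 2) =
      sgn (2 + r 0 * 2) • extForm 𝒱 p B (z 0) (extBracket 𝒱 p l fun i => z i.succ)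
    rw [eq_pair fun i : Fin 2 => z i.castSucc, eq_pair fun i : Fin 2 => z i.succ]
    change extForm 𝒱 p B (extBracket 𝒱 p l ![z 0, z 1]) (z 2) =
      sgn (2 + r 0 * 2) • extForm 𝒱 p B (z 0) (extBracket 𝒱 p l ![z 1, z 2])
    have h0 := hz.fst 0
    have h1 := hz.fst 1
    rw [two_eq_zero, mul_zero, add_zero, sgn_zero, one_smul, extForm_apply, extForm_apply,
      extBracket_apply, extBracket_apply]
    simp only [parityTwist_of_mem 𝒱 p h0, parityTwist_of_mem 𝒱 p h1,
      parityTwist_of_mem 𝒱 p (hl.map_mem h0 h1), map_add, LinearMap.add_apply,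
      pair_units_smul_left]
    refine Prod.ext (hinv _ _ _) ?_
    have hinv' : ∀ x y z : V, B (l ![x, y]) z = B x (l ![y, z]) := hinv
    simp only [units_smul_eq (k := k), map_smul, LinearMap.smul_apply, mul_add, sgn_add,
      hinv', smul_eq_mul, Units.val_mul, Int.cast_mul]
    ring
  · rw [ofBracket_of_ne hn]
    exact isCyclic_zero

end OfBracket

/-! ### Composites of families of operations -/

section TotalComp

variable (𝒱 : ZMod 2 → Submodule k V) [DirectSum.Decomposition 𝒱]

/-- The sum of all composites of `F` and `G` with `N` inputs, for a family `G` of parity `s`. -/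
def totalComp (s : ℕ → ZMod 2) (F G : ∀ n, Multi k n V V) (N : ℕ) : Multi k N V V :=
  ∑ b : Fin (N + 1), sgn ((N - b : ℕ) * s b) •
    extComp 𝒱 (a := N - b) (b := b) (by omega) (F (N - b + 1)) (G b)

/-- The signs in `totalComp` are those left over in `suspSign_insert` by an inner map of parity `s
b` followed by N - b further arguments. -/
theorem symComp_suspend (F : ∀ n, Multi k n V V) {G : ∀ n, Multi k n V V} {s : ℕ → ZMod 2}
    (hG : ∀ n, HasParity 𝒱 𝒱 (s n) (G n)) {N : ℕ} {p : Fin N → ZMod 2} {w : Fin N → V}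
    (hw : Homog 𝒱 p w) :
    symComp (fun n => suspend 𝒱 (F n)) (fun n => suspend 𝒱 (G n)) (fun i => p i + 1) w =
      suspSign p • totalComp 𝒱 s F G N w := by
  rw [symComp, totalComp, sum_apply, Finset.smul_sum]
  refine Finset.sum_congr rfl fun b _ => ?_
  rw [sum_unshuffles_suspend 𝒱 _ _ (hG b) hw, smul_apply, smul_smul, mul_comm]

theorem totalComp_add_left (s : ℕ → ZMod 2) (F F' G : ∀ n, Multi k n V V) (N : ℕ) :
    totalComp 𝒱 s (fun n => F n + F' n) G N = totalComp 𝒱 s F G N + totalComp 𝒱 s F' G N := by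
  simp only [totalComp, extComp_add_left, smul_add, Finset.sum_add_distrib]

theorem totalComp_add_right (s : ℕ → ZMod 2) (F G G' : ∀ n, Multi k n V V) (N : ℕ) :
    totalComp 𝒱 s F (fun n => G n + G' n) N = totalComp 𝒱 s F G N + totalComp 𝒱 s F G' N := by
  simp only [totalComp, extComp_add_right, smul_add, Finset.sum_add_distrib]

theorem extComp_zero_left {n a b : ℕ} (h : b + a = n) (ψ : Multi k b V V) :
    extComp 𝒱 h (0 : Multi k (a + 1) V M) ψ = 0 := by
  simpa using extComp_smul_left 𝒱 h (0 : k) (0 : Multi k (a + 1) V M) ψ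

theorem extComp_zero_right {n a b : ℕ} (h : b + a = n) (φ : Multi k (a + 1) V M) :
    extComp 𝒱 h φ (0 : Multi k b V V) = 0 := by
  simpa using extComp_smul_right 𝒱 h (0 : k) φ (0 : Multi k b V V)

theorem totalComp_ofBracket_right (s : ℕ → ZMod 2) (F : ∀ n, Multi k n V V) (l : Multi k 2 V V)
    (a : ℕ) : totalComp 𝒱 s F (ofBracket l) (a + 2) =
      sgn (a * s 2) • extComp 𝒱 (Nat.add_comm 2 a) (F (a + 1)) l := by
  rw [totalComp, Finset.sum_eq_single (⟨2, by omega⟩ : Fin (a + 2 + 1))]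
  · rfl
  · intro b _ hb
    rw [ofBracket_of_ne fun h => hb (Fin.ext h), extComp_zero_right, smul_zero]
  · intro h
    exact absurd (Finset.mem_univ _) h

theorem totalComp_ofBracket_right_of_lt (s : ℕ → ZMod 2) (F : ∀ n, Multi k n V V)
    (l : Multi k 2 V V) {N : ℕ} (hN : N < 2) : totalComp 𝒱 s F (ofBracket l) N = 0 := by
  refine Finset.sum_eq_zero fun b _ => ?_
  rw [ofBracket_of_ne (by omega), extComp_zero_right, smul_zero]

theorem totalComp_ofBracket_left (s : ℕ → ZMod 2) (G : ∀ n, Multi k n V V) (l : Multi k 2 V V)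
    (b : ℕ) : totalComp 𝒱 s (ofBracket l) G (b + 1) =
      sgn (s b) • extComp 𝒱 (a := 1) rfl l (G b) := by
  -- The number b + 1 - b of remaining inputs equals 1 only propositionally, so it is generalized
  -- before substitution.
  have aux : ∀ (a : ℕ) (h : b + a = b + 1), a = 1 →
      sgn (a * s b) • extComp 𝒱 h (ofBracket l (a + 1)) (G b) =
        sgn (s b) • extComp 𝒱 (a := 1) rfl l (G b) := by
    rintro a h rfl
    rw [Nat.cast_one, one_mul]
    rfl
  rw [totalComp, Finset.sum_eq_single (⟨b, by omega⟩ : Fin (b + 1 + 1))]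
  · exact aux (b + 1 - b) (by omega) (by omega)
  · intro b' _ hb
    have h : (b' : ℕ) ≠ b := fun h => hb (Fin.ext h)
    rw [ofBracket_of_ne (by omega), extComp_zero_left, smul_zero]
  · intro h
    exact absurd (Finset.mem_univ _) h

theorem totalComp_of_zero (s : ℕ → ZMod 2) (F : ∀ n, Multi k n V V) {G : ∀ n, Multi k n V V}
    (hG : G 0 = 0) : totalComp 𝒱 s F G 0 = 0 := by
  refine Finset.sum_eq_zero fun b _ => ?_
  obtain rfl : b = 0 := Fin.fin_one_eq_zero b
  change _ • extComp 𝒱 _ _ (G 0) = 0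
  rw [hG, extComp_zero_right, smul_zero]

theorem totalComp_ofBracket_self {l : Multi k 2 V V} (hl : IsLieBracket 𝒱 l) (s : ℕ → ZMod 2)
    (N : ℕ) : totalComp 𝒱 s (ofBracket l) (ofBracket l) N = 0 := by
  cases N with
  | zero => exact totalComp_of_zero 𝒱 s _ rfl
  | succ b =>
    rw [totalComp_ofBracket_left]
    rcases eq_or_ne b 2 with rfl | hb
    · exact (congrArg _ (hl.extComp_self rfl)).trans (smul_zero _)
    · rw [ofBracket_of_ne hb, extComp_zero_right, smul_zero]

/-! ### Composites on `V[t]` -/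

/-- As t² = 0, an outer map divisible by t sees the inner one only modulo t. -/
theorem extComp_tPart_left (p : ZMod 2) {n a b : ℕ} (h : b + a = n) (φ : Multi k (a + 1) V V)
    {ψ : Multi k b (V × V) (V × V)} {ψ' : Multi k b V V}
    (hψ : ∀ z, (ψ z).1 = ψ' fun i => (z i).1) :
    extComp (extGrading 𝒱 p) h (tPart φ) ψ = tPart (extComp 𝒱 h φ ψ') := by
  refine Multi.ext_homog (extGrading 𝒱 p) fun r z hz => ?_
  rw [extComp_apply_homog _ h _ _ hz, tPart_apply, extComp_apply_homog _ h _ _ hz.fst]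
  have e : ∀ σ : Equiv.Perm (Fin n), insertMap h (tPart φ) ψ (fun i => z (σ i)) =
      (0, insertMap h φ ψ' fun i => (z (σ i)).1) := by
    intro σ
    rw [insertMap_apply, insertMap_apply, tPart_apply, ← hψ]
    refine Prod.ext rfl (congrArg φ (funext fun i => ?_))
    cases i using Fin.cases <;> rfl
  simp only [e]
  refine Prod.ext ?_ ?_
  · rw [Prod.fst_sum]
    exact Finset.sum_eq_zero fun σ _ => by simp
  · rw [Prod.snd_sum]
    rfl

/-- The factor t enters through the first slot of the bracket, so it is already in front and causes
no sign. -/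
theorem extComp_extBracket_tPart (p : ZMod 2) (l : Multi k 2 V V) {n : ℕ} (φ : Multi k n V V) :
    extComp (extGrading 𝒱 p) (a := 1) rfl (extBracket 𝒱 p l) (tPart φ) =
      tPart (extComp 𝒱 (a := 1) rfl l φ) := by
  refine Multi.ext_homog (extGrading 𝒱 p) fun r z hz => ?_
  rw [extComp_apply_homog _ _ _ _ hz, tPart_apply, extComp_apply_homog _ _ _ _ hz.fst]
  simp only [insertMap_pair, extBracket_apply, tPart_apply, map_zero, pair_zero_left, add_zero]
  refine Prod.ext ?_ ?_
  · rw [Prod.fst_sum]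
    exact Finset.sum_eq_zero fun σ _ => by simp
  · rw [Prod.snd_sum]
    rfl

theorem totalComp_tPart_left (p : ZMod 2) (s : ℕ → ZMod 2) (φ : ∀ n, Multi k n V V)
    {G : ∀ n, Multi k n (V × V) (V × V)} {G' : ∀ n, Multi k n V V}
    (hG : ∀ n z, (G n z).1 = G' n fun i => (z i).1) (N : ℕ) :
    totalComp (extGrading 𝒱 p) s (fun n => tPart (φ n)) G N = tPart (totalComp 𝒱 s φ G' N) := by
  simp only [totalComp, extComp_tPart_left 𝒱 p _ _ (hG _)]
  ext z
  · simp [tPart_apply, Prod.fst_sum]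
  · simp [tPart_apply, Prod.snd_sum]

end TotalComp

end Graded

section Graded

variable {k V : Type*} [Field k] [AddCommGroup V] [Module k V]

/-! ### Deformations and cyclic cocycles -/

variable {𝒱 : ZMod 2 → Submodule k V} [DirectSum.Decomposition 𝒱] {l : Multi k 2 V V}
  {B : V →ₗ[k] V →ₗ[k] k} {p : ZMod 2}

/-- The operations `l + t φₙ` on `V[t]`. -/
def deformOp (𝒱 : ZMod 2 → Submodule k V) [DirectSum.Decomposition 𝒱] (l : Multi k 2 V V)
    (p : ZMod 2) (φ : ∀ n, Multi k n V V) (n : ℕ) : Multi k n (V × V) (V × V) :=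
  ofBracket (extBracket 𝒱 p l) n + tPart (φ n)

theorem deformOp_fst (φ : ∀ n, Multi k n V V) (n : ℕ) (z : Fin n → V × V) :
    (deformOp 𝒱 l p φ n z).1 = ofBracket l n fun i => (z i).1 := by
  rw [deformOp, add_apply, Prod.fst_add, ofBracket_extBracket_fst, tPart_apply, add_zero]

theorem ofBracket_extBracket_inl_snd (n : ℕ) (v : Fin n → V) :
    (ofBracket (extBracket 𝒱 p l) n fun i => (v i, (0 : V))).2 = 0 := by
  rcases eq_or_ne n 2 with rfl | hn
  · change (extBracket 𝒱 p l fun i => (v i, (0 : V))).2 = 0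
    rw [eq_pair fun i => (v i, (0 : V)), extBracket_apply]
    simp
  · rw [ofBracket_of_ne hn]
    rfl

theorem deformOp_inl_snd (φ : ∀ n, Multi k n V V) (n : ℕ) (v : Fin n → V) :
    (deformOp 𝒱 l p φ n fun i => (v i, (0 : V))).2 = φ n v := by
  rw [deformOp, add_apply, Prod.snd_add, ofBracket_extBracket_inl_snd, tPart_apply, zero_add]

/-- The bracket composed with itself vanishes by the Jacobi identity, and tφ with tφ because t² = 0.
Of the mixed terms, φ∘l has the sign of a · 2, that is +, and l∘φ has (-1)^(a+1) = -(-1)^a, as in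
the coboundary of a cochain of degree a + 1. -/
theorem totalComp_deformOp (hl : IsLieBracket 𝒱 l) (φ : ∀ n, Multi k n V V) (a : ℕ) :
    totalComp (extGrading 𝒱 p) (fun n => n) (deformOp 𝒱 l p φ) (deformOp 𝒱 l p φ) (a + 2) =
      tPart (lieDifferential 𝒱 l a (φ (a + 1))) := by
  rw [show totalComp (extGrading 𝒱 p) (fun n => n) (deformOp 𝒱 l p φ) (deformOp 𝒱 l p φ) (a + 2) =
      totalComp (extGrading 𝒱 p) (fun n => n) (ofBracket (extBracket 𝒱 p l))
        (deformOp 𝒱 l p φ) (a + 2) +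
      totalComp (extGrading 𝒱 p) (fun n => n) (fun n => tPart (φ n))
        (deformOp 𝒱 l p φ) (a + 2) from totalComp_add_left _ _ _ _ _ _,
    show totalComp (extGrading 𝒱 p) (fun n => n) (ofBracket (extBracket 𝒱 p l))
        (deformOp 𝒱 l p φ) (a + 2) =
      totalComp (extGrading 𝒱 p) (fun n => n) (ofBracket (extBracket 𝒱 p l))
        (ofBracket (extBracket 𝒱 p l)) (a + 2) +
      totalComp (extGrading 𝒱 p) (fun n => n) (ofBracket (extBracket 𝒱 p l))
        (fun n => tPart (φ n)) (a + 2) from totalComp_add_right _ _ _ _ _ _,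
    totalComp_ofBracket_self _ (hl.extBracket p), zero_add,
    totalComp_ofBracket_left _ _ _ _ (a + 1), extComp_extBracket_tPart,
    totalComp_tPart_left 𝒱 p _ φ (deformOp_fst φ), totalComp_ofBracket_right]
  have h2 : ((2 : ℕ) : ZMod 2) = 0 := rfl
  rw [h2, mul_zero, sgn_zero, one_smul, Nat.cast_add, sgn_add, Nat.cast_one, sgn_one, mul_neg,
    mul_one, Units.neg_smul, lieDifferential]
  ext z
  · simp [tPart_apply]
  · simp [tPart_apply]
    abel

theorem totalComp_deformOp_of_lt (φ : ∀ n, Multi k n V V)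
    (hφ : φ 0 = 0) {N : ℕ} (hN : N < 2) :
    totalComp (extGrading 𝒱 p) (fun n => n) (deformOp 𝒱 l p φ) (deformOp 𝒱 l p φ) N = 0 := by
  have h0 : deformOp 𝒱 l p φ 0 = 0 := by
    rw [deformOp, hφ, tPart_zero, add_zero]
    rfl
  match N, hN with
  | 0, _ => exact totalComp_of_zero _ _ _ h0
  | 1, _ =>
    rw [show totalComp (extGrading 𝒱 p) (fun n => n) (deformOp 𝒱 l p φ) (deformOp 𝒱 l p φ) 1 =
      totalComp (extGrading 𝒱 p) (fun n => n) (ofBracket (extBracket 𝒱 p l))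
        (deformOp 𝒱 l p φ) 1 +
      totalComp (extGrading 𝒱 p) (fun n => n) (fun n => tPart (φ n))
        (deformOp 𝒱 l p φ) 1 from totalComp_add_left _ _ _ _ _ _,
      totalComp_ofBracket_left _ _ _ _ 0, h0, extComp_zero_right, smul_zero, zero_add,
      totalComp_tPart_left 𝒱 p _ φ (deformOp_fst φ),
      totalComp_ofBracket_right_of_lt _ _ _ _ one_lt_two, tPart_zero]

/-- The difference of the operations and the extended bracket is `k[t]`-linear and zero modulo t, so
`IsGradedTLinear.eq_tPart` applies to it. -/
theorem Deformation.op_eq (m : Deformation 𝒱 l B p) :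
    m.op = deformOp 𝒱 l p m.cochain := by
  funext n
  have h := ((m.isGradedTLinear n).sub
    (isGradedTLinear_ofBracket (l := l) p n)).eq_tPart (c := 0) (fun i => by rw [add_zero])
    (fun z => by rw [sub_apply, Prod.fst_sub, m.reduces, ofBracket_extBracket_fst, sub_self])
  rw [sub_eq_iff_eq_add'] at h
  rw [h, deformOp]
  congr 2
  ext v
  change (m.op n (fun i => (v i, (0 : V))) - ofBracket (extBracket 𝒱 p l) n
    (fun i => (v i, (0 : V)))).2 = (m.op n (fun i => (v i, (0 : V)))).2
  rw [Prod.snd_sub, ofBracket_extBracket_inl_snd, sub_zero]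

theorem Deformation.cochain_zero (m : Deformation 𝒱 l B p) : m.cochain 0 = 0 := by
  ext v
  change (m.op 0 _).2 = 0
  rw [m.isLInfinity.zero]
  rfl

theorem Deformation.tPart_cochain (m : Deformation 𝒱 l B p) (n : ℕ) :
    tPart (m.cochain n) = m.op n - ofBracket (extBracket 𝒱 p l) n := by
  rw [m.op_eq, deformOp, add_sub_cancel_left]

/-- All three conditions are linear and hold for l_t and for the extended bracket, hence for the
difference tλ_n. -/
theorem Deformation.cochain_mem_cyclicCochains (hl : IsLieBracket 𝒱 l) (hinv : IsInvariantForm l B)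
    (m : Deformation 𝒱 l B p) (n : ℕ) : m.cochain n ∈ cyclicCochains 𝒱 B (p + n) n := by
  refine ⟨?_, ?_, ?_⟩
  · rw [← hasParity_tPart_iff, m.tPart_cochain]
    exact (m.isLInfinity.parity n).sub (hasParity_ofBracket (hl.extBracket p) n)
  · rw [← isGradedAlt_tPart_iff (p := p), m.tPart_cochain]
    exact (m.isLInfinity.alt n).sub (isGradedAlt_ofBracket (hl.extBracket p) n)
  · rw [← isCyclic_tPart_iff, m.tPart_cochain]
    exact (m.invariant n).sub (isCyclic_ofBracket_extBracket hl hinv p n)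

theorem Deformation.symComp_op (m : Deformation 𝒱 l B p) {N : ℕ} {r : Fin N → ZMod 2}
    {z : Fin N → V × V} (hz : Homog (extGrading 𝒱 p) r z) :
    symComp (fun n => suspend (extGrading 𝒱 p) (m.op n))
      (fun n => suspend (extGrading 𝒱 p) (m.op n)) (fun i => r i + 1) z =
      suspSign r • totalComp (extGrading 𝒱 p) (fun n => n) m.op m.op N z :=
  symComp_suspend _ _ m.isLInfinity.parity hz

theorem Deformation.lieDifferential_cochain (hl : IsLieBracket 𝒱 l) (m : Deformation 𝒱 l B p)
    (a : ℕ) : lieDifferential 𝒱 l a (m.cochain (a + 1)) = 0 := by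
  refine Multi.ext_homog 𝒱 fun r v hv => ?_
  have h := m.isLInfinity.sq_zero (a + 2) _ _ (hv.inl p).parityReversion
  rw [m.symComp_op (hv.inl p), smul_eq_zero_iff_eq, m.op_eq, totalComp_deformOp hl] at h
  exact congrArg Prod.snd h

theorem Deformation.cochain_mem_cyclicCocycles (hl : IsLieBracket 𝒱 l) (hinv : IsInvariantForm l B)
    (m : Deformation 𝒱 l B p) (a : ℕ) :
    m.cochain (a + 1) ∈ cyclicCocycles 𝒱 l B (p + (a + 1 : ℕ)) a :=
  ⟨m.cochain_mem_cyclicCochains hl hinv (a + 1), m.lieDifferential_cochain hl a⟩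

/-- A sequence indexed by degrees `n ≥ 1`, extended by `0` to degree `0`. -/
def extendZero (φ : ∀ a : ℕ, Multi k (a + 1) V V) : ∀ n, Multi k n V V
  | 0 => 0
  | a + 1 => φ a

/-- The deformation given by a sequence of cyclic cocycles. -/
def Deformation.ofCocycles (hl : IsLieBracket 𝒱 l) (hinv : IsInvariantForm l B)
    (φ : ∀ a : ℕ, cyclicCocycles 𝒱 l B (p + (a + 1 : ℕ)) a) : Deformation 𝒱 l B p :=
  have hφ : ∀ n : ℕ, extendZero (fun a => φ a) n ∈ cyclicCochains 𝒱 B (p + n) n := fun n =>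
    match n with
    | 0 => zero_mem _
    | a + 1 => (φ a).2.1
  have hpar : ∀ n : ℕ, HasParity (extGrading 𝒱 p) (extGrading 𝒱 p) n
      (deformOp 𝒱 l p (extendZero fun a => φ a) n) := fun n =>
    (hasParity_ofBracket (hl.extBracket p) n).add (hasParity_tPart_iff.2 (hφ n).1)
  { op := deformOp 𝒱 l p (extendZero fun a => φ a)
    isLInfinity :=
      { zero := by
          rw [deformOp, extendZero, tPart_zero, add_zero]
          rfl
        parity := hpar
        alt := fun n => (isGradedAlt_ofBracket (hl.extBracket p) n).add
          (isGradedAlt_tPart_iff.2 (hφ n).2.1)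
        sq_zero := by
          intro N r z hz
          have h := symComp_suspend (extGrading 𝒱 p) (deformOp 𝒱 l p (extendZero fun a => φ a))
            hpar hz
          simp only [add_assoc, zmod2_add_self, add_zero] at h
          rw [h]
          match N with
          | 0 => rw [totalComp_deformOp_of_lt _ rfl zero_lt_two]; exact smul_zero _
          | 1 => rw [totalComp_deformOp_of_lt _ rfl one_lt_two]; exact smul_zero _
          | a + 2 =>
            rw [totalComp_deformOp hl]
            have : lieDifferential 𝒱 l a (extendZero (fun a => φ a) (a + 1)) = 0 := (φ a).2.2
            rw [this, tPart_zero]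
            exact smul_zero _ }
    isGradedTLinear := fun n =>
      (isGradedTLinear_ofBracket p n).add (isGradedTLinear_tPart _ _ _ _)
    reduces := deformOp_fst _
    invariant := fun n => (isCyclic_ofBracket_extBracket hl hinv p n).add
      (isCyclic_tPart_iff.2 (hφ n).2.2) }

theorem Deformation.ext_op {m m' : Deformation 𝒱 l B p} (h : m.op = m'.op) : m = m' := by
  cases m
  cases m'
  cases h
  rfl

/-- Deformations correspond to sequences of cyclic cocycles. -/
def deformationEquiv (hl : IsLieBracket 𝒱 l) (hinv : IsInvariantForm l B) :
    Deformation 𝒱 l B p ≃ ∀ a : ℕ, cyclicCocycles 𝒱 l B (p + (a + 1 : ℕ)) a where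
  toFun m a := ⟨m.cochain (a + 1), m.cochain_mem_cyclicCocycles hl hinv a⟩
  invFun := Deformation.ofCocycles hl hinv
  left_inv m := by
    refine Deformation.ext_op ?_
    rw [m.op_eq]
    change deformOp 𝒱 l p _ = _
    refine congrArg (deformOp 𝒱 l p) (funext fun n => ?_)
    cases n with
    | zero => exact m.cochain_zero.symm
    | succ a => rfl
  right_inv φ := by
    funext a
    refine Subtype.ext (MultilinearMap.ext fun v => ?_)
    exact deformOp_inl_snd (extendZero fun a => (φ a : Multi k (a + 1) V V)) (a + 1) v

end Graded

/-! ### Partitions into two blocks, one of which is a singleton -/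

theorem index_emb {N : ℕ} (c : OrderedFinpartition N) (m : Fin c.length) (r : Fin (c.partSize m)) :
    c.index (c.emb m r) = m := by
  by_contra h
  exact c.emb_ne_emb_of_ne h (c.emb_invEmbedding (c.emb m r))

/-- The ordered partition with two given blocks. -/
def twoBlocks {N a b : ℕ} (e : Fin (a + 1) → Fin N) (e' : Fin (b + 1) → Fin N) (he : StrictMono e)
    (he' : StrictMono e') (hlt : e (Fin.last a) < e' (Fin.last b)) (hdisj : ∀ i j, e i ≠ e' j)
    (hcover : ∀ x, (∃ i, e i = x) ∨ ∃ j, e' j = x) : OrderedFinpartition N where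
  length := 2
  partSize := fun
    | 0 => a + 1
    | 1 => b + 1
  partSize_pos := fun
    | 0 => Nat.succ_pos a
    | 1 => Nat.succ_pos b
  emb := fun
    | 0 => e
    | 1 => e'
  emb_strictMono := fun
    | 0 => he
    | 1 => he'
  parts_strictMono := by
    intro i j hij
    have hi : i = 0 := by omega
    have hj : j = 1 := by omega
    subst hi hj
    exact hlt
  disjoint := by
    have h : Disjoint (Set.range e) (Set.range e') := by
      rw [Set.disjoint_iff_forall_ne]
      rintro _ ⟨x, rfl⟩ _ ⟨y, rfl⟩
      exact hdisj x y
    intro i _ j _ hij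
    match i, j, hij with
    | 0, 0, hij => exact absurd rfl hij
    | 0, 1, _ => exact h
    | 1, 0, _ => exact h.symm
    | 1, 1, hij => exact absurd rfl hij
  cover := by
    intro x
    rcases hcover x with ⟨i, hi⟩ | ⟨j, hj⟩
    · exact ⟨0, i, hi⟩
    · exact ⟨1, j, hj⟩

/-- Puts the partition into a form in which block sizes and embeddings reduce definitionally on each
block. -/
theorem exists_eq_twoBlocks {N : ℕ} (c : OrderedFinpartition N) (hc : c.length = 2) :
    ∃ (a b : ℕ) (e : Fin (a + 1) → Fin N) (e' : Fin (b + 1) → Fin N) (he : StrictMono e)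
      (he' : StrictMono e') (hlt : e (Fin.last a) < e' (Fin.last b)) (hdisj : ∀ i j, e i ≠ e' j)
      (hcover : ∀ x, (∃ i, e i = x) ∨ ∃ j, e' j = x),
      c = twoBlocks e e' he he' hlt hdisj hcover := by
  obtain ⟨len, size, pos, emb, mono, parts, disj, cover⟩ := c
  dsimp only at hc
  subst hc
  obtain ⟨a, b, rfl⟩ : ∃ a b : ℕ, size = fun
      | 0 => a + 1
      | 1 => b + 1 := by
    refine ⟨size 0 - 1, size 1 - 1, funext fun i => ?_⟩
    have h := pos i
    match i with
    | 0 => exact (Nat.sub_add_cancel h).symm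
    | 1 => exact (Nat.sub_add_cancel h).symm
  refine ⟨a, b, emb 0, emb 1, mono 0, mono 1, parts (show (0 : Fin 2) < 1 by decide), ?_, ?_, ?_⟩
  · intro i j
    exact Set.disjoint_iff_forall_ne.1
      (disj (Set.mem_univ 0) (Set.mem_univ 1) zero_ne_one) ⟨i, rfl⟩ ⟨j, rfl⟩
  · intro x
    obtain ⟨m, i, hi⟩ := cover x
    match m, i, hi with
    | 0, i, hi => exact Or.inl ⟨i, hi⟩
    | 1, i, hi => exact Or.inr ⟨i, hi⟩
  · have : emb = fun
        | 0 => emb 0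
        | 1 => emb 1 := funext fun i => match i with
      | 0 => rfl
      | 1 => rfl
    simp only [twoBlocks]
    congr

theorem strictMono_fin_one {X : Type*} [Preorder X] (f : Fin (0 + 1) → X) : StrictMono f :=
  @Subsingleton.strictMono (Fin 1) X _ _ _ f

/-- The partition with the blocks `{0, …, n}` and `{n + 1}`. -/
def splitLast (n : ℕ) : OrderedFinpartition (n + 2) :=
  twoBlocks (a := n) (b := 0) (Fin.last (n + 1)).succAbove (fun _ => Fin.last (n + 1))
    (Fin.strictMono_succAbove _) (strictMono_fin_one _)
    (by rw [Fin.succAbove_last]; exact Fin.castSucc_lt_last _)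
    (fun i _ => Fin.succAbove_ne _ i)
    (fun x => by
      rcases eq_or_ne x (Fin.last (n + 1)) with rfl | hx
      · exact Or.inr ⟨0, rfl⟩
      · exact Or.inl (Fin.exists_succAbove_eq hx))

/-- The partition with the blocks `{i}` and its complement, for `i ≠ n + 1`. -/
def splitOff {n : ℕ} (i : Fin (n + 2)) (hi : i ≠ Fin.last (n + 1)) : OrderedFinpartition (n + 2) :=
  twoBlocks (a := 0) (b := n) (fun _ => i) i.succAbove (strictMono_fin_one _)
    (Fin.strictMono_succAbove i)
    (by rw [Fin.succAbove_ne_last_last hi]; exact Fin.lt_last_iff_ne_last.2 hi)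
    (fun _ j => (Fin.succAbove_ne i j).symm)
    (fun x => by
      rcases eq_or_ne x i with rfl | hx
      · exact Or.inl ⟨0, rfl⟩
      · exact Or.inr (Fin.exists_succAbove_eq hx))

/-- The partition into `{i}` and its complement, together with the index of the complement. -/
def splitPair {n : ℕ} (i : Fin (n + 2)) : Σ c : OrderedFinpartition (n + 2), Fin c.length :=
  -- Blocks are ordered by their largest elements, so the complement of i is the second block unless
  -- i itself is the largest element.
  if hi : i = Fin.last (n + 1) then ⟨splitLast n, (0 : Fin 2)⟩ else ⟨splitOff i hi, (1 : Fin 2)⟩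

theorem range_splitPair {n : ℕ} (i : Fin (n + 2)) :
    Set.range ((splitPair i).1.emb (splitPair i).2) = {i}ᶜ := by
  by_cases hi : i = Fin.last (n + 1)
  · subst hi
    rw [splitPair, dif_pos rfl]
    exact Fin.range_succAbove _
  · rw [splitPair, dif_neg hi]
    exact Fin.range_succAbove i

theorem splitPair_injective {n : ℕ} :
    Function.Injective (splitPair : Fin (n + 2) → Σ c : OrderedFinpartition (n + 2), Fin c.length) := by
  intro i j h
  have := congrArg (fun x : Σ c : OrderedFinpartition (n + 2), Fin c.length =>
    Set.range (x.1.emb x.2)) h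
  simp only [range_splitPair] at this
  exact Set.singleton_injective (compl_injective this)

/-- The size follows by counting the range; the equality of maps is heterogeneous because their
domains agree only after that. -/
theorem strictMono_avoiding {n a : ℕ} {e : Fin (a + 1) → Fin (n + 2)} (he : StrictMono e)
    (i : Fin (n + 2)) (hi : ∀ x, (∃ j, e j = x) ↔ x ≠ i) :
    a = n ∧ HEq e i.succAbove := by
  have h : Set.range e = {i}ᶜ := Set.ext hi
  have hcard : a = n := by
    have := congrArg Set.ncard h
    rw [Set.ncard_range_of_injective he.injective, Set.ncard_compl, Set.ncard_singleton] at this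
    simpa using this
  subst hcard
  exact ⟨rfl, heq_of_eq (strictMono_eq_succAbove he fun j => (hi _).1 ⟨j, rfl⟩)⟩

/-- A block of a partition with two blocks is the complement of a singleton if the other block
has one element. -/
theorem mem_range_splitPair {n : ℕ} (c : OrderedFinpartition (n + 2)) (hc : c.length = 2)
    (m : Fin c.length) (hm : ∀ m', m' ≠ m → c.partSize m' = 1) :
    (⟨c, m⟩ : Σ c : OrderedFinpartition (n + 2), Fin c.length) ∈ Set.range splitPair := by
  obtain ⟨a, b, e, e', he, he', hlt, hdisj, hcover, rfl⟩ := exists_eq_twoBlocks c hc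
  change Fin 2 at m
  match m with
  | 0 =>
    have hb : b + 1 = 1 := hm (1 : Fin 2) (show (1 : Fin 2) ≠ 0 by decide)
    obtain rfl : b = 0 := by omega
    obtain ⟨i, rfl⟩ : ∃ i, e' = fun _ => i := ⟨e' 0, funext fun j => by rw [Fin.fin_one_eq_zero j]⟩
    have h : ∀ x, (∃ j, e j = x) ↔ x ≠ i := by
      intro x
      constructor
      · rintro ⟨j, rfl⟩
        exact hdisj j 0
      · intro hx
        rcases hcover x with h | ⟨j, hj⟩
        · exact h
        · exact absurd hj.symm hx
    obtain ⟨rfl, h2⟩ := strictMono_avoiding he i h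
    obtain rfl := eq_of_heq h2
    -- If i were not the largest element, its complement would contain the largest one and could not
    -- be the first block.
    have hi : i = Fin.last (a + 1) := by
      by_contra hi
      rw [Fin.succAbove_ne_last_last hi] at hlt
      exact hlt.not_ge (Fin.le_last _)
    subst hi
    refine ⟨Fin.last _, ?_⟩
    rw [splitPair, dif_pos rfl]
    rfl
  | 1 =>
    have ha : a + 1 = 1 := hm (0 : Fin 2) (show (0 : Fin 2) ≠ 1 by decide)
    obtain rfl : a = 0 := by omega
    obtain ⟨i, rfl⟩ : ∃ i, e = fun _ => i := ⟨e 0, funext fun j => by rw [Fin.fin_one_eq_zero j]⟩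
    have h : ∀ x, (∃ j, e' j = x) ↔ x ≠ i := by
      intro x
      constructor
      · rintro ⟨j, rfl⟩
        exact (hdisj 0 j).symm
      · intro hx
        rcases hcover x with ⟨j, hj⟩ | h
        · exact absurd hj.symm hx
        · exact h
    obtain ⟨rfl, h2⟩ := strictMono_avoiding he' i h
    obtain rfl := eq_of_heq h2
    have hi : i ≠ Fin.last (b + 1) := (hlt.trans_le (Fin.le_last _)).ne
    refine ⟨i, ?_⟩
    rw [splitPair, dif_neg hi]
    rfl

/-! ### Signs of the relevant partitions -/

theorem partitionSign_splitLast {n : ℕ} (p : Fin (n + 2) → ZMod 2) :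
    partitionSign p (splitLast n) = 1 := by
  refine Finset.prod_eq_one fun i _ => Finset.prod_eq_one fun j _ => if_neg ?_
  rintro ⟨hij, h⟩
  obtain ⟨i, rfl⟩ := Fin.exists_succAbove_eq (hij.trans_le (Fin.le_last _)).ne
  have : (splitLast n).index ((Fin.last (n + 1)).succAbove i) = (0 : Fin 2) := index_emb (splitLast n) (0 : Fin 2) i
  rw [this] at h
  exact absurd h (Fin.not_lt_zero (n := 2) _)

/-- The block {i} is listed first, so i passes exactly the smaller indices. -/
theorem partitionSign_splitOff {n : ℕ} (p : Fin (n + 2) → ZMod 2) (i : Fin (n + 2))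
    (hi : i ≠ Fin.last (n + 1)) :
    partitionSign p (splitOff i hi) = sgn (p i * ∑ j ∈ Finset.Iio i, p j) := by
  have h0 : (splitOff i hi).index i = (0 : Fin 2) :=
    index_emb (splitOff i hi) (0 : Fin 2) (0 : Fin 1)
  have h1 : ∀ j, j ≠ i → (splitOff i hi).index j = (1 : Fin 2) := by
    intro j hj
    obtain ⟨j, rfl⟩ := Fin.exists_succAbove_eq hj
    exact index_emb (splitOff i hi) (1 : Fin 2) j
  have key : ∀ a b : Fin (n + 2), (a < b ∧ (splitOff i hi).index b < (splitOff i hi).index a) ↔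
      (a < i ∧ b = i) := by
    intro a b
    constructor
    · rintro ⟨hab, h⟩
      have hb : b = i := by
        by_contra hb
        rw [h1 b hb] at h
        by_cases ha : a = i
        · subst ha
          rw [h0] at h
          exact absurd h (Fin.not_lt_zero (n := 2) _)
        · rw [h1 a ha] at h
          exact lt_irrefl _ h
      exact ⟨hb ▸ hab, hb⟩
    · rintro ⟨ha, rfl⟩
      refine ⟨ha, ?_⟩
      rw [h0, h1 a ha.ne]
      exact (Fin.zero_lt_one : (0 : Fin 2) < 1)
  simp only [partitionSign, key]
  rw [Finset.mul_sum, sgn_sum, ← Finset.filter_gt_eq_Iio, Finset.prod_filter]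
  refine Finset.prod_congr rfl fun a _ => ?_
  by_cases ha : a < i
  · simp [ha, mul_comm]
  · simp [ha]

theorem partitionSign_atomic {N : ℕ} (p : Fin N → ZMod 2) :
    partitionSign p (OrderedFinpartition.atomic N) = 1 := by
  refine Finset.prod_eq_one fun i _ => Finset.prod_eq_one fun j _ => if_neg ?_
  rintro ⟨hij, h⟩
  have : ∀ i : Fin N, (OrderedFinpartition.atomic N).index i = i :=
    fun i => index_emb (OrderedFinpartition.atomic N) i (0 : Fin 1)
  rw [this, this] at h
  exact hij.not_gt h

/-- Blocks are ordered by their largest elements, so singletons enumerate all indices increasingly;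
a strictly increasing surjection is the identity. -/
theorem eq_atomic {N : ℕ} (c : OrderedFinpartition N) (hc : ∀ m, c.partSize m = 1) :
    c = OrderedFinpartition.atomic N := by
  have hlen : c.length = N := by
    have := c.sum_sigma_eq_sum (fun _ : Fin N => (1 : ℕ))
    simpa [hc] using this
  obtain ⟨len, size, pos, emb, mono, parts, disj, cover⟩ := c
  dsimp only at hlen hc
  subst hlen
  obtain rfl : size = fun _ => 1 := funext hc
  have h : (fun m => emb m 0) = id := by
    refine (StrictMono.range_inj (fun i j hij => parts hij) strictMono_id).1 ?_
    rw [Set.range_id, Set.eq_univ_iff_forall]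
    intro x
    obtain ⟨m, r, hr⟩ := cover x
    exact ⟨m, by rw [← hr, Fin.fin_one_eq_zero r]; rfl⟩
  have h' : emb = fun m _ => m := by
    funext m r
    rw [Fin.fin_one_eq_zero r]
    exact congrFun h m
  subst h'
  rfl

section Graded

theorem sum_eq_Iio_add_Ioi {X : Type*} [AddCommMonoid X] {n : ℕ} (f : Fin n → X) (i : Fin n) :
    ∑ j, f j = f i + (∑ j ∈ Finset.Iio i, f j + ∑ j ∈ Finset.Ioi i, f j) := by
  rw [← Finset.filter_gt_eq_Iio, ← Finset.filter_lt_eq_Ioi, Finset.sum_filter, Finset.sum_filter,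
    ← Finset.sum_add_distrib]
  have h : f i = ∑ j, if j = i then f j else 0 := by simp
  rw [h, ← Finset.sum_add_distrib]
  refine Finset.sum_congr rfl fun j _ => ?_
  rcases lt_trichotomy j i with hj | rfl | hj
  · simp [hj, hj.ne, hj.not_gt]
  · simp
  · simp [hj, hj.ne', hj.not_gt]

variable {k V U : Type*} [Field k] [AddCommGroup V] [Module k V] [AddCommGroup U] [Module k U]

/-! ### The identity of the symmetric coalgebra and composites with it -/

/-- The components of the identity of the symmetric coalgebra of `U`. -/
def idFam (k U : Type*) [Field k] [AddCommGroup U] [Module k U] : ∀ n, Multi k n U U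
  | 1 => MultilinearMap.ofSubsingleton k U U (0 : Fin 1) LinearMap.id
  | _ => 0

theorem idFam_one (w : Fin 1 → U) : idFam k U 1 w = w 0 := rfl

theorem idFam_of_ne {n : ℕ} (hn : n ≠ 1) : idFam k U n = 0 := by
  match n, hn with
  | 0, _ => rfl
  | n + 2, _ => rfl

theorem morComp_add_left (d d' f : ∀ n, Multi k n U U) {N : ℕ} (p : Fin N → ZMod 2)
    (w : Fin N → U) :
    morComp (fun n => d n + d' n) f p w = morComp d f p w + morComp d' f p w := by
  simp only [morComp, add_apply, smul_add, Finset.sum_add_distrib]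

theorem symComp_add_left (f f' d : ∀ n, Multi k n U U) {N : ℕ} (p : Fin N → ZMod 2)
    (w : Fin N → U) :
    symComp (fun n => f n + f' n) d p w = symComp f d p w + symComp f' d p w := by
  simp only [symComp, insertMap_add_left, add_apply, smul_add, Finset.sum_add_distrib]

/-- A block that is not a singleton contributes a zero argument, so only the partition into
singletons survives. -/
theorem morComp_idFam (d : ∀ n, Multi k n U U) {N : ℕ} (p : Fin N → ZMod 2) (w : Fin N → U) :
    morComp d (idFam k U) p w = d N w := by
  rw [morComp, Finset.sum_eq_single (OrderedFinpartition.atomic N)]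
  · rw [partitionSign_atomic, one_smul]
    rfl
  · intro c _ hc
    have : ∃ m, c.partSize m ≠ 1 := by
      by_contra! h
      exact hc (eq_atomic c h)
    obtain ⟨m, hm⟩ := this
    rw [(d c.length).map_coord_zero m, smul_zero]
    rw [idFam_of_ne hm]
    rfl
  · intro h
    exact absurd (Finset.mem_univ _) h

theorem unshuffles_self (n : ℕ) : unshuffles n n = {1} := by
  ext σ
  rw [mem_unshuffles, Finset.mem_singleton]
  constructor
  · intro h
    have hmono : StrictMono σ := fun i j hij => h i j hij (Or.inl j.2)
    have := (StrictMono.range_inj hmono strictMono_id).1 (by simp [σ.surjective.range_eq])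
    exact Equiv.ext fun i => congrFun this i
  · rintro rfl i j hij _
    exact hij

theorem symComp_idFam (d : ∀ n, Multi k n U U) {N : ℕ} (p : Fin N → ZMod 2) (w : Fin N → U) :
    symComp (idFam k U) d p w = d N w := by
  have aux : ∀ (a : ℕ) (h : N + a = N), a = 0 → ∀ v : Fin N → U,
      insertMap h (idFam k U (a + 1)) (d N) v = d N v := by
    rintro a h rfl v
    rw [insertMap_apply]
    rfl
  rw [symComp, Finset.sum_eq_single (Fin.last N)]
  · change ∑ σ ∈ unshuffles N N, _ = _
    rw [unshuffles_self, Finset.sum_singleton, koszul_refl, one_smul]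
    exact aux (N - N) (by omega) (by omega) w
  · intro b _ hb
    have hb : (b : ℕ) ≠ N := fun h => hb (Fin.ext h)
    refine Finset.sum_eq_zero fun σ _ => ?_
    rw [idFam_of_ne (by omega)]
    exact smul_zero _
  · intro h
    exact absurd (Finset.mem_univ _) h

variable {𝒱 : ZMod 2 → Submodule k V}

theorem koszul_swap (p : Fin 2 → ZMod 2) : koszul p (Equiv.swap 0 1) = sgn (p 0 * p 1) := by
  simp [koszul, Fin.prod_univ_two, mul_comm]

theorem IsGradedSymm.pair_comm {φ : Multi k 2 V U} (hφ : IsGradedSymm 𝒱 φ) {i j : ZMod 2}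
    {x y : V} (hx : x ∈ 𝒱 i) (hy : y ∈ 𝒱 j) : φ ![x, y] = sgn (i * j) • φ ![y, x] := by
  have h := hφ (Equiv.swap 0 1) ![i, j] ![x, y] (by intro m; fin_cases m <;> assumption)
  rw [koszul_swap, eq_pair fun m => ![x, y] (Equiv.swap 0 1 m)] at h
  simpa using h

/-! ### Composites with the automorphisms `id + t φ` -/

variable [DirectSum.Decomposition 𝒱] {l : Multi k 2 V V} {p : ZMod 2}

/-- The components of the coalgebra endomorphism of `⊙(ΠV[t])` that is given by the maps `φ n`. -/
def equivMap (𝒱 : ZMod 2 → Submodule k V) [DirectSum.Decomposition 𝒱] (φ : ∀ n, Multi k n V V)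
    (n : ℕ) : Multi k n (V × V) (V × V) :=
  idFam k (V × V) n + tPart (suspend 𝒱 (φ n))

/-- The outer map is divisible by t, so id + tφ acts through its reduction modulo t, the identity.
-/
theorem morComp_tPart (ψ φ : ∀ n, Multi k n V V) {N : ℕ} (r : Fin N → ZMod 2)
    (z : Fin N → V × V) :
    morComp (fun n => tPart (ψ n)) (equivMap 𝒱 φ) r z = tPart (ψ N) z := by
  rw [← morComp_idFam (fun n => tPart (ψ n)) r z]
  refine Finset.sum_congr rfl fun c _ => ?_
  simp only [tPart_apply, equivMap, add_apply, Prod.fst_add, add_zero]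

/-- Bilinear maps on `V[t]` are additive up to terms of order `t²`. -/
theorem suspend_ofBracket_add {n : ℕ} (I S : Fin n → V × V) (hS : ∀ m, (S m).1 = 0) :
    suspend (extGrading 𝒱 p) (ofBracket (extBracket 𝒱 p l) n) (fun m => I m + S m) =
      suspend (extGrading 𝒱 p) (ofBracket (extBracket 𝒱 p l) n) I +
      ∑ m, suspend (extGrading 𝒱 p) (ofBracket (extBracket 𝒱 p l) n) (Function.update I m (S m)) := by
  rcases eq_or_ne n 2 with rfl | hn
  · have h : suspend (extGrading 𝒱 p) (ofBracket (extBracket 𝒱 p l) 2) ![S 0, S 1] = 0 := by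
      have hf : ofBracket (extBracket 𝒱 p l) 2 = extBracket 𝒱 p l := rfl
      rw [suspend, MultilinearMap.compLinearMap_apply, hf]
      refine (congrArg (extBracket 𝒱 p l) (eq_pair _)).trans ?_
      rw [extBracket_apply]
      have h0 : ((parityInvolution (extGrading 𝒱 p) ^ (2 - 1 - ((0 : Fin 2) : ℕ)))
          (![S 0, S 1] 0)).1 = 0 := by
        rw [parityInvolution_pow_extGrading_fst]
        simp [hS]
      have h1 : ((parityInvolution (extGrading 𝒱 p) ^ (2 - 1 - ((1 : Fin 2) : ℕ)))
          (![S 0, S 1] 1)).1 = 0 := by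
        rw [parityInvolution_pow_extGrading_fst]
        simp [hS]
      rw [h0, h1]
      simp
    rw [eq_pair fun m => I m + S m, Fin.sum_univ_two, eq_pair (Function.update I 0 (S 0)),
      eq_pair (Function.update I 1 (S 1)), pair_add_left, pair_add_right, pair_add_right, h,
      eq_pair I]
    simp
    abel
  · rw [ofBracket_of_ne hn, suspend_zero]
    simp

/-- The part of order `t` of the composite of `l` with `id + t φ`. -/
theorem sum_partitions_eq (φ : ∀ n, Multi k n V V) (hl : IsLieBracket 𝒱 l)
    (hφ : ∀ n : ℕ, HasParity 𝒱 𝒱 (p + (n + 1)) (φ n))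
    {n : ℕ} {r : Fin (n + 2) → ZMod 2} {z : Fin (n + 2) → V × V}
    (hz : Homog (extGrading 𝒱 p) r z) :
    ∑ x : Σ c : OrderedFinpartition (n + 2), Fin c.length,
      partitionSign (fun i => r i + 1) x.1 •
        suspend (extGrading 𝒱 p) (ofBracket (extBracket 𝒱 p l) x.1.length)
          (Function.update (fun m => idFam k (V × V) (x.1.partSize m) fun j => z (x.1.emb m j)) x.2
            (tPart (suspend 𝒱 (φ (x.1.partSize x.2))) fun j => z (x.1.emb x.2 j))) =
      (sgn n * suspSign r) • extComp (extGrading 𝒱 p) (a := 1) rfl (extBracket 𝒱 p l)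
        (tPart (φ (n + 1))) z := by
  have hpar : HasParity (extGrading 𝒱 p) (extGrading 𝒱 p) (((n + 1 : ℕ) : ZMod 2) + 1)
      (tPart (φ (n + 1))) := hasParity_tPart_iff.2 (hφ (n + 1))
  have hs : ((1 : ℕ) : ZMod 2) * (((n + 1 : ℕ) : ZMod 2) + 1) = n := by
    push_cast
    linear_combination two_eq_zero
  have h := sum_unshuffles_suspend (extGrading 𝒱 p) (a := 1) (b := n + 1) rfl
    (extBracket 𝒱 p l) hpar hz
  rw [hs, sum_unshuffles_last] at h
  rw [← h]
  symm
  -- A term survives only if there are two blocks, since l is bilinear, and the block not fed to φ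
  -- is a singleton, since the identity has no other components. These are the values of
  -- `splitPair`, matching the unshuffles of type (n + 1, 1).
  refine Fintype.sum_of_injective splitPair splitPair_injective _ _ ?_ ?_
  · rintro ⟨c, m⟩ hc
    by_cases h2 : c.length = 2
    · have : ∃ m', m' ≠ m ∧ c.partSize m' ≠ 1 := by
        by_contra! hm
        exact hc (mem_range_splitPair c h2 m hm)
      obtain ⟨m', hm', hsize⟩ := this
      dsimp only
      rw [MultilinearMap.map_coord_zero _ m', smul_zero]
      rw [Function.update_of_ne hm', idFam_of_ne hsize]
      rfl
    · dsimp only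
      rw [ofBracket_of_ne h2, suspend_zero]
      exact smul_zero _
  · intro i
    rw [insertMap_pair, skipPerm_last]
    simp only [skipPerm_castSucc]
    rw [koszul_skipPerm, suspend_tPart]
    by_cases hi : i = Fin.last (n + 1)
    · subst hi
      rw [splitPair, dif_pos rfl]
      dsimp only
      rw [partitionSign_splitLast, ← Fin.top_eq_last, Finset.Ioi_top, Finset.sum_empty, mul_zero,
        sgn_zero]
      congr 2
      refine (eq_pair _).trans ?_ |>.symm
      rfl
    · rw [splitPair, dif_neg hi]
      dsimp only
      rw [partitionSign_splitOff]
      have hsymm := (isGradedSymm_suspend_iff (extGrading 𝒱 p)).2 (hl.extBracket p).isGradedAlt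
      have hT : tPart (suspend 𝒱 (φ (n + 1))) (fun j => z (i.succAbove j)) ∈
          parityReversion (extGrading 𝒱 p) (∑ j, (r (i.succAbove j) + 1)) := by
        have h0 : HasParity (parityReversion (extGrading 𝒱 p)) (parityReversion (extGrading 𝒱 p)) 0
            (suspend (extGrading 𝒱 p) (tPart (φ (n + 1)))) := by
          rw [hasParity_suspend_iff, zero_add]
          exact hpar
        have := h0 _ _ ((hz.comp i.succAbove).parityReversion)
        rwa [suspend_tPart, zero_add] at this
      have hi' : z i ∈ parityReversion (extGrading 𝒱 p) (r i + 1) := hz.parityReversion i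
      -- Here {i} is the first block, whereas `extComp` puts φ first. The exchange moves z i past
      -- all other arguments; combined with the sign for the larger indices, this leaves the sign
      -- for the smaller ones, that of the partition.
      rw [hsymm.pair_comm hT hi', smul_smul]
      have e : (∑ j ∈ Finset.Ioi i, (r j + 1)) + ∑ j, (r (i.succAbove j) + 1) =
          ∑ j ∈ Finset.Iio i, (r j + 1) := by
        have h1 := sum_eq_Iio_add_Ioi (fun j => r j + 1) i
        rw [Fin.sum_univ_succAbove _ i, add_right_inj] at h1
        rw [h1, add_left_comm, zmod2_add_self, add_zero]
      rw [← sgn_add, mul_comm (∑ j, _) (r i + 1), ← mul_add, e]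
      congr 2
      refine (eq_pair _).trans ?_ |>.symm
      rfl

/-- Expanding l on arguments of the form id + tφ and dropping t² leaves l itself and the terms with
one argument replaced by tφ. -/
theorem morComp_ofBracket_equivMap (hl : IsLieBracket 𝒱 l) {φ : ∀ n, Multi k n V V} (h0 : φ 0 = 0)
    (hφ : ∀ n : ℕ, HasParity 𝒱 𝒱 (p + (n + 1)) (φ n)) {N : ℕ} {r : Fin N → ZMod 2}
    {z : Fin N → V × V} (hz : Homog (extGrading 𝒱 p) r z) :
    morComp (fun n => suspend (extGrading 𝒱 p) (ofBracket (extBracket 𝒱 p l) n)) (equivMap 𝒱 φ)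
        (fun i => r i + 1) z =
      suspend (extGrading 𝒱 p) (ofBracket (extBracket 𝒱 p l) N) z +
      suspSign r • totalComp (extGrading 𝒱 p) (fun n => n + 1) (ofBracket (extBracket 𝒱 p l))
        (fun n => tPart (φ n)) N z := by
  have key : morComp (fun n => suspend (extGrading 𝒱 p) (ofBracket (extBracket 𝒱 p l) n))
      (equivMap 𝒱 φ) (fun i => r i + 1) z =
      suspend (extGrading 𝒱 p) (ofBracket (extBracket 𝒱 p l) N) z +
      ∑ x : Σ c : OrderedFinpartition N, Fin c.length,
      partitionSign (fun i => r i + 1) x.1 •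
        suspend (extGrading 𝒱 p) (ofBracket (extBracket 𝒱 p l) x.1.length)
          (Function.update (fun m => idFam k (V × V) (x.1.partSize m) fun j => z (x.1.emb m j)) x.2
            (tPart (suspend 𝒱 (φ (x.1.partSize x.2))) fun j => z (x.1.emb x.2 j))) := by
    rw [← morComp_idFam (fun n => suspend (extGrading 𝒱 p) (ofBracket (extBracket 𝒱 p l) n))
      (fun i => r i + 1) z, Fintype.sum_sigma, morComp, morComp, ← Finset.sum_add_distrib]
    refine Finset.sum_congr rfl fun c _ => ?_
    dsimp only
    rw [← Finset.smul_sum, ← smul_add]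
    congr 1
    exact suspend_ofBracket_add _ _ fun m => rfl
  rw [key]
  congr 1
  have small : N < 2 → ∑ x : Σ c : OrderedFinpartition N, Fin c.length,
      partitionSign (fun i => r i + 1) x.1 •
        suspend (extGrading 𝒱 p) (ofBracket (extBracket 𝒱 p l) x.1.length)
          (Function.update (fun m => idFam k (V × V) (x.1.partSize m) fun j => z (x.1.emb m j)) x.2
            (tPart (suspend 𝒱 (φ (x.1.partSize x.2))) fun j => z (x.1.emb x.2 j))) = 0 := by
    intro hN
    refine Finset.sum_eq_zero fun x _ => ?_
    rw [ofBracket_of_ne (x.1.length_le.trans_lt hN).ne, suspend_zero]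
    exact smul_zero _
  have ht : tPart (φ 0) = 0 := by rw [h0, tPart_zero]
  match N with
  | 0 =>
    rw [small zero_lt_two, totalComp_of_zero _ _ _ ht]
    exact (smul_zero _).symm
  | 1 =>
    rw [small one_lt_two, totalComp_ofBracket_left _ _ _ _ 0, ht, extComp_zero_right, smul_zero]
    exact (smul_zero _).symm
  | n + 2 =>
    rw [sum_partitions_eq φ hl hφ hz, totalComp_ofBracket_left _ _ _ _ (n + 1), smul_apply,
      smul_smul, mul_comm]
    congr 3
    push_cast
    linear_combination -two_eq_zero

theorem equivMap_eq (φ : ∀ n, Multi k n V V) : equivMap 𝒱 φ = fun n =>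
    idFam k (V × V) n + suspend (extGrading 𝒱 p) (tPart (φ n)) := by
  funext n
  rw [equivMap, suspend_tPart]

/-- The endomorphism given by `φ` intertwines two families of operations exactly if their difference
is the coboundary of `φ`. -/
theorem intertwines_iff (hl : IsLieBracket 𝒱 l) {φ lam lam' : ∀ n, Multi k n V V} (h0 : φ 0 = 0)
    (hφ : ∀ n : ℕ, HasParity 𝒱 𝒱 (p + (n + 1)) (φ n))
    (hlam : ∀ n : ℕ, HasParity 𝒱 𝒱 (p + n) (lam n)) (hz : lam 0 = 0) (hz' : lam' 0 = 0) :
    (∀ N (r : Fin N → ZMod 2) w, Homog (parityReversion (extGrading 𝒱 p)) r w →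
      symComp (equivMap 𝒱 φ) (fun n => suspend (extGrading 𝒱 p) (deformOp 𝒱 l p lam n)) r w =
        morComp (fun n => suspend (extGrading 𝒱 p) (deformOp 𝒱 l p lam' n)) (equivMap 𝒱 φ) r w) ↔
    lam' 1 = lam 1 ∧ ∀ a, lam' (a + 2) - lam (a + 2) = lieDifferential 𝒱 l a (φ (a + 1)) := by
  have hop : ∀ n : ℕ, HasParity (extGrading 𝒱 p) (extGrading 𝒱 p) n (deformOp 𝒱 l p lam n) :=
    fun n => (hasParity_ofBracket (hl.extBracket p) n).add (hasParity_tPart_iff.2 (hlam n))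
  -- After cancelling the extended bracket and the common suspension sign, the condition on N inputs
  -- is λ + φ∘l = λ' + l∘φ at order t.
  have key : ∀ N (r : Fin N → ZMod 2) z, Homog (extGrading 𝒱 p) r z →
      (symComp (equivMap 𝒱 φ) (fun n => suspend (extGrading 𝒱 p) (deformOp 𝒱 l p lam n))
          (fun i => r i + 1) z =
        morComp (fun n => suspend (extGrading 𝒱 p) (deformOp 𝒱 l p lam' n)) (equivMap 𝒱 φ)
          (fun i => r i + 1) z ↔
      tPart (lam N + totalComp 𝒱 (fun n => n) φ (ofBracket l) N) z =
        tPart (lam' N) z + totalComp (extGrading 𝒱 p) (fun n => n + 1)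
          (ofBracket (extBracket 𝒱 p l)) (fun n => tPart (φ n)) N z) := by
    intro N r z hz
    have e1 : symComp (equivMap 𝒱 φ) (fun n => suspend (extGrading 𝒱 p) (deformOp 𝒱 l p lam n))
        (fun i => r i + 1) z = suspSign r • deformOp 𝒱 l p lam N z +
          suspSign r • tPart (totalComp 𝒱 (fun n => n) φ (ofBracket l) N) z := by
      rw [equivMap_eq (p := p), symComp_add_left, symComp_idFam, symComp_suspend _ _ hop hz,
        suspend_apply_homog _ _ hz, totalComp_tPart_left 𝒱 p _ φ (deformOp_fst lam)]
    have e2 : morComp (fun n => suspend (extGrading 𝒱 p) (deformOp 𝒱 l p lam' n)) (equivMap 𝒱 φ)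
        (fun i => r i + 1) z = suspSign r • ofBracket (extBracket 𝒱 p l) N z +
        suspSign r • totalComp (extGrading 𝒱 p) (fun n => n + 1)
          (ofBracket (extBracket 𝒱 p l)) (fun n => tPart (φ n)) N z + suspSign r • tPart (lam' N) z := by
      have : (fun n => suspend (extGrading 𝒱 p) (deformOp 𝒱 l p lam' n)) = fun n =>
          suspend (extGrading 𝒱 p) (ofBracket (extBracket 𝒱 p l) n) + tPart (suspend 𝒱 (lam' n)) := by
        funext n
        rw [deformOp, suspend_add, suspend_tPart]
      rw [this, morComp_add_left, morComp_ofBracket_equivMap hl h0 hφ hz, morComp_tPart,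
        ← suspend_tPart 𝒱 p, suspend_apply_homog _ _ hz, suspend_apply_homog _ _ hz]
    rw [e1, e2, ← smul_add, ← smul_add, ← smul_add, smul_left_cancel_iff, deformOp, add_apply,
      add_assoc, add_assoc, add_right_inj, add_comm (totalComp _ _ _ _ _ _)]
    have e3 : ∀ φ ψ : Multi k N V V, tPart (φ + ψ) z = tPart φ z + tPart ψ z := fun φ ψ =>
      Prod.ext (add_zero (0 : V)).symm rfl
    rw [e3]
  have key' : ∀ N, (∀ (r : Fin N → ZMod 2) w, Homog (parityReversion (extGrading 𝒱 p)) r w →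
      symComp (equivMap 𝒱 φ) (fun n => suspend (extGrading 𝒱 p) (deformOp 𝒱 l p lam n)) r w =
        morComp (fun n => suspend (extGrading 𝒱 p) (deformOp 𝒱 l p lam' n)) (equivMap 𝒱 φ) r w) ↔
      tPart (lam N + totalComp 𝒱 (fun n => n) φ (ofBracket l) N) =
        tPart (lam' N) + totalComp (extGrading 𝒱 p) (fun n => n + 1)
          (ofBracket (extBracket 𝒱 p l)) (fun n => tPart (φ n)) N := by
    intro N
    constructor
    · intro h
      refine Multi.ext_homog (extGrading 𝒱 p) fun r z hz => ?_
      exact (key N r z hz).1 (h _ z hz.parityReversion)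
    · intro h r z hz
      have := (key N _ z hz).2 (congrArg (fun F => F z) h)
      simpa only [add_assoc, zmod2_add_self, add_zero] using this
  have inj : ∀ {N : ℕ} {φ ψ : Multi k N V V}, tPart φ = tPart ψ ↔ φ = ψ := by
    intro N φ ψ
    constructor
    · intro h
      ext v
      exact congrArg (fun F => (F fun i => (v i, (0 : V))).2) h
    · rintro rfl
      rfl
  have tadd : ∀ {N : ℕ} (φ ψ : Multi k N V V), tPart φ + tPart ψ = tPart (φ + ψ) := by
    intro N φ ψ
    ext z
    · exact add_zero (0 : V)
    · rfl
  have ht : tPart (φ 0) = 0 := by rw [h0, tPart_zero]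
  have c0 : tPart (lam 0 + totalComp 𝒱 (fun n => n) φ (ofBracket l) 0) =
        tPart (lam' 0) + totalComp (extGrading 𝒱 p) (fun n => n + 1)
          (ofBracket (extBracket 𝒱 p l)) (fun n => tPart (φ n)) 0 := by
    rw [totalComp_of_zero 𝒱 _ _ rfl, totalComp_of_zero _ _ _ ht, hz, hz', add_zero, add_zero]
  -- With a single input, φ∘l is absent because l needs two inputs, and l∘φ would need φ_0, which is
  -- zero.
  have c1 : tPart (lam 1 + totalComp 𝒱 (fun n => n) φ (ofBracket l) 1) =
        tPart (lam' 1) + totalComp (extGrading 𝒱 p) (fun n => n + 1)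
          (ofBracket (extBracket 𝒱 p l)) (fun n => tPart (φ n)) 1 ↔ lam' 1 = lam 1 := by
    rw [totalComp_ofBracket_right_of_lt _ _ _ _ one_lt_two, totalComp_ofBracket_left _ _ _ _ 0, ht,
      extComp_zero_right, smul_zero, add_zero, add_zero, inj, eq_comm]
  have c2 : ∀ a, tPart (lam (a + 2) + totalComp 𝒱 (fun n => n) φ (ofBracket l) (a + 2)) =
        tPart (lam' (a + 2)) + totalComp (extGrading 𝒱 p) (fun n => n + 1)
          (ofBracket (extBracket 𝒱 p l)) (fun n => tPart (φ n)) (a + 2) ↔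
        lam' (a + 2) - lam (a + 2) = lieDifferential 𝒱 l a (φ (a + 1)) := by
    intro a
    have s1 : (a : ZMod 2) * ((2 : ℕ) : ZMod 2) = 0 := mul_zero _
    -- The degree a + 1 component of φ enters with the parity of a + 2, which gives l∘φ the sign
    -- (-1)^a of the coboundary.
    have s2 : ((a + 1 : ℕ) : ZMod 2) + 1 = a := by
      push_cast
      linear_combination two_eq_zero
    have tsmul : ∀ {N : ℕ} (u : ℤˣ) (φ : Multi k N V V), u • tPart φ = tPart (u • φ) := by
      intro N u φ
      ext z
      · simp [tPart_apply]
      · rfl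
    rw [totalComp_ofBracket_right, totalComp_ofBracket_left _ _ _ _ (a + 1),
      extComp_extBracket_tPart, s1, s2, sgn_zero, one_smul, tsmul, tadd, inj, sub_eq_iff_eq_add,
      ← sub_eq_iff_eq_add, eq_comm]
    change _ ↔ lam' (a + 2) = extComp 𝒱 (Nat.add_comm 2 a) (φ (a + 1)) l -
      sgn a • extComp 𝒱 (a := 1) rfl l (φ (a + 1)) + lam (a + 2)
    rw [sub_add_eq_add_sub, add_comm (extComp _ _ _ _)]
  constructor
  · intro h
    exact ⟨c1.1 ((key' 1).1 (h 1)), fun a => (c2 a).1 ((key' (a + 2)).1 (h (a + 2)))⟩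
  · rintro ⟨h1, h2⟩ N
    match N with
    | 0 => exact (key' 0).2 c0
    | 1 => exact (key' 1).2 (c1.2 h1)
    | a + 2 => exact (key' (a + 2)).2 ((c2 a).2 (h2 a))

end Graded

section Graded

variable {k V M U : Type*} [Field k] [AddCommGroup V] [Module k V] [AddCommGroup M] [Module k M]
  [AddCommGroup U] [Module k U]

/-! ### Rotations -/

theorem cons_skipPerm_zero {X : Type*} {N : ℕ} (x : X) (w : Fin N → X) :
    (fun i => (Fin.cons x w : Fin (N + 1) → X) (skipPerm 0 i)) =
      (Fin.snoc (α := fun _ => X) w x) := by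
  funext i
  induction i using Fin.lastCases with
  | last => simp
  | cast i => simp

theorem IsGradedAlt.cons_eq_snoc {𝒱 : ZMod 2 → Submodule k V} {N : ℕ} {φ : Multi k (N + 1) V M}
    (hφ : IsGradedAlt 𝒱 φ) {P : Fin N → ZMod 2} {w : Fin N → V} (hw : Homog 𝒱 P w)
    {a : ZMod 2} {x : V} (hx : x ∈ 𝒱 a) :
    φ (Fin.cons x w) = sgn (N + a * ∑ i, P i) • φ (Fin.snoc (α := fun _ => V) w x) := by
  have h := hφ (skipPerm 0) _ _ (hw.cons hx)
  have e := sum_eq_Iio_add_Ioi (Fin.cons a P : Fin (N + 1) → ZMod 2) 0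
  have e0 : Finset.Iio (0 : Fin (N + 1)) = ∅ :=
    Finset.eq_empty_of_forall_notMem fun i hi => Fin.not_lt_zero i (Finset.mem_Iio.1 hi)
  rw [e0, Finset.sum_empty, zero_add, Fin.sum_univ_succ, add_right_inj] at e
  simp only [Fin.cons_succ] at e
  rw [cons_skipPerm_zero, sign_skipPerm, koszul_skipPerm, ← e, Fin.cons_zero, ← sgn_add] at h
  exact h

/-! ### Isometries -/

theorem evalSubset_univ (f : ∀ n, Multi k n U U) {N : ℕ} (w : Fin N → U) (x : U) :
    evalSubset f w Finset.univ x = f (N + 1) (Fin.snoc (α := fun _ => U) w x) := by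
  have aux : ∀ (m : ℕ) (g : Fin m → U) (h : m = N), (∀ j, g j = w (Fin.cast h j)) →
      f (m + 1) (Fin.snoc (α := fun _ => U) g x) =
        f (N + 1) (Fin.snoc (α := fun _ => U) w x) := by
    rintro m g rfl hg
    obtain rfl : g = w := funext hg
    rfl
  refine aux _ _ (Finset.card_fin N) fun j => ?_
  congr 1
  have h := Finset.orderEmbOfFin_unique (s := (Finset.univ : Finset (Fin N))) rfl
    (f := Fin.cast (Finset.card_fin N)) (fun _ => Finset.mem_univ _) (fun _ _ h => h)
  exact (congrFun h j).symm

theorem evalSubset_idFam_empty {N : ℕ} (w : Fin N → U) (x : U) :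
    evalSubset (idFam k U) w ∅ x = x := rfl

theorem evalSubset_idFam_of_ne {N : ℕ} (w : Fin N → U) (x : U) {I : Finset (Fin N)} (hI : I ≠ ∅) :
    evalSubset (idFam k U) w I x = 0 := by
  rw [evalSubset, idFam_of_ne]
  · rfl
  · simpa using hI

theorem subsetSign_univ {N : ℕ} (p : Fin N → ZMod 2) (a : ZMod 2) :
    subsetSign p a Finset.univ = 1 := by
  simp [subsetSign]

theorem subsetSign_empty {N : ℕ} (p : Fin N → ZMod 2) (a : ZMod 2) :
    subsetSign p a ∅ = sgn (a * ∑ j, p j) := by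
  simp [subsetSign]

/-- The last position has exponent zero in the suspension sign. -/
theorem suspSign_snoc {N : ℕ} (P : Fin N → ZMod 2) (a b : ZMod 2) :
    suspSign (Fin.snoc (α := fun _ => ZMod 2) P a) =
      suspSign (Fin.snoc (α := fun _ => ZMod 2) P b) := by
  simp [suspSign, Fin.sum_univ_castSucc]

theorem sgn_smul_add_eq_zero_iff {X Y : M} {α β γ δ : ZMod 2} (h : β = α + γ + δ + 1) :
    sgn α • X + sgn β • Y = 0 ↔ sgn γ • X = sgn δ • Y := by
  have h1 : sgn (α + γ) • (sgn α • X + sgn β • Y) = sgn γ • X - sgn δ • Y := by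
    rw [smul_add, sgn_smul_smul, sgn_smul_smul, h,
      show α + γ + α = γ + α * 2 by ring,
      show α + γ + (α + γ + δ + 1) = δ + 1 + (α + γ) * 2 by ring, two_eq_zero, mul_zero, mul_zero,
      add_zero, add_zero, sgn_add δ, sgn_one, mul_neg_one, Units.neg_smul, sub_eq_add_neg]
  rw [← smul_eq_zero_iff_eq (sgn (α + γ)), h1, sub_eq_zero]

variable {𝒱 : ZMod 2 → Submodule k V} [DirectSum.Decomposition 𝒱] {B : V →ₗ[k] V →ₗ[k] k}
  {p : ZMod 2}

/-- For id + tφ, the product of two corrections has t², and the identity accepts no w's. So at order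
t either x receives all of w (I everything) or y does (I empty). -/
theorem preserves_sum_eq (φ : ∀ n, Multi k n V V) {N : ℕ} (r : Fin N → ZMod 2)
    (w : Fin N → V × V) (a : ZMod 2) (x y : V × V) :
    ∑ I : Finset (Fin N), subsetSign r a I •
        extForm 𝒱 p B (parityInvolution (extGrading 𝒱 p) (evalSubset (equivMap 𝒱 φ) w I x))
          (evalSubset (equivMap 𝒱 φ) w Iᶜ y) =
      (if N = 0 then extForm 𝒱 p B (parityInvolution (extGrading 𝒱 p) x) y else 0) +
      (extForm 𝒱 p B (parityInvolution (extGrading 𝒱 p)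
          (tPart (suspend 𝒱 (φ (N + 1))) (Fin.snoc (α := fun _ => V × V) w x))) y +
        sgn (a * ∑ j, r j) • extForm 𝒱 p B (parityInvolution (extGrading 𝒱 p) x)
          (tPart (suspend 𝒱 (φ (N + 1))) (Fin.snoc (α := fun _ => V × V) w y))) := by
  set ε := parityInvolution (extGrading 𝒱 p) with hε
  set T : ∀ n, Multi k n (V × V) (V × V) := fun n => tPart (suspend 𝒱 (φ n)) with hT
  have split : ∀ (I : Finset (Fin N)) x, evalSubset (equivMap 𝒱 φ) w I x =
      evalSubset (idFam k (V × V)) w I x + evalSubset T w I x := fun _ _ => rfl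
  have tt : ∀ I J : Finset (Fin N),
      extForm 𝒱 p B (ε (evalSubset T w I x)) (evalSubset T w J y) = 0 := by
    intro I J
    rw [hε, parityInvolution_extGrading, extForm_apply]
    simp [evalSubset, hT, tPart_apply]
  have h1 : ∑ I : Finset (Fin N), subsetSign r a I •
      extForm 𝒱 p B (ε (evalSubset (idFam k (V × V)) w I x))
        (evalSubset (idFam k (V × V)) w Iᶜ y) = if N = 0 then extForm 𝒱 p B (ε x) y else 0 := by
    split_ifs with hN
    · subst hN
      rw [Fintype.sum_unique]
      have e : (default : Finset (Fin 0)) = ∅ := Subsingleton.elim _ _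
      have e' : (∅ᶜ : Finset (Fin 0)) = ∅ := Subsingleton.elim _ _
      rw [e, e', evalSubset_idFam_empty, evalSubset_idFam_empty, subsetSign_empty]
      simp
    · refine Finset.sum_eq_zero fun I _ => ?_
      by_cases hI : I = ∅
      · have : Iᶜ ≠ ∅ := by
          subst hI
          have : NeZero N := ⟨hN⟩
          rw [Finset.compl_empty]
          exact Finset.univ_nonempty.ne_empty
        rw [evalSubset_idFam_of_ne w y this, map_zero, smul_zero]
      · rw [evalSubset_idFam_of_ne w x hI, map_zero, map_zero, LinearMap.zero_apply, smul_zero]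
  have h2 : ∑ I : Finset (Fin N), subsetSign r a I • extForm 𝒱 p B (ε (evalSubset T w I x))
        (evalSubset (idFam k (V × V)) w Iᶜ y) =
      extForm 𝒱 p B (ε (T (N + 1) (Fin.snoc (α := fun _ => V × V) w x))) y := by
    rw [Finset.sum_eq_single Finset.univ]
    · rw [subsetSign_univ, one_smul, evalSubset_univ, Finset.compl_univ, evalSubset_idFam_empty]
    · intro I _ hI
      have : Iᶜ ≠ ∅ := fun h => hI ((Finset.compl_eq_empty_iff I).1 h)
      rw [evalSubset_idFam_of_ne w y this, map_zero, smul_zero]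
    · intro h
      exact absurd (Finset.mem_univ _) h
  have h3 : ∑ I : Finset (Fin N), subsetSign r a I •
        extForm 𝒱 p B (ε (evalSubset (idFam k (V × V)) w I x)) (evalSubset T w Iᶜ y) =
      sgn (a * ∑ j, r j) •
        extForm 𝒱 p B (ε x) (T (N + 1) (Fin.snoc (α := fun _ => V × V) w y)) := by
    rw [Finset.sum_eq_single ∅]
    · rw [subsetSign_empty, evalSubset_idFam_empty, Finset.compl_empty, evalSubset_univ]
    · intro I _ hI
      rw [evalSubset_idFam_of_ne w x hI, map_zero, map_zero, LinearMap.zero_apply, smul_zero]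
    · intro h
      exact absurd (Finset.mem_univ _) h
  rw [← h1, ← h2, ← h3, ← Finset.sum_add_distrib, ← Finset.sum_add_distrib]
  refine Finset.sum_congr rfl fun I _ => ?_
  rw [split, split, map_add, map_add, map_add, LinearMap.add_apply, LinearMap.add_apply, tt,
    add_zero, smul_add, smul_add]
  abel

/-- The endomorphism given by `φ` preserves the inner product exactly if all `φ n` are cyclic. -/
theorem preservesInnerProduct_iff {φ : ∀ n, Multi k n V V}
    (hφ : ∀ n : ℕ, HasParity 𝒱 𝒱 (p + (n + 1)) (φ n)) (halt : ∀ n, IsGradedAlt 𝒱 (φ n)) :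
    PreservesInnerProduct (extGrading 𝒱 p) (extForm 𝒱 p B) (equivMap 𝒱 φ) ↔
      ∀ n : ℕ, IsCyclic 𝒱 B (p + (n + 1 + 1)) (φ (n + 1)) := by
  -- The order t condition compares ω(tφ(w, x), y) with ω(x, tφ(w, y)). Rotating x to the front of
  -- the first term turns it into cyclicity on (x, w, y). Parities on ΠV are those on V plus one,
  -- hence a + 1 and P j + 1.
  have key : ∀ (N : ℕ) (P : Fin N → ZMod 2) (w : Fin N → V × V) (a b : ZMod 2) (x y : V × V),
      Homog (extGrading 𝒱 p) P w → x ∈ extGrading 𝒱 p a → y ∈ extGrading 𝒱 p b →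
      (extForm 𝒱 p B (parityInvolution (extGrading 𝒱 p)
          (tPart (suspend 𝒱 (φ (N + 1))) (Fin.snoc (α := fun _ => V × V) w x))) y +
        sgn ((a + 1) * ∑ j, (P j + 1)) • extForm 𝒱 p B (parityInvolution (extGrading 𝒱 p) x)
          (tPart (suspend 𝒱 (φ (N + 1))) (Fin.snoc (α := fun _ => V × V) w y)) = 0 ↔
      B (φ (N + 1) (Fin.cons x.1 fun j => (w j).1)) y.1 =
        sgn (((N + 1 : ℕ) : ZMod 2) + a * (p + (N + 1 + 1))) •
          B x.1 (φ (N + 1) (Fin.snoc (α := fun _ => V) (fun j => (w j).1) y.1))) := by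
    intro N P w a b x y hw hx hy
    have hx' := (mem_extGrading 𝒱).1 hx
    have hy' := (mem_extGrading 𝒱).1 hy
    have fs : ∀ z : V × V, (fun i => (Fin.snoc (α := fun _ => V × V) w z i).1) =
        Fin.snoc (α := fun _ => V) (fun j => (w j).1) z.1 := by
      intro z
      funext i
      induction i using Fin.lastCases <;> simp
    have hX := hφ (N + 1) _ _ (hw.fst.snoc hx'.1)
    rw [Fin.sum_univ_castSucc] at hX
    simp only [Fin.snoc_castSucc, Fin.snoc_last] at hX
    rw [(halt (N + 1)).cons_eq_snoc hw.fst hx'.1]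
    simp only [tPart_apply, fs]
    rw [suspend_apply_homog 𝒱 _ (hw.fst.snoc hx'.1), suspend_apply_homog 𝒱 _ (hw.fst.snoc hy'.1),
      suspSign_snoc P a 0, suspSign_snoc P b 0, parityInvolution_extGrading,
      parityInvolution_of_mem _ hx, extForm_apply, extForm_apply,
      parityInvolution_of_mem 𝒱 (units_smul_mem _ _ hX), Prod.ext_iff]
    simp only [Prod.smul_fst, Prod.smul_snd, Prod.fst_add, Prod.snd_add, map_zero, smul_zero,
      LinearMap.zero_apply, add_zero, zero_add, Prod.fst_zero, Prod.snd_zero, true_and]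
    rw [parityTwist_of_mem 𝒱 p (units_smul_mem _ _ hx'.1)]
    set X := φ (N + 1) (Fin.snoc (α := fun _ => V) (fun j => (w j).1) x.1)
    set Y := φ (N + 1) (Fin.snoc (α := fun _ => V) (fun j => (w j).1) y.1)
    -- Both terms carry the same suspension sign, as it does not depend on the parity of the last
    -- argument; it cancels.
    set κ := suspSign (Fin.snoc (α := fun _ => ZMod 2) P 0)
    have bl : ∀ (u : ℤˣ) (v v' : V), B (u • v) v' = u • B v v' := by
      intro u v v'
      rw [units_smul_eq (k := k), map_smul, LinearMap.smul_apply, ← units_smul_eq]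
    have br : ∀ (u : ℤˣ) (v v' : V), B v (u • v') = u • B v v' := by
      intro u v v'
      rw [units_smul_eq (k := k), map_smul, ← units_smul_eq]
    simp only [bl, br]
    rw [smul_comm _ κ, smul_comm _ κ, smul_comm _ κ, smul_comm _ κ, smul_comm _ κ, ← smul_add,
      smul_eq_zero_iff_eq]
    simp only [sgn_smul_smul]
    refine sgn_smul_add_eq_zero_iff ?_
    rw [Finset.sum_add_distrib]
    simp only [Finset.sum_const, Finset.card_univ, Fintype.card_fin, nsmul_eq_mul, mul_one]
    push_cast
    generalize ∑ i, P i = S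
    generalize (N : ZMod 2) = n
    linear_combination -(p + n + 2 + a) * two_eq_zero
  have pres : PreservesInnerProduct (extGrading 𝒱 p) (extForm 𝒱 p B) (equivMap 𝒱 φ) ↔
      ∀ (N : ℕ) (P : Fin N → ZMod 2) (w : Fin N → V × V) (a b : ZMod 2) (x y : V × V),
      Homog (extGrading 𝒱 p) P w → x ∈ extGrading 𝒱 p a → y ∈ extGrading 𝒱 p b →
      (extForm 𝒱 p B (parityInvolution (extGrading 𝒱 p)
          (tPart (suspend 𝒱 (φ (N + 1))) (Fin.snoc (α := fun _ => V × V) w x))) y +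
        sgn ((a + 1) * ∑ j, (P j + 1)) • extForm 𝒱 p B (parityInvolution (extGrading 𝒱 p) x)
          (tPart (suspend 𝒱 (φ (N + 1))) (Fin.snoc (α := fun _ => V × V) w y)) = 0) := by
    have cancel : ∀ a : ZMod 2, a + 1 + 1 = a := by decide
    constructor
    · intro h N P w a b x y hw hx hy
      have := h N (fun i => P i + 1) w (a + 1) (b + 1) x y hw.parityReversion
        (by rw [parityReversion, cancel]; exact hx) (by rw [parityReversion, cancel]; exact hy)
      rw [preserves_sum_eq] at this
      exact left_eq_add.1 this.symm
    · intro h N r w a b x y hw hx hy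
      have := h N (fun i => r i + 1) w (a + 1) (b + 1) x y hw hx hy
      simp only [cancel] at this
      rw [preserves_sum_eq, this, add_zero]
  rw [pres]
  constructor
  · intro h N P v hv
    have hv0 : v = Fin.cons (v 0) (Fin.snoc (α := fun _ => V) (fun j : Fin N => v j.castSucc.succ)
        (v (Fin.last (N + 1)))) := by
      funext i
      induction i using Fin.cases with
      | zero => rfl
      | succ i =>
        rw [Fin.cons_succ]
        induction i using Fin.lastCases <;> simp
    have h1 : (fun i : Fin (N + 1) => v i.castSucc) =
        Fin.cons (v 0) fun j : Fin N => v j.castSucc.succ := by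
      funext i
      induction i using Fin.cases <;> simp
    have h2 : (fun i : Fin (N + 1) => v i.succ) =
        Fin.snoc (α := fun _ => V) (fun j : Fin N => v j.castSucc.succ) (v (Fin.last (N + 1))) := by
      funext i
      induction i using Fin.lastCases <;> simp
    rw [h1, h2]
    have hw : Homog 𝒱 (fun j : Fin N => P j.castSucc.succ) fun j : Fin N => v j.castSucc.succ :=
      fun j => hv _
    exact (key N _ _ _ _ (v 0, 0) (v (Fin.last (N + 1)), 0) (hw.inl p)
      ((mem_extGrading 𝒱).2 ⟨hv 0, zero_mem _⟩)
      ((mem_extGrading 𝒱).2 ⟨hv (Fin.last (N + 1)), zero_mem _⟩)).1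
      (h N _ _ _ _ _ _ (hw.inl p) ((mem_extGrading 𝒱).2 ⟨hv 0, zero_mem _⟩)
      ((mem_extGrading 𝒱).2 ⟨hv (Fin.last (N + 1)), zero_mem _⟩))
  · intro h N P w a b x y hw hx hy
    refine (key N P w a b x y hw hx hy).2 ?_
    have hc := h N _ _ ((hw.fst.snoc ((mem_extGrading 𝒱).1 hy).1).cons ((mem_extGrading 𝒱).1 hx).1)
    have h1 : (fun i : Fin (N + 1) => (Fin.cons x.1 (Fin.snoc (α := fun _ => V)
        (fun j => (w j).1) y.1) : Fin (N + 2) → V) i.castSucc) =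
        Fin.cons x.1 fun j : Fin N => (w j).1 := by
      funext i
      induction i using Fin.cases with
      | zero => rfl
      | succ i =>
        rw [← Fin.succ_castSucc, Fin.cons_succ, Fin.cons_succ]
        simp
    rw [h1, ← Fin.succ_last] at hc
    simpa using hc

end Graded

section Graded

variable {k V U : Type*} [Field k] [AddCommGroup V] [Module k V] [AddCommGroup U] [Module k U]

/-! ### Equivalence of deformations -/

theorem hasParity_idFam (𝒰 : ZMod 2 → Submodule k U) (n : ℕ) :
    HasParity 𝒰 𝒰 0 (idFam k U n) := by
  rcases eq_or_ne n 1 with rfl | hn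
  · intro p v hv
    rw [idFam_one, zero_add, Fin.sum_univ_one]
    exact hv 0
  · rw [idFam_of_ne hn]
    exact hasParity_zero

theorem isGradedSymm_idFam (𝒰 : ZMod 2 → Submodule k U) (n : ℕ) :
    IsGradedSymm 𝒰 (idFam k U n) := by
  rcases eq_or_ne n 1 with rfl | hn
  · intro σ p v _
    obtain rfl : σ = 1 := Subsingleton.elim _ _
    rw [koszul_refl, one_smul]
    rfl
  · rw [idFam_of_ne hn]
    exact fun _ _ _ _ => (smul_zero _).symm

theorem isGradedTLinear_idFam (𝒰 : ZMod 2 → Submodule k (V × V)) (p : ZMod 2) (n : ℕ) :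
    IsGradedTLinear 𝒰 p 0 (idFam k (V × V) n) := by
  rcases eq_or_ne n 1 with rfl | hn
  · intro r z _ i
    obtain rfl : i = 0 := Subsingleton.elim _ _
    have e0 : Finset.Iio (0 : Fin 1) = ∅ := by decide
    rw [idFam_one, idFam_one, e0, Function.update_self]
    simp
  · rw [idFam_of_ne hn]
    exact isGradedTLinear_tPart _ _ _ (0 : Multi k n V V)

variable {𝒱 : ZMod 2 → Submodule k V} [DirectSum.Decomposition 𝒱] {l : Multi k 2 V V}
  {B : V →ₗ[k] V →ₗ[k] k} {p : ZMod 2}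

/-- A `k[t]`-linear endomorphism that is the identity modulo `t` has the form `id + t φ`. -/
theorem eq_equivMap {f : ∀ n, Multi k n (V × V) (V × V)}
    (hf : ∀ n, IsGradedTLinear (parityReversion (extGrading 𝒱 p)) p 0 (f n))
    (h1 : ∀ z : Fin 1 → V × V, (f 1 z).1 = (z 0).1)
    (hn : ∀ n, n ≠ 1 → ∀ z : Fin n → V × V, (f n z).1 = 0) :
    f = equivMap 𝒱 fun n => suspend 𝒱 ((LinearMap.snd k V V).compMultilinearMap
      ((f n).compLinearMap fun _ => LinearMap.inl k V V)) := by
  funext n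
  have hfst : ∀ z, ((f n - idFam k (V × V) n) z).1 = 0 := by
    intro z
    rw [sub_apply, Prod.fst_sub, sub_eq_zero]
    rcases eq_or_ne n 1 with rfl | hn'
    · exact h1 z
    · rw [hn n hn', idFam_of_ne hn']
      rfl
  have h := ((hf n).sub (isGradedTLinear_idFam _ p n)).eq_tPart (c := 1) (fun i => rfl) hfst
  rw [sub_eq_iff_eq_add'] at h
  conv_lhs => rw [h]
  rw [equivMap, suspend_suspend]
  congr 2
  ext v
  change (f n (fun i => (v i, (0 : V))) - idFam k (V × V) n (fun i => (v i, (0 : V)))).2 =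
    (f n (fun i => (v i, (0 : V)))).2
  have : (idFam k (V × V) n (fun i => (v i, (0 : V)))).2 = 0 := by
    rcases eq_or_ne n 1 with rfl | hn'
    · rfl
    · rw [idFam_of_ne hn']
      rfl
  rw [Prod.snd_sub, this, sub_zero]

/-- The identity is even, so only tφ matters. The parity p + n + 1 found for φ_n is that of the
cochains of degree n + 1, as a primitive requires. -/
theorem hasParity_equivMap_iff {φ : ∀ n, Multi k n V V} {n : ℕ} :
    HasParity (parityReversion (extGrading 𝒱 p)) (parityReversion (extGrading 𝒱 p)) 0
      (equivMap 𝒱 φ n) ↔ HasParity 𝒱 𝒱 (p + (n + 1)) (φ n) := by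
  have e : equivMap 𝒱 φ n = idFam k (V × V) n + suspend (extGrading 𝒱 p) (tPart (φ n)) := by
    rw [equivMap, suspend_tPart]
  have h := hasParity_suspend_iff (extGrading 𝒱 p) (q := 0) (φ := tPart (φ n))
  rw [hasParity_tPart_iff, zero_add] at h
  rw [← h, e]
  constructor
  · intro h
    have := h.sub (hasParity_idFam _ n)
    rwa [add_sub_cancel_left] at this
  · exact fun h => (hasParity_idFam _ n).add h

theorem isGradedSymm_equivMap_iff {φ : ∀ n, Multi k n V V} {n : ℕ} :
    IsGradedSymm (parityReversion (extGrading 𝒱 p)) (equivMap 𝒱 φ n) ↔ IsGradedAlt 𝒱 (φ n) := by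
  have e : equivMap 𝒱 φ n = idFam k (V × V) n + suspend (extGrading 𝒱 p) (tPart (φ n)) := by
    rw [equivMap, suspend_tPart]
  rw [← isGradedAlt_tPart_iff (p := p), ← isGradedSymm_suspend_iff, e]
  constructor
  · intro h
    have := h.sub (isGradedSymm_idFam _ n)
    rwa [add_sub_cancel_left] at this
  · exact fun h => (isGradedSymm_idFam _ n).add h

/-- Deformations are equivalent exactly if their cocycles are cohomologous. -/
theorem Deformation.isEquivalent_iff (hl : IsLieBracket 𝒱 l) (hinv : IsInvariantForm l B)
    (m m' : Deformation 𝒱 l B p) :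
    m.IsEquivalent m' ↔ ∀ a, m'.cochain (a + 1) - m.cochain (a + 1) ∈
      cyclicCoboundaries 𝒱 l B (p + (a + 1 : ℕ)) a := by
  have hm := fun n => (m.cochain_mem_cyclicCochains hl hinv n).1
  have cast : ∀ a : ℕ, p + ((a + 1 + 1 : ℕ) : ZMod 2) = p + ((a : ZMod 2) + 1 + 1) := by
    intro a
    push_cast
    rfl
  constructor
  · rintro ⟨f, hf, ht, h1, hn, hpres⟩
    obtain ⟨φ, rfl⟩ : ∃ φ, f = equivMap 𝒱 φ := ⟨_, eq_equivMap ht h1 hn⟩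
    have h0 : φ 0 = 0 := by
      have := hf.zero
      rw [equivMap, idFam_of_ne zero_ne_one, zero_add] at this
      rw [← suspend_suspend 𝒱 (φ 0)]
      have h2 : suspend 𝒱 (φ 0) = 0 := by
        ext v
        exact congrArg (fun F => (F fun i => (v i, (0 : V))).2) this
      rw [h2, suspend_zero]
    have hpar := fun n => hasParity_equivMap_iff.1 (hf.parity n)
    have halt := fun n => isGradedSymm_equivMap_iff.1 (hf.symm n)
    have hcyc := (preservesInnerProduct_iff hpar halt).1 hpres
    have hint := hf.intertwines
    rw [m.op_eq, m'.op_eq, intertwines_iff hl h0 hpar hm m.cochain_zero m'.cochain_zero] at hint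
    intro a
    cases a with
    -- In degree 1 the cocycles must agree exactly, in accordance with the zero space of
    -- coboundaries there.
    | zero => exact (Submodule.mem_bot k).2 (sub_eq_zero.2 hint.1)
    | succ a =>
      refine Submodule.mem_map.2 ⟨φ (a + 1), ⟨?_, halt _, ?_⟩, (hint.2 a).symm⟩
      · have := hpar (a + 1)
        push_cast at this ⊢
        exact this
      · rw [cast]
        exact hcyc a
  · intro h
    have h' : ∀ a, ∃ φ ∈ cyclicCochains 𝒱 B (p + (a + 1 + 1 : ℕ)) (a + 1),
        lieDifferential 𝒱 l a φ = m'.cochain (a + 2) - m.cochain (a + 2) :=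
      fun a => Submodule.mem_map.1 (h (a + 1))
    -- Cyclic primitives in the separate degrees are independent and together form one automorphism,
    -- with component 0 in degree 0.
    choose φ hφ hd using h'
    have hpar : ∀ n : ℕ, HasParity 𝒱 𝒱 (p + (n + 1)) (extendZero φ n) := by
      intro n
      cases n with
      | zero => exact hasParity_zero
      | succ a =>
        have := (hφ a).1
        push_cast at this ⊢
        exact this
    have halt : ∀ n : ℕ, IsGradedAlt 𝒱 (extendZero φ n) := by
      intro n
      cases n with
      | zero => exact isGradedAlt_zero
      | succ a => exact (hφ a).2.1
    refine ⟨equivMap 𝒱 (extendZero φ), ⟨?_, fun n => hasParity_equivMap_iff.2 (hpar n),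
      fun n => isGradedSymm_equivMap_iff.2 (halt n), ?_⟩, ?_, ?_, ?_, ?_⟩
    · rw [equivMap, idFam_of_ne zero_ne_one, zero_add, extendZero, suspend_zero, tPart_zero]
    · rw [m.op_eq, m'.op_eq, intertwines_iff hl rfl hpar hm m.cochain_zero m'.cochain_zero]
      exact ⟨sub_eq_zero.1 ((Submodule.mem_bot k).1 (h 0)), fun a => (hd a).symm⟩
    · exact fun n => (isGradedTLinear_idFam _ p n).add (isGradedTLinear_tPart _ _ _ _)
    · intro z
      exact add_zero _
    · intro n hn z
      rw [equivMap, idFam_of_ne hn, zero_add, tPart_apply]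
    · rw [preservesInnerProduct_iff hpar halt]
      intro a
      have := (hφ a).2.2
      rwa [cast] at this

/-- Coboundaries form a subspace, so automorphisms need not be inverted or composed. -/
theorem Deformation.equivalence_isEquivalent (hl : IsLieBracket 𝒱 l) (hinv : IsInvariantForm l B) :
    Equivalence (Deformation.IsEquivalent (𝒱 := 𝒱) (l := l) (B := B) (p := p)) where
  refl m := (isEquivalent_iff hl hinv m m).2 fun a => by
    rw [sub_self]
    exact zero_mem _
  symm := by
    intro m m' h
    rw [isEquivalent_iff hl hinv] at h ⊢
    intro a
    rw [← neg_sub]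
    exact neg_mem (h a)
  trans := by
    intro m m' m'' h h'
    rw [isEquivalent_iff hl hinv] at h h' ⊢
    intro a
    rw [← sub_add_sub_cancel]
    exact add_mem (h' a) (h a)

theorem isEquivalent_iff_class_eq (hl : IsLieBracket 𝒱 l) (hinv : IsInvariantForm l B)
    (m m' : Deformation 𝒱 l B p) :
    m.IsEquivalent m' ↔ (fun a => (Submodule.Quotient.mk (deformationEquiv hl hinv m a) :
        CyclicCohomology 𝒱 l B (p + (a + 1 : ℕ)) a)) =
      fun a => Submodule.Quotient.mk (deformationEquiv hl hinv m' a) := by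
  rw [m.isEquivalent_iff hl hinv, funext_iff]
  refine forall_congr' fun a => ?_
  rw [eq_comm, Submodule.Quotient.eq]
  rfl

/-- Equivalence classes of deformations correspond to sequences of cyclic cohomology classes. -/
def deformationClassEquiv (hl : IsLieBracket 𝒱 l) (hinv : IsInvariantForm l B) :
    Quot (Deformation.IsEquivalent (𝒱 := 𝒱) (l := l) (B := B) (p := p)) ≃
      ∀ a : ℕ, CyclicCohomology 𝒱 l B (p + (a + 1 : ℕ)) a :=
  Equiv.ofBijective
    (Quot.lift (fun m a => Submodule.Quotient.mk (deformationEquiv hl hinv m a))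
      fun m m' h => (isEquivalent_iff_class_eq hl hinv m m').1 h)
    (by
      constructor
      · rintro ⟨m⟩ ⟨m'⟩ h
        exact Quot.sound ((isEquivalent_iff_class_eq hl hinv m m').2 h)
      · intro c
        choose φ hφ using fun a => Submodule.Quotient.mk_surjective _ (c a)
        refine ⟨Quot.mk _ ((deformationEquiv hl hinv).symm φ), ?_⟩
        funext a
        change Submodule.Quotient.mk (deformationEquiv hl hinv
          ((deformationEquiv hl hinv).symm φ) a) = c a
        rw [Equiv.apply_symm_apply, hφ])

end Graded

/-! ### Permutations that fix the last element -/

/-- The extension of a permutation by a fixed last element. -/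
def extPerm {n : ℕ} (σ : Equiv.Perm (Fin n)) : Equiv.Perm (Fin (n + 1)) :=
  finSuccEquivLast.symm.permCongr (Equiv.optionCongr σ)

@[simp] theorem extPerm_castSucc {n : ℕ} (σ : Equiv.Perm (Fin n)) (i : Fin n) :
    extPerm σ i.castSucc = (σ i).castSucc := by
  simp [extPerm, Equiv.permCongr_apply]

@[simp] theorem extPerm_last {n : ℕ} (σ : Equiv.Perm (Fin n)) :
    extPerm σ (Fin.last n) = Fin.last n := by
  simp [extPerm, Equiv.permCongr_apply]

theorem koszul_extPerm {n : ℕ} (p : Fin (n + 1) → ZMod 2) (σ : Equiv.Perm (Fin n)) :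
    koszul p (extPerm σ) = koszul (fun i => p i.castSucc) σ := by
  rw [koszul, Fin.prod_univ_castSucc]
  simp only [Fin.prod_univ_castSucc, extPerm_castSucc, extPerm_last, Fin.castSucc_lt_castSucc_iff,
    (Fin.castSucc_lt_last _).not_gt, and_false, false_and, lt_irrefl, if_false,
    Finset.prod_const_one, mul_one]
  rfl

theorem sign_extPerm {n : ℕ} (σ : Equiv.Perm (Fin n)) :
    Equiv.Perm.sign (extPerm σ) = Equiv.Perm.sign σ := by
  rw [sign_eq_koszul_one, koszul_extPerm, sign_eq_koszul_one]

theorem exists_eq_extPerm {n : ℕ} (π : Equiv.Perm (Fin (n + 1))) (h : π (Fin.last n) = Fin.last n) :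
    ∃ τ, π = extPerm τ := by
  have hne : ∀ i : Fin n, π i.castSucc ≠ Fin.last n := fun i hi =>
    (Fin.castSucc_lt_last i).ne (π.injective (hi.trans h.symm))
  have hinj : Function.Injective fun i : Fin n => (π i.castSucc).castPred (hne i) := by
    intro i j hij
    exact Fin.castSucc_injective n (π.injective (Fin.castPred_inj.1 hij))
  refine ⟨Equiv.ofBijective _ (Finite.injective_iff_bijective.1 hinj), Equiv.ext fun i => ?_⟩
  induction i using Fin.lastCases with
  | last => rw [extPerm_last, h]
  | cast i => simp

/-- Every permutation that moves the last element factors through the rotation. -/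
theorem exists_eq_mul_rotation {n : ℕ} (π : Equiv.Perm (Fin (n + 2)))
    (h : π (Fin.last (n + 1)) ≠ Fin.last (n + 1)) :
    ∃ τ τ', π = extPerm τ * (skipPerm 0 * extPerm τ') := by
  obtain ⟨i, hi⟩ : ∃ i : Fin (n + 1), i.castSucc = π (Fin.last (n + 1)) :=
    ⟨(π (Fin.last (n + 1))).castPred h, by simp⟩
  -- The rotation followed by the swap of 0 and i sends the last element to i, as π does, so the
  -- remaining factor fixes it.
  obtain ⟨τ', hτ'⟩ := exists_eq_extPerm
    ((skipPerm 0)⁻¹ * ((extPerm (Equiv.swap 0 i))⁻¹ * π)) (by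
      rw [Equiv.Perm.mul_apply, Equiv.Perm.mul_apply, Equiv.Perm.inv_eq_iff_eq, skipPerm_last,
        Equiv.Perm.inv_eq_iff_eq, ← hi]
      change i.castSucc = extPerm (Equiv.swap 0 i) (0 : Fin (n + 1)).castSucc
      rw [extPerm_castSucc, Equiv.swap_apply_left])
  exact ⟨Equiv.swap 0 i, τ', by rw [← hτ']; group⟩

/-- The permutation `(n, n + 1, 0, …, n - 1)`. -/
def rotateTwo (n : ℕ) : Equiv.Perm (Fin (n + 2)) := (skipPerm 0 * skipPerm 0)⁻¹

theorem rotateTwo_zero (n : ℕ) : rotateTwo n 0 = (Fin.last n).castSucc := by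
  rw [rotateTwo, Equiv.Perm.inv_eq_iff_eq, Equiv.Perm.mul_apply, skipPerm_castSucc,
    Fin.succAbove_zero, Fin.succ_last, skipPerm_last]

theorem rotateTwo_one (n : ℕ) : rotateTwo n 1 = Fin.last (n + 1) := by
  rw [rotateTwo, Equiv.Perm.inv_eq_iff_eq, Equiv.Perm.mul_apply, skipPerm_last]
  exact (skipPerm_castSucc 0 (0 : Fin (n + 1))).symm

theorem rotateTwo_succ_succ {n : ℕ} (j : Fin n) :
    rotateTwo n j.succ.succ = j.castSucc.castSucc := by
  rw [rotateTwo, Equiv.Perm.inv_eq_iff_eq, Equiv.Perm.mul_apply, skipPerm_castSucc,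
    Fin.succAbove_zero, Fin.succ_castSucc, skipPerm_castSucc, Fin.succAbove_zero]

theorem sign_rotateTwo (n : ℕ) : Equiv.Perm.sign (rotateTwo n) = 1 := by
  rw [rotateTwo, Equiv.Perm.sign_inv, Equiv.Perm.sign_mul, Int.units_mul_self]

theorem koszul_skipPerm_zero {n : ℕ} (p : Fin (n + 1) → ZMod 2) :
    koszul p (skipPerm 0) = sgn (p 0 * ∑ i : Fin n, p i.succ) := by
  have e := sum_eq_Iio_add_Ioi p 0
  have e0 : Finset.Iio (0 : Fin (n + 1)) = ∅ :=
    Finset.eq_empty_of_forall_notMem fun i hi => Fin.not_lt_zero i (Finset.mem_Iio.1 hi)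
  rw [e0, Finset.sum_empty, zero_add, Fin.sum_univ_succ, add_right_inj] at e
  rw [koszul_skipPerm, ← e]

/-- Found from the inverse by multiplicativity. In the two rotations the last two elements cross
each other twice, so only their passage across the others leaves a sign. -/
theorem koszul_rotateTwo {n : ℕ} (p : Fin (n + 2) → ZMod 2) :
    koszul p (rotateTwo n) = sgn ((p (Fin.last n).castSucc + p (Fin.last (n + 1))) *
      ∑ j : Fin n, p j.castSucc.castSucc) := by
  have h := koszul_mul p (rotateTwo n) (skipPerm 0 * skipPerm 0)
  rw [show rotateTwo n * (skipPerm 0 * skipPerm 0) = 1 from inv_mul_cancel _, koszul_refl,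
    koszul_mul, koszul_skipPerm_zero, koszul_skipPerm_zero] at h
  have s1 : skipPerm (0 : Fin (n + 2)) 0 = 1 := skipPerm_castSucc 0 (0 : Fin (n + 1))
  have s2 : ∀ j : Fin n, skipPerm (0 : Fin (n + 2)) j.castSucc.succ = j.succ.succ := by
    intro j
    rw [Fin.succ_castSucc, skipPerm_castSucc, Fin.succAbove_zero]
  rw [Fin.sum_univ_succ, Fin.sum_univ_castSucc, Fin.succ_last, skipPerm_last, s1, rotateTwo_zero] at h
  simp only [s2, rotateTwo_succ_succ] at h
  rw [show (0 : Fin (n + 1)).succ = 1 from rfl, rotateTwo_one, ← sgn_add] at h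
  rw [← mul_one (koszul p _), ← sgn_mul_self ((p (Fin.last n).castSucc + p (Fin.last (n + 1))) *
      ∑ j : Fin n, p j.castSucc.castSucc), ← mul_assoc]
  refine (congrArg (· * _) ?_).trans (one_mul _)
  refine (congrArg (fun s => koszul p (rotateTwo n) * sgn s) ?_).trans h.symm
  linear_combination
    -(p (Fin.last n).castSucc * p (Fin.last (n + 1))) * two_eq_zero

/-- The largest element ends one of the two increasing runs. Either it stays last, or it is the
second entry of the pair in front; then the first entry i is arbitrary and determines the rest. -/
theorem sum_unshuffles_two {X : Type*} [AddCommMonoid X] (a : ℕ)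
    (F : Equiv.Perm (Fin (a + 3)) → X) :
    ∑ σ ∈ unshuffles (a + 3) 2, F σ = ∑ τ ∈ unshuffles (a + 2) 2, F (extPerm τ) +
      ∑ i : Fin (a + 2), F (extPerm (skipPerm i) * rotateTwo (a + 1)) := by
  classical
  rw [← Finset.sum_filter_add_sum_filter_not _
    (fun σ : Equiv.Perm (Fin (a + 3)) => σ (Fin.last (a + 2)) = Fin.last (a + 2))]
  congr 1
  · symm
    refine Finset.sum_bij (fun τ _ => extPerm τ) ?_ ?_ ?_ fun _ _ => rfl
    · intro τ hτ
      rw [mem_unshuffles] at hτ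
      rw [Finset.mem_filter, mem_unshuffles]
      refine ⟨fun i j hij h => ?_, extPerm_last τ⟩
      induction j using Fin.lastCases with
      | last =>
        obtain ⟨i, rfl⟩ : ∃ i' : Fin (a + 2), i'.castSucc = i := ⟨i.castPred hij.ne, by simp⟩
        rw [extPerm_last, extPerm_castSucc]
        exact Fin.castSucc_lt_last _
      | cast j =>
        obtain ⟨i, rfl⟩ : ∃ i' : Fin (a + 2), i'.castSucc = i :=
          ⟨i.castPred (hij.trans (Fin.castSucc_lt_last j)).ne, by simp⟩
        rw [extPerm_castSucc, extPerm_castSucc]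
        exact hτ i j hij h
    · intro τ _ τ' _ h
      refine Equiv.ext fun i => Fin.castSucc_injective _ ?_
      rw [← extPerm_castSucc, ← extPerm_castSucc]
      exact congrArg (fun σ : Equiv.Perm (Fin (a + 3)) => σ i.castSucc) h
    · intro σ hσ
      rw [Finset.mem_filter, mem_unshuffles] at hσ
      obtain ⟨τ, rfl⟩ := exists_eq_extPerm σ hσ.2
      refine ⟨τ, mem_unshuffles.2 fun i j hij h => ?_, rfl⟩
      have := hσ.1 i.castSucc j.castSucc hij h
      rwa [extPerm_castSucc, extPerm_castSucc] at this
  · symm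
    have e0 : ∀ i : Fin (a + 2), (extPerm (skipPerm i) * rotateTwo (a + 1)) 0 = i.castSucc := by
      intro i
      rw [Equiv.Perm.mul_apply, rotateTwo_zero, extPerm_castSucc, skipPerm_last]
    have e1 : ∀ i : Fin (a + 2),
        (extPerm (skipPerm i) * rotateTwo (a + 1)) 1 = Fin.last (a + 2) := by
      intro i
      rw [Equiv.Perm.mul_apply, rotateTwo_one, extPerm_last]
    have e2 : ∀ (i : Fin (a + 2)) (j : Fin (a + 1)),
        (extPerm (skipPerm i) * rotateTwo (a + 1)) j.succ.succ = (i.succAbove j).castSucc := by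
      intro i j
      rw [Equiv.Perm.mul_apply, rotateTwo_succ_succ, extPerm_castSucc, skipPerm_castSucc]
    refine Finset.sum_bij (fun i _ => extPerm (skipPerm i) * rotateTwo (a + 1)) ?_ ?_ ?_
      fun _ _ => rfl
    · intro i _
      rw [Finset.mem_filter, mem_unshuffles]
      constructor
      · intro x y hxy h
        rcases h with h | h
        · obtain rfl : y = 1 := Fin.ext (by rw [Fin.val_one]; omega)
          obtain rfl : x = 0 := Fin.ext (by rw [Fin.val_zero]; rw [Fin.lt_def, Fin.val_one] at hxy; omega)
          rw [e0, e1]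
          exact Fin.castSucc_lt_last i
        · obtain ⟨x, rfl⟩ : ∃ x' : Fin (a + 1), x'.succ.succ = x :=
            ⟨⟨x - 2, by omega⟩, Fin.ext (by simp; omega)⟩
          obtain ⟨y, rfl⟩ : ∃ y' : Fin (a + 1), y'.succ.succ = y :=
            ⟨⟨y - 2, by omega⟩, Fin.ext (by simp; omega)⟩
          rw [e2, e2, Fin.castSucc_lt_castSucc_iff]
          exact Fin.strictMono_succAbove i (by simpa using hxy)
      · intro h
        have : (extPerm (skipPerm i) * rotateTwo (a + 1)) (Fin.last a).succ.succ =
            Fin.last (a + 2) := h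
        rw [e2] at this
        exact (Fin.castSucc_lt_last _).ne this
    · intro i _ j _ h
      refine Fin.castSucc_injective _ ?_
      rw [← e0, ← e0]
      exact congrArg (fun σ : Equiv.Perm (Fin (a + 3)) => σ 0) h
    · intro σ hσ
      rw [Finset.mem_filter, mem_unshuffles] at hσ
      obtain ⟨hmono, hlast⟩ := hσ
      have h1 : σ 1 = Fin.last (a + 2) := by
        obtain ⟨x, hx⟩ := σ.surjective (Fin.last (a + 2))
        have hmax : ∀ y, ¬ σ x < σ y := fun y h => (hx ▸ h).not_ge (Fin.le_last _)
        have hx2 : (x : ℕ) < 2 := by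
          by_contra h2
          refine hmax (Fin.last (a + 2)) (hmono x _ (Fin.lt_last_iff_ne_last.2 ?_) (Or.inr (by omega)))
          rintro rfl
          exact hlast hx
        have hx0 : (x : ℕ) ≠ 0 := by
          intro h0
          refine hmax 1 (hmono x 1 (by rw [Fin.lt_def, h0, Fin.val_one]; omega) (Or.inl ?_))
          rw [Fin.val_one]
          omega
        have : x = 1 := Fin.ext (by rw [Fin.val_one]; omega)
        rwa [this] at hx
      have h0 : σ 0 ≠ Fin.last (a + 2) := fun h => Fin.zero_ne_one (σ.injective (h.trans h1.symm))
      obtain ⟨i, hi⟩ : ∃ i : Fin (a + 2), i.castSucc = σ 0 := ⟨(σ 0).castPred h0, by simp⟩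
      have hne : ∀ j : Fin (a + 1), σ j.succ.succ ≠ Fin.last (a + 2) := by
        intro j hj
        have := congrArg Fin.val (σ.injective (hj.trans h1.symm))
        rw [Fin.val_one, Fin.val_succ, Fin.val_succ] at this
        omega
      have h2 : (fun j : Fin (a + 1) => (σ j.succ.succ).castPred (hne j)) = i.succAbove := by
        refine strictMono_eq_succAbove (fun x y hxy => ?_) fun j hj => ?_
        · exact hmono x.succ.succ y.succ.succ (by simpa using hxy)
            (Or.inr (by rw [Fin.val_succ, Fin.val_succ]; omega))
        · have h3 : σ j.succ.succ = σ 0 := by rw [← hi, ← hj, Fin.castSucc_castPred]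
          exact Fin.succ_ne_zero _ (σ.injective h3)
      refine ⟨i, Finset.mem_univ _, Equiv.ext fun x => ?_⟩
      induction x using Fin.cases with
      | zero => rw [e0, hi]
      | succ x =>
        induction x using Fin.cases with
        | zero => exact (e1 i).trans h1.symm
        | succ j => rw [e2, ← h2, Fin.castSucc_castPred]

section Graded

variable {k V M : Type*} [Field k] [AddCommGroup V] [Module k V] [AddCommGroup M] [Module k M]

/-! ### Cyclic cochains and scalar cochains -/

/-- Graded antisymmetry with respect to a single permutation. -/
def IsAltAt (𝒱 : ZMod 2 → Submodule k V) {n : ℕ} (φ : Multi k n V M) (σ : Equiv.Perm (Fin n)) :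
    Prop :=
  ∀ p v, Homog 𝒱 p v → φ v = (Equiv.Perm.sign σ * koszul p σ) • φ (fun i => v (σ i))

theorem IsAltAt.mul {𝒱 : ZMod 2 → Submodule k V} {n : ℕ} {φ : Multi k n V M}
    {σ τ : Equiv.Perm (Fin n)} (hσ : IsAltAt 𝒱 φ σ) (hτ : IsAltAt 𝒱 φ τ) :
    IsAltAt 𝒱 φ (σ * τ) := by
  intro p v hv
  rw [hσ p v hv, hτ _ _ (hv.comp σ), smul_smul, koszul_mul, Equiv.Perm.sign_mul,
    mul_mul_mul_comm]
  rfl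

theorem tilde_apply (B : V →ₗ[k] V →ₗ[k] k) {n : ℕ} (φ : Multi k n V V) (v : Fin (n + 1) → V) :
    tilde B φ v = B (φ fun i => v i.castSucc) (v (Fin.last n)) := rfl

theorem tilde_snoc (B : V →ₗ[k] V →ₗ[k] k) {n : ℕ} (φ : Multi k n V V) (v : Fin n → V) (y : V) :
    tilde B φ (Fin.snoc (α := fun _ => V) v y) = B (φ v) y := by
  rw [tilde_apply]
  simp

/-- The isomorphism `φ ↦ φ~`. -/
def tildeEquiv (B : V →ₗ[k] V →ₗ[k] k) (hB : Function.Bijective B) (n : ℕ) :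
    Multi k n V V ≃ₗ[k] Multi k (n + 1) V k :=
  LinearEquiv.ofBijective
    { toFun := tilde B
      map_add' := by
        intro φ ψ
        ext v
        simp [tilde_apply]
      map_smul' := by
        intro c φ
        ext v
        simp [tilde_apply] }
    (by
      constructor
      · intro φ ψ h
        ext v
        refine hB.1 (LinearMap.ext fun y => ?_)
        rw [← tilde_snoc, ← tilde_snoc]
        exact congrArg (fun F : Multi k (n + 1) V k => F (Fin.snoc (α := fun _ => V) v y)) h
      · intro f
        -- The preimage regards f as a map into the dual of V and applies the inverse of B.
        refine ⟨(LinearEquiv.ofBijective B hB).symm.toLinearMap.compMultilinearMap f.curryRight, ?_⟩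
        ext v
        change B ((LinearEquiv.ofBijective B hB).symm (f.curryRight fun i => v i.castSucc))
          (v (Fin.last n)) = f v
        rw [show B ((LinearEquiv.ofBijective B hB).symm (f.curryRight fun i => v i.castSucc)) =
          f.curryRight fun i => v i.castSucc from
            (LinearEquiv.ofBijective B hB).apply_symm_apply _, MultilinearMap.curryRight_apply]
        congr 1
        exact Fin.snoc_init_self v)

theorem tildeEquiv_apply (B : V →ₗ[k] V →ₗ[k] k) (hB : Function.Bijective B) {n : ℕ}
    (φ : Multi k n V V) : tildeEquiv B hB n φ = tilde B φ := rfl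

variable {𝒱 : ZMod 2 → Submodule k V} {B : V →ₗ[k] V →ₗ[k] k} {q : ZMod 2}

theorem groundGrading_mem_iff {i : ZMod 2} {c : k} : c ∈ groundGrading k i ↔ (i ≠ 0 → c = 0) := by
  rw [groundGrading]
  split_ifs with h
  · simp [h]
  · simp [h]

theorem bilin_units_smul_left (B : V →ₗ[k] V →ₗ[k] M) (u : ℤˣ) (x y : V) :
    B (u • x) y = u • B x y := by
  rw [units_smul_eq (k := k), map_smul, LinearMap.smul_apply, ← units_smul_eq]

/-- As B is even, a component of φ(v) pairs only with vectors of its own parity. If φ~ has parity q,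
components of the wrong parity pair to zero with everything and vanish by nondegeneracy. -/
theorem hasParity_tilde_iff [DirectSum.Decomposition 𝒱] (hB : IsInnerProduct 𝒱 B) {n : ℕ}
    {φ : Multi k n V V} :
    HasParity 𝒱 (groundGrading k) q (tilde B φ) ↔ HasParity 𝒱 𝒱 q φ := by
  constructor
  · intro h p v hv
    have key : ∀ j, j ≠ q + ∑ i, p i → parityProj 𝒱 j (φ v) = 0 := by
      intro j hj
      refine hB.nondegenerate.1 (LinearMap.ext fun y => ?_)
      rw [map_zero, LinearMap.zero_apply, ← sum_parityProj 𝒱 y, map_sum]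
      refine Finset.sum_eq_zero fun i _ => ?_
      have hy := parityProj_mem 𝒱 i y
      rcases eq_or_ne j i with rfl | hij
      · have h1 : B (φ v) (parityProj 𝒱 j y) = 0 := by
          have := h _ _ (hv.snoc hy)
          rw [tilde_snoc, groundGrading_mem_iff, Fin.sum_univ_castSucc] at this
          simp only [Fin.snoc_castSucc, Fin.snoc_last] at this
          refine this fun h0 => hj ?_
          rw [← add_assoc] at h0
          exact (CharTwo.add_eq_zero.1 h0).symm
        rw [← h1]
        conv_rhs => rw [← sum_parityProj 𝒱 (φ v)]
        rw [map_sum, LinearMap.sum_apply, Finset.sum_eq_single j]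
        · intro j' _ hj'
          exact hB.even _ _ hj' _ (parityProj_mem 𝒱 _ _) _ hy
        · intro hn
          exact absurd (Finset.mem_univ _) hn
      · exact hB.even _ _ hij _ (parityProj_mem 𝒱 _ _) _ hy
    rw [← sum_parityProj 𝒱 (φ v), Finset.sum_eq_single (q + ∑ i, p i)]
    · exact parityProj_mem 𝒱 _ _
    · exact fun j _ hj => key j hj
    · intro hn
      exact absurd (Finset.mem_univ _) hn
  · intro h p v hv
    rw [groundGrading_mem_iff, tilde_apply, Fin.sum_univ_castSucc, ← add_assoc]
    intro h0
    refine hB.even _ _ (fun he => h0 ?_) _ (h _ _ (hv.comp Fin.castSucc)) _ (hv (Fin.last n))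
    rw [he, zmod2_add_self]

theorem isAltAt_tilde_extPerm_iff [DirectSum.Decomposition 𝒱] (hB : Function.Injective B) {n : ℕ}
    {φ : Multi k n V V} (σ : Equiv.Perm (Fin n)) :
    IsAltAt 𝒱 (tilde B φ) (extPerm σ) ↔ IsAltAt 𝒱 φ σ := by
  have e : ∀ (p : Fin (n + 1) → ZMod 2) (v : Fin (n + 1) → V),
      (tilde B φ v = (Equiv.Perm.sign (extPerm σ) * koszul p (extPerm σ)) •
        tilde B φ (fun i => v (extPerm σ i))) ↔
      B (φ fun i => v i.castSucc) (v (Fin.last n)) =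
        B ((Equiv.Perm.sign σ * koszul (fun i => p i.castSucc) σ) •
          φ (fun i => v (σ i).castSucc)) (v (Fin.last n)) := by
    intro p v
    rw [tilde_apply, tilde_apply, sign_extPerm, koszul_extPerm, bilin_units_smul_left]
    simp only [extPerm_castSucc, extPerm_last]
  constructor
  · intro h p v hv
    refine hB (LinearMap.ext fun y => ?_)
    rw [← sum_parityProj 𝒱 y, map_sum, map_sum]
    refine Finset.sum_congr rfl fun i _ => ?_
    have := (e _ _).1 (h _ _ (hv.snoc (parityProj_mem 𝒱 i y)))
    simpa using this
  · intro h p v hv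
    refine (e p v).2 ?_
    rw [h _ _ (hv.comp Fin.castSucc)]

/-- The rotation has exponent n + p₀ Σ, with Σ the sum of the other parities, and graded symmetry of
B has p₀ (q + Σ). They differ by n + p₀ q, the cyclic sign. -/
theorem isAltAt_tilde_rotation_iff (hB : IsInnerProduct 𝒱 B) {n : ℕ} {φ : Multi k n V V}
    (hφ : HasParity 𝒱 𝒱 q φ) : IsAltAt 𝒱 (tilde B φ) (skipPerm 0) ↔ IsCyclic 𝒱 B q φ := by
  refine forall_congr' fun p => forall_congr' fun v => forall_congr' fun hv => ?_
  rw [tilde_apply, tilde_apply, sign_skipPerm, koszul_skipPerm_zero,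
    hB.symm _ _ _ (hv 0) _ (hφ _ _ (hv.comp Fin.succ)), sgn_smul_smul, ← sgn_add, skipPerm_last]
  simp only [skipPerm_castSucc, Fin.succAbove_zero]
  have : ((n - ((0 : Fin (n + 1)) : ℕ) : ℕ) : ZMod 2) + p 0 * ∑ i : Fin n, p i.succ =
      n + p 0 * q + p 0 * (q + ∑ i : Fin n, p i.succ) := by
    rw [Fin.val_zero, Nat.sub_zero]
    linear_combination -(p 0 * q) * two_eq_zero
  rw [this]

/-- Every permutation either fixes the last argument or is a product of such permutations and one
rotation, and antisymmetry at two permutations passes to their product. -/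
theorem tilde_mem_scalarCochains_iff [DirectSum.Decomposition 𝒱] (hB : IsInnerProduct 𝒱 B) {n : ℕ}
    {φ : Multi k (n + 1) V V} :
    tilde B φ ∈ scalarCochains 𝒱 q (n + 2) ↔ φ ∈ cyclicCochains 𝒱 B q (n + 1) := by
  constructor
  · rintro ⟨h1, h2⟩
    have hpar := (hasParity_tilde_iff hB).1 h1
    exact ⟨hpar, fun σ => (isAltAt_tilde_extPerm_iff hB.nondegenerate.1 σ).1 (h2 (extPerm σ)),
      (isAltAt_tilde_rotation_iff hB hpar).1 (h2 (skipPerm 0))⟩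
  · rintro ⟨h1, h2, h3⟩
    refine ⟨(hasParity_tilde_iff hB).2 h1, fun π => ?_⟩
    change IsAltAt 𝒱 (tilde B φ) π
    have hext : ∀ σ, IsAltAt 𝒱 (tilde B φ) (extPerm σ) :=
      fun σ => (isAltAt_tilde_extPerm_iff hB.nondegenerate.1 σ).2 (h2 σ)
    by_cases hπ : π (Fin.last (n + 1)) = Fin.last (n + 1)
    · obtain ⟨τ, rfl⟩ := exists_eq_extPerm π hπ
      exact hext τ
    · obtain ⟨τ, τ', rfl⟩ := exists_eq_mul_rotation π hπ
      exact (hext τ).mul (((isAltAt_tilde_rotation_iff hB h1).2 h3).mul (hext τ'))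

/-! ### Comparison of the differentials -/

theorem insertMap_two {a : ℕ} (h : 2 + a = a + 2) (f : Multi k (a + 1) V M) (l : Multi k 2 V V)
    (w : Fin (a + 2) → V) :
    insertMap h f l w = f (Fin.cons (l ![w 0, w 1]) fun j => w j.succ.succ) := by
  rw [insertMap_apply, eq_pair fun i => w (Fin.cast h (Fin.castAdd a i))]
  congr 2
  funext j
  congr 1
  ext
  simp

/-- Unshuffles that leave the last argument outside the bracket give the terms of dφ with a bracket
inside φ. In the others, antisymmetry of φ~ moves [v_i, v_last] to the end, and invariance gives
⟨φ(…), [v_i, v_last]⟩ = ⟨[φ(…), v_i], v_last⟩. -/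
theorem scalarDifferential_tilde [DirectSum.Decomposition 𝒱] {l : Multi k 2 V V}
    (hl : IsLieBracket 𝒱 l) (hB : IsInnerProduct 𝒱 B) (hinv : IsInvariantForm l B) {a : ℕ}
    {φ : Multi k (a + 1) V V} (hφ : φ ∈ cyclicCochains 𝒱 B q (a + 1)) :
    scalarDifferential 𝒱 l (a + 1) (tilde B φ) = tilde B (lieDifferential 𝒱 l a φ) := by
  have halt := ((tilde_mem_scalarCochains_iff hB).2 hφ).2
  refine Multi.ext_homog 𝒱 fun p v hv => ?_
  rw [tilde_apply]
  change extComp 𝒱 _ (tilde B φ) l v = B (extComp 𝒱 _ φ l _ -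
    sgn a • extComp 𝒱 (a := 1) rfl l φ _) _
  rw [extComp_apply_homog 𝒱 _ _ _ hv, extComp_apply_homog 𝒱 _ _ _ (hv.comp Fin.castSucc),
    extComp_apply_homog 𝒱 _ _ _ (hv.comp Fin.castSucc), sum_unshuffles_two, sum_unshuffles_last,
    map_sub, LinearMap.sub_apply, sub_eq_add_neg]
  congr 1
  · rw [map_sum, LinearMap.sum_apply]
    refine Finset.sum_congr rfl fun τ _ => ?_
    rw [sign_extPerm, koszul_extPerm, bilin_units_smul_left, insertMap_two, insertMap_two,
      tilde_apply]
    congr 1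
    have e : (fun i : Fin (a + 1) => (Fin.cons (l ![v (extPerm τ 0), v (extPerm τ 1)])
        fun j => v (extPerm τ j.succ.succ) : Fin (a + 2) → V) i.castSucc) =
        Fin.cons (l ![v (τ 0).castSucc, v (τ 1).castSucc]) fun j => v (τ j.succ.succ).castSucc := by
      funext i
      induction i using Fin.cases with
      | zero =>
        rw [← extPerm_castSucc, ← extPerm_castSucc]
        rfl
      | succ j =>
        rw [← Fin.succ_castSucc, Fin.cons_succ, Fin.cons_succ, ← extPerm_castSucc]
        rfl
    rw [e, ← Fin.succ_last, Fin.cons_succ, Fin.succ_last, Fin.succ_last, extPerm_last]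
  · rw [bilin_units_smul_left, map_sum, LinearMap.sum_apply, Finset.smul_sum,
      ← Finset.sum_neg_distrib]
    refine Finset.sum_congr rfl fun i _ => ?_
    have h0 : (extPerm (skipPerm i) * rotateTwo (a + 1)) 0 = i.castSucc := by
      rw [Equiv.Perm.mul_apply, rotateTwo_zero, extPerm_castSucc, skipPerm_last]
    have h1 : (extPerm (skipPerm i) * rotateTwo (a + 1)) 1 = Fin.last (a + 2) := by
      rw [Equiv.Perm.mul_apply, rotateTwo_one, extPerm_last]
    have h2 : ∀ j : Fin (a + 1), (extPerm (skipPerm i) * rotateTwo (a + 1)) j.succ.succ =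
        (i.succAbove j).castSucc := by
      intro j
      rw [Equiv.Perm.mul_apply, rotateTwo_succ_succ, extPerm_castSucc, skipPerm_castSucc]
    rw [bilin_units_smul_left, insertMap_pair, insertMap_two, h0, h1]
    simp only [h2, skipPerm_castSucc, skipPerm_last]
    rw [halt.cons_eq_snoc (hv.comp fun j => (i.succAbove j).castSucc)
      (hl.map_mem (hv i.castSucc) (hv (Fin.last (a + 2)))), tilde_snoc, ← hinv,
      koszul_mul, Equiv.Perm.sign_mul, sign_extPerm, koszul_extPerm, sign_rotateTwo,
      koszul_rotateTwo]
    simp only [extPerm_castSucc, extPerm_last, skipPerm_castSucc, skipPerm_last]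
    rw [mul_one, ← Units.neg_smul, smul_smul, smul_smul, sgn_add, Nat.cast_add_one, sgn_add, sgn_one]
    congr 1
    -- Moving the bracket to the end produces the same Koszul sign s as `rotateTwo`, so s² = 1 drops
    -- out and -(-1)^a remains.
    generalize sgn ((p i.castSucc + p (Fin.last (a + 2))) * _) = s
    rcases Int.units_eq_one_or s with rfl | rfl <;> simp [mul_comm]

end Graded

section Graded

variable {k V : Type*} [Field k] [AddCommGroup V] [Module k V]
variable {𝒱 : ZMod 2 → Submodule k V} [DirectSum.Decomposition 𝒱] {B : V →ₗ[k] V →ₗ[k] k}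
variable {l : Multi k 2 V V}

/-! ### Comparison of the cohomologies -/

theorem map_tildeEquiv_cyclicCochains (hB : IsInnerProduct 𝒱 B) (q : ZMod 2) (n : ℕ) :
    (cyclicCochains 𝒱 B q (n + 1)).map (tildeEquiv B hB.nondegenerate (n + 1)).toLinearMap =
      scalarCochains 𝒱 q (n + 2) := by
  ext f
  rw [Submodule.mem_map_equiv, ← tilde_mem_scalarCochains_iff hB, ← tildeEquiv_apply B
    hB.nondegenerate, LinearEquiv.apply_symm_apply]

theorem map_tildeEquiv_cyclicCocycles (hl : IsLieBracket 𝒱 l) (hB : IsInnerProduct 𝒱 B)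
    (hinv : IsInvariantForm l B) (q : ZMod 2) (a : ℕ) :
    (cyclicCocycles 𝒱 l B q a).map (tildeEquiv B hB.nondegenerate (a + 1)).toLinearMap =
      scalarCocycles 𝒱 l q (a + 1) := by
  ext f
  obtain ⟨φ, rfl⟩ := (tildeEquiv B hB.nondegenerate (a + 1)).surjective f
  rw [Submodule.mem_map_equiv, LinearEquiv.symm_apply_apply, tildeEquiv_apply]
  refine Iff.trans (and_congr_right fun hφ => ?_)
    (and_congr_left' (tilde_mem_scalarCochains_iff hB).symm)
  change lieDifferential 𝒱 l a φ = 0 ↔ scalarDifferential 𝒱 l (a + 1) (tilde B φ) = 0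
  rw [scalarDifferential_tilde hl hB hinv hφ, ← tildeEquiv_apply B hB.nondegenerate,
    LinearEquiv.map_eq_zero_iff]

/-- The isomorphism `φ ↦ φ~` from cyclic cocycles to cocycles with trivial coefficients. -/
def tildeCocycles (hl : IsLieBracket 𝒱 l) (hB : IsInnerProduct 𝒱 B)
    (hinv : IsInvariantForm l B) (q : ZMod 2) (a : ℕ) :
    cyclicCocycles 𝒱 l B q a ≃ₗ[k] scalarCocycles 𝒱 l q (a + 1) :=
  (tildeEquiv B hB.nondegenerate (a + 1)).ofSubmodules _ _
    (map_tildeEquiv_cyclicCocycles hl hB hinv q a)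

/-- Coboundaries correspond because both the cochains and the differentials do. The case of cyclic
degree 1 is excluded: scalar 2-coboundaries come from 1-cochains, which correspond to no cyclic
cochain of degree at least 1. -/
theorem map_tildeEquiv_cyclicCoboundaries (hl : IsLieBracket 𝒱 l) (hB : IsInnerProduct 𝒱 B)
    (hinv : IsInvariantForm l B) (q : ZMod 2) (a : ℕ) :
    (cyclicCoboundaries 𝒱 l B q (a + 1)).map
        (tildeEquiv B hB.nondegenerate (a + 2)).toLinearMap =
      scalarCoboundaries 𝒱 l q (a + 2) := by
  rw [cyclicCoboundaries, scalarCoboundaries, ← map_tildeEquiv_cyclicCochains hB,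
    ← Submodule.map_comp, ← Submodule.map_comp]
  ext f
  refine exists_congr fun φ => and_congr_right fun hφ => ?_
  change tilde B (lieDifferential 𝒱 l a φ) = f ↔
    scalarDifferential 𝒱 l (a + 1) (tilde B φ) = f
  rw [scalarDifferential_tilde hl hB hinv hφ]

/-- The isomorphism `HCⁿ(V) ≅ Hⁿ⁺¹(V, k)` for `n = a + 2`. -/
def tildeCohomology (hl : IsLieBracket 𝒱 l) (hB : IsInnerProduct 𝒱 B)
    (hinv : IsInvariantForm l B) (q : ZMod 2) (a : ℕ) :
    CyclicCohomology 𝒱 l B q (a + 1) ≃ₗ[k] ScalarCohomology 𝒱 l q (a + 2) :=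
  Submodule.Quotient.equiv _ _ (tildeCocycles hl hB hinv q (a + 1)) (by
    ext f
    obtain ⟨φ, rfl⟩ := (tildeCocycles hl hB hinv q (a + 1)).surjective f
    refine Iff.trans (Submodule.mem_map_equiv _) ?_
    rw [LinearEquiv.symm_apply_apply]
    change (φ : Multi k (a + 2) V V) ∈ cyclicCoboundaries 𝒱 l B q (a + 1) ↔
      tilde B (φ : Multi k (a + 2) V V) ∈ scalarCoboundaries 𝒱 l q (a + 2)
    rw [← map_tildeEquiv_cyclicCoboundaries hl hB hinv, ← tildeEquiv_apply B hB.nondegenerate,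
      Submodule.mem_map_equiv, LinearEquiv.symm_apply_apply])

/-- The isomorphism of `HC¹(V)` with the space of `2`-cocycles with trivial coefficients. -/
def tildeCohomologyOne (hl : IsLieBracket 𝒱 l) (hB : IsInnerProduct 𝒱 B)
    (hinv : IsInvariantForm l B) (q : ZMod 2) :
    CyclicCohomology 𝒱 l B q 0 ≃ₗ[k] scalarCocycles 𝒱 l q 1 :=
  (Submodule.quotEquivOfEqBot _ (Submodule.ker_subtype _)).trans (tildeCocycles hl hB hinv q 0)

end Graded

end CyclicLInfinity

end

open CyclicLInfinity

theorem mainTheorem8 {k V : Type*} [Field k] [CharZero k] [AddCommGroup V] [Module k V]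
    (𝒱 : ZMod 2 → Submodule k V) [DirectSum.Decomposition 𝒱]
    (l : Multi k 2 V V) (hl : IsLieBracket 𝒱 l)
    (B : V →ₗ[k] V →ₗ[k] k) (hB : IsInnerProduct 𝒱 B) (hinv : IsInvariantForm l B) :
    -- The deformations with a parameter of parity `p` are in bijection with the sequences of
    -- cyclic cocycles `λₙ`, `n = a + 1 ≥ 1`, of parity `p + n`, and their equivalence classes
    -- with the sequences of cyclic cohomology classes.
    (∀ p : ZMod 2,
      Equivalence (Deformation.IsEquivalent (𝒱 := 𝒱) (l := l) (B := B) (p := p)) ∧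
      ∃ Φ : Deformation 𝒱 l B p ≃ (∀ a : ℕ, cyclicCocycles 𝒱 l B (p + (a + 1 : ℕ)) a),
        (∀ m a, (Φ m a : Multi k (a + 1) V V) = m.cochain (a + 1)) ∧
        ∃ Ψ : Quot (Deformation.IsEquivalent (𝒱 := 𝒱) (l := l) (B := B) (p := p)) ≃
            (∀ a : ℕ, CyclicCohomology 𝒱 l B (p + (a + 1 : ℕ)) a),
          ∀ m a, Ψ (Quot.mk _ m) a = Submodule.Quotient.mk (Φ m a)) ∧
    -- `HCⁿ(V) ≅ Hⁿ⁺¹(V, k)` for `n = a + 2 ≥ 2`.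
    (∀ (q : ZMod 2) (a : ℕ),
      ∃ Θ : CyclicCohomology 𝒱 l B q (a + 1) ≃ₗ[k] ScalarCohomology 𝒱 l q (a + 2),
        ∀ φ : cyclicCocycles 𝒱 l B q (a + 1), ∃ f : scalarCocycles 𝒱 l q (a + 2),
          (f : Multi k (a + 3) V k) = tilde B (φ : Multi k (a + 2) V V) ∧
          Θ (Submodule.Quotient.mk φ) = Submodule.Quotient.mk f) ∧
    -- `HC¹(V)` is isomorphic to the space of `2`-cocycles with trivial coefficients.
    (∀ q : ZMod 2,
      ∃ Θ : CyclicCohomology 𝒱 l B q 0 ≃ₗ[k] scalarCocycles 𝒱 l q 1,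
        ∀ φ : cyclicCocycles 𝒱 l B q 0,
          (Θ (Submodule.Quotient.mk φ) : Multi k 2 V k) = tilde B (φ : Multi k 1 V V)) := by
  exact ⟨fun p => ⟨Deformation.equivalence_isEquivalent hl hinv, deformationEquiv hl hinv,
      fun _ _ => rfl, deformationClassEquiv hl hinv, fun _ _ => rfl⟩,
    fun q a => ⟨tildeCohomology hl hB hinv q a, fun φ =>
      ⟨tildeCocycles hl hB hinv q (a + 1) φ, rfl, rfl⟩⟩,
    fun q => ⟨tildeCohomologyOne hl hB hinv q, fun _ => rfl⟩⟩
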